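/- **Model.** A network is a strongly connected directed graph with $n\ge 2$ nodes; $D$ (its eccentricity) is the maximum directed distance between two nodes. Nodes know only $n$ and $D$. Time is synchronous. In each step a node either transmits a bit string of $O(\log n)$ bits to all its out-neighbours or listens; a listening node receives a message if and only if exactly one of its in-neighbours transmits, and otherwise it receives nothing (no collision detection). Nodes use private independent random coins. Logarithms are binary, $\log n$ and $\sqrt{\log n}$ stand for $\lceil\log n\rceil$ and $\lceil\sqrt{\lceil\log n\rceil}\,\rceil$ where integers are needed, probabilities are capped at $1$, and bit strings of equal length are compared as binary numbers. Put $T_{BC}=D\log\frac{2n}{D}+\log^2 n$ (so $T_{BC}=\Theta(D\log\frac nD+\log^2 n)$ when $D\le n/2$). **Procedures.** All of them take a predetermined number of steps. - *Partial Multi-Broadcast*$(S,f,l)$, where $l=O(\log n)$ and each source $s\in S$ has a string $f(s)\in\{0,1\}^l$: every node $v$ ends with a string $m(v)$, where $m(v)=\varepsilon$ for all $v$ if $S=\emptyset$, and otherwise each $m(v)$ is $f(s)$ for some $s\in S$. - *Decay*: in step $i=1,\dots,\log n$ each participant transmits its current string with probability $2^{-i}$; the other nodes listen. - *Selection*$(S)$,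 for sources with $l$-bit IDs: $m\gets$ Partial Multi-Broadcast$(S,\mathrm{ID},l)$. A node with $m(v)=\varepsilon$ outputs $(\varepsilon,0)$. Otherwise, for $i=1,\dots,l$: the nodes with $m(v)_i=1$ perform four rounds of Decay with their strings $m(v)$; a node with $m(v)_i=0$ that receives something becomes a witness and replaces $m(v)$ by the maximum of $m(v)$ and the received strings. Then $p\gets$ Partial Multi-Broadcast$(W,m,l)$, where $W$ is the set of witnesses; $v$ outputs $(m(v),1)$ if $p(v)=\varepsilon$ and $(p(v),0)$ otherwise. - *Search*$(C,k)$: for $i=1,\dots,k$, the nodes of $C$ whose ID agrees with the bits $m(v)_1\dots m(v)_{i-1}$ found so far and has $i$-th bit $1$ are the sources of a Partial Multi-Broadcast of the one-bit string $1$; $v$ sets $m(v)_i=0$ if it interprets $\varepsilon$, and $m(v)_i=1$ otherwise. **Algorithm** with constants $(\alpha,\beta,\gamma)$. Each node independently joins the candidate set $C$ with probability $\alpha\log n/n$, and each candidate chooses a uniformly random ID of $\beta\log n$ bits. Then $m\gets$ Search$(C,\sqrt{\log n})$, and candidates whose first $\sqrt{\log n}$ ID bits differ from $m(v)$ leave $C$.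 Then, $\gamma\sqrt{\log n}$ times: $(p,b)\gets$ Selection$(C)$; a node with $b=1$ outputs $p(v)$ and stops; otherwise a candidate with $p(v)>\mathrm{ID}(v)$ leaves $C$. **Theorem.** Say that the algorithm with constants $(\alpha,\beta,\gamma)$ *works with exponent $c$ for $n\ge n_0$* if there are a constant $K$ and a Partial Multi-Broadcast procedure which, on every network with $n\ge n_0$ nodes and for all lengths $l\le\beta\log n$, takes a fixed time of at most $K\,T_{BC}$ steps and is correct with probability at least $1-n^{-c}$, such that on every network with $n\ge n_0$ nodes the algorithm run with this procedure always stops within a fixed time $T(n,D)\le K\,T_{BC}\sqrt{\log n}$, uses messages of at most $K\log n$ bits, and with probability at least $1-n^{-c}$ all of the following hold: 1. all nodes output the same ID, and precisely one node has this ID as its own; 2. after Search, at least $1$ and at most $\gamma\sqrt{\log n}$ candidates remain; 3. each iteration of Selection that starts with more than one candidate removes the candidate with the minimum ID, and leaves at least one candidate. Then (i) for some $n_0\ge 2$ the algorithm with constants $(4,16,3)$ works with exponent $1$ for $n\ge n_0$; and (ii) for every $c\ge1$ there are constants $(\alpha,\beta,\gamma)$ with which the algorithm works with exponent $c$ for $n\ge2$.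 -/

import Mathlib

namespace RadioNetwork

open scoped ENNReal NNReal

/-! ### Probability: independent families of discrete random variables -/

theorem tsum_fin_prod {β : Type} : ∀ (n : ℕ) (p : Fin n → β → ℝ≥0∞),
    ∑' f : Fin n → β, ∏ i, p i (f i) = ∏ i, ∑' b, p i b
  | 0, p => by
      rw [tsum_eq_single (fun i => i.elim0)
        (fun f hf => absurd (funext fun i => i.elim0) hf)]
      simp
  | n + 1, p => by
      rw [← (Fin.consEquiv fun _ : Fin (n + 1) => β).tsum_eq, ENNReal.tsum_prod',
        Fin.prod_univ_succ, ← tsum_fin_prod n (fun i => p i.succ), ← ENNReal.tsum_mul_right]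
      refine tsum_congr fun b => ?_
      rw [← ENNReal.tsum_mul_left]
      refine tsum_congr fun f => ?_
      simp [Fin.consEquiv, Fin.prod_univ_succ]

theorem tsum_pi_prod {V β : Type} [Fintype V] (p : V → β → ℝ≥0∞) :
    ∑' f : V → β, ∏ v, p v (f v) = ∏ v, ∑' b, p v b := by
  let e := (Fintype.equivFin V).symm
  rw [← (Equiv.arrowCongr e (Equiv.refl β)).tsum_eq, ← e.prod_comp,
    ← tsum_fin_prod _ (fun i => p (e i))]
  refine tsum_congr fun f => ?_
  rw [← e.prod_comp]
  simp [Equiv.arrowCongr]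

/-- The law of a family of independent random variables, the `v`-th one with law `p v`. -/
noncomputable def indep {V β : Type} [Fintype V] (p : V → PMF β) : PMF (V → β) :=
  ⟨fun f => ∏ v, p v (f v), by
    have h : ∑' f : V → β, ∏ v, p v (f v) = 1 := by
      rw [tsum_pi_prod (fun v b => p v b)]
      simp [PMF.tsum_coe]
    exact h ▸ ENNReal.summable.hasSum⟩

/-- A biased coin: `true` with probability `p`. -/
noncomputable def coinPMF (p : ℝ≥0) (h : p ≤ 1) : PMF Bool :=
  PMF.ofFintype (fun b => if b then (p : ℝ≥0∞) else ((1 - p : ℝ≥0) : ℝ≥0∞)) (by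
    simp only [Fintype.univ_bool, Finset.mem_singleton, Bool.true_eq_false, not_false_eq_true,
      Finset.sum_insert, Finset.sum_singleton, if_true, Bool.false_eq_true, if_false]
    rw [← ENNReal.coe_add, add_tsub_cancel_of_le h, ENNReal.coe_one])

/-! ### Directed networks -/

/-- There is a directed walk with exactly `k` edges from `u` to `v`. -/
def ReachIn {V : Type} (G : Digraph V) : ℕ → V → V → Prop
  | 0, u, v => u = v
  | k + 1, u, v => ∃ w, ReachIn G k u w ∧ G.Adj w v

/-- `G` is strongly connected and the maximum directed distance between any pair of nodes (the
eccentricity of the network) is exactly `D`. -/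
def HasEccentricity {V : Type} (G : Digraph V) (D : ℕ) : Prop :=
  (∀ u v, ∃ k ≤ D, ReachIn G k u v) ∧ ∃ u v, ∀ k < D, ¬ ReachIn G k u v

/-! ### Node programs and their synchronous execution without collision detection -/

/-- Bit strings, most significant bit first. The order on them is the lexicographic one, which for
strings of equal length is the order of the numbers they denote. -/
abbrev Bits := List Bool

/-- A randomized program of a single node: it stops with an output, or flips a private biased coin,
or spends one time step. In a time step `step (some x) k` it transmits `x`; in a time step
`step none k` it listens, and it goes on with `k r` where `r` is what it received. -/
inductive Prog (α : Type) : Type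
  | done (a : α) : Prog α
  | coin (p : ℝ≥0) (hp : p ≤ 1) (k : Bool → Prog α) : Prog α
  | step (x : Option Bits) (k : Option Bits → Prog α) : Prog α

namespace Prog

/-- Sequential composition. -/
def bind {α β : Type} : Prog α → (α → Prog β) → Prog β
  | done a, f => f a
  | coin p hp k, f => coin p hp fun b => (k b).bind f
  | step x k, f => step x fun r => (k r).bind f

instance : Monad Prog where
  pure := done
  bind := bind

/-- A coin that shows `true` with probability `min 1 p`. -/
noncomputable def flip (p : ℝ≥0) : Prog Bool := coin (min 1 p) (min_le_left 1 p) done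

/-- One time step; the result is the received message, if any. -/
def act (x : Option Bits) : Prog (Option Bits) := step x done

/-- Stay silent for `t` time steps. -/
def idle : ℕ → Prog Unit
  | 0 => done ()
  | t + 1 => step none fun _ => idle t

/-- On every branch, the program takes exactly `t` time steps. -/
def HasDuration {α : Type} : Prog α → ℕ → Prop
  | done _, t => t = 0
  | coin _ _ k, t => ∀ b, (k b).HasDuration t
  | step _ k, t => ∃ s, t = s + 1 ∧ ∀ r, (k r).HasDuration s

/-- On every branch, the program takes at most `t` time steps. -/
def StepsLE {α : Type} : Prog α → ℕ → Prop
  | done _, _ => True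
  | coin _ _ k, t => ∀ b, (k b).StepsLE t
  | step _ k, t => ∃ s, t = s + 1 ∧ ∀ r, (k r).StepsLE s

/-- Every message sent by the program has at most `M` bits, provided that those which it receives
have at most `M` bits. -/
def MsgLE {α : Type} (M : ℕ) : Prog α → Prop
  | done _ => True
  | coin _ _ k => ∀ b, (k b).MsgLE M
  | step x k => (∀ y ∈ x, y.length ≤ M) ∧
      ∀ r : Option Bits, (∀ y ∈ r, y.length ≤ M) → (k r).MsgLE M

/-- Flip the coins that come before the next time step. -/
noncomputable def settle {α : Type} : Prog α → PMF (Prog α)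
  | done a => PMF.pure (done a)
  | coin p hp k => (coinPMF p hp).bind fun b => (k b).settle
  | step x k => PMF.pure (step x k)

/-- The message that a settled program transmits now. -/
def sends {α : Type} : Prog α → Option Bits
  | step x _ => x
  | _ => none

/-- Continue a settled program after a time step in which `r` arrives at the node; a transmitting
node hears nothing. -/
def resume {α : Type} (r : Option Bits) : Prog α → Prog α
  | step none k => k r
  | step (some _) k => k none
  | done a => done a
  | coin p hp k => coin p hp k

/-- The output, once the program has stopped. -/
def output {α : Type} : Prog α → Option α
  | done a => some a
  | _ => none

end Prog

open Classical in
/-- What arrives at `v`: if exactly one in-neighbour transmits, its message; otherwise nothing. -/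
noncomputable def heard {V : Type} (G : Digraph V) (x : V → Option Bits) (v : V) : Option Bits :=
  if h : ∃! u, G.Adj u v ∧ x u ≠ none then x h.choose else none

/-- The random configuration after `t` synchronous time steps, when every node `v` runs `P v` with
private independent coins. -/
noncomputable def exec {V α : Type} [Fintype V] (G : Digraph V) :
    ℕ → (V → Prog α) → PMF (V → Prog α)
  | 0, P => indep fun v => (P v).settle
  | t + 1, P => (indep fun v => (P v).settle).bind fun Q =>
      exec G t fun v => (Q v).resume (heard G (fun u => (Q u).sends) v)

/-- The probability that within `t` time steps all nodes have stopped, with outputs that satisfy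
`E`. -/
noncomputable def prob {V α : Type} [Fintype V] (G : Digraph V) (t : ℕ) (P : V → Prog α)
    (E : (V → α) → Prop) : ℝ≥0∞ :=
  (exec G t P).toOuterMeasure {Q | ∃ a : V → α, (∀ v, (Q v).output = some (a v)) ∧ E a}

/-! ### Parameters -/

/-- `⌈log₂ n⌉`. -/
def lg (n : ℕ) : ℕ := Nat.clog 2 n

/-- `⌈√⌈log₂ n⌉⌉`. -/
noncomputable def sqrtLg (n : ℕ) : ℕ := ⌈Real.sqrt (lg n)⌉₊

/-- `D log (2n/D) + log² n = D log (n/D) + D + log² n`, with binary logarithms. -/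
noncomputable def bcastTime (n D : ℕ) : ℝ :=
  D * Real.logb 2 (2 * n / D) + Real.logb 2 n ^ 2

/-! ### Partial Multi-Broadcast -/

/-- A family of programs for multi-source broadcast, which know only `n`, `D` and the message length
`l`. The input of a node is `some` of its message if it is a source and `none` otherwise; the output
is the string that the node interprets, `none` being the empty string `ε`. -/
structure MultiBroadcast where
  /-- the predetermined number of time steps -/
  time : ℕ → ℕ → ℕ
  /-- the program of a node -/
  run : (n D l : ℕ) → Option Bits → Prog (Option Bits)

/-- What Partial Multi-Broadcast with input `f` has to achieve: without sources, all nodes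
interpret `ε`; otherwise every node interprets the string of some source. -/
def MultiBroadcast.Correct {V : Type} (f m : V → Option Bits) : Prop :=
  ((∀ v, f v = none) → ∀ v, m v = none) ∧
  ((∃ s, f s ≠ none) → ∀ v, ∃ s, f s ≠ none ∧ m v = f s)

/-- On the network `G` with `n` nodes and eccentricity `D`, and for all strings of at most `lmax`
bits, `B` performs Partial Multi-Broadcast with probability at least `1 - n ^ (-c)`, in its fixed
time, which is at most `K (D log (2n/D) + log² n)`, and with messages of at most `K log n` bits. -/
def MultiBroadcast.Works (B : MultiBroadcast) {V : Type} [Fintype V] (G : Digraph V)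
    (n D lmax : ℕ) (c K : ℝ) : Prop :=
  (B.time n D : ℝ) ≤ K * bcastTime n D ∧
  ∀ l ≤ lmax,
    (∀ x : Option Bits, (B.run n D l x).HasDuration (B.time n D)) ∧
    (∀ x : Option Bits, (∀ y ∈ x, y.length = l) →
      (B.run n D l x).MsgLE ⌊K * Real.logb 2 n⌋₊) ∧
    ∀ f : V → Option Bits, (∀ v, ∀ y ∈ f v, y.length = l) →
      ENNReal.ofReal (1 - (n : ℝ) ^ (-c)) ≤
        prob G (B.time n D) (fun v => B.run n D l (f v)) (MultiBroadcast.Correct f)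

/-! ### Decay -/

/-- One round of Decay at a node: `x` is `some` of the node's message if it takes part and `none`
otherwise. For `i = 1, …, log n`, in time step `i`, a participant transmits with probability
`2 ^ (-i)`. The result is the list of the received messages. -/
noncomputable def decay (n : ℕ) (x : Option Bits) : Prog (List Bits) :=
  (List.range (lg n)).foldlM (fun got i => do
    let b ← Prog.flip ((2 : ℝ≥0)⁻¹ ^ (i + 1))
    let r ← Prog.act (if b then x else none)
    pure (got ++ r.toList)) []

/-- Four rounds of Decay. -/
noncomputable def decay4 (n : ℕ) (x : Option Bits) : Prog (List Bits) := do
  let r₁ ← decay n x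
  let r₂ ← decay n x
  let r₃ ← decay n x
  let r₄ ← decay n x
  pure (r₁ ++ r₂ ++ r₃ ++ r₄)

/-! ### Selection -/

/-- The middle part of Selection. For each bit position `i` below `l`, the nodes whose string `m`
has `i`-th bit `1` do four rounds of Decay with message `m`; a node with `i`-th bit `0` that
receives something becomes a witness and raises `m` to the maximum of `m` and what it received.
The result is the final `m` and whether the node is a witness. -/
noncomputable def findWitnesses (n l : ℕ) (m : Bits) : Prog (Bits × Bool) :=
  (List.range l).foldlM (fun (s : Bits × Bool) i => do
    let bit := s.1.getD i false
    let got ← decay4 n (if bit then some s.1 else none)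
    pure (if bit = false ∧ got ≠ [] then (got.foldl max s.1, true) else s)) (m, false)

/-- Selection with IDs of `l` bits: `x` is `some` of the node's ID if it is a source. -/
noncomputable def selection (B : MultiBroadcast) (n D l : ℕ) (x : Option Bits) :
    Prog (Option Bits × Bool) := do
  let m ← B.run n D l x
  match m with
  | none =>
    -- the rest of the fixed time of the procedure
    Prog.idle (l * (4 * lg n) + B.time n D)
    pure (none, false)
  | some m₀ =>
    let (m₁, witness) ← findWitnesses n l m₀
    let p ← B.run n D l (if witness then some m₁ else none)
    match p with
    | none => pure (some m₁, true)
    | some q => pure (some q, false)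

/-! ### Search -/

/-- Binary search for the first `k` bits of the highest ID in use; `id` is the node's ID if it is a
source. -/
noncomputable def search (B : MultiBroadcast) (n D k : ℕ) (id : Option Bits) : Prog Bits :=
  (List.range k).foldlM (fun (m : Bits) i => do
    let source := id.any fun x => decide (x.take i = m) && x.getD i false
    let p ← B.run n D 1 (if source then some [true] else none)
    pure (m ++ [p.isSome])) []

/-! ### Leader election -/

/-- The constants of the algorithm: nodes become candidates with probability `cand · log n / n`,
IDs have `bits · log n` bits, and there are `rounds · √log n` iterations of Selection. -/
structure Constants where
  cand : ℕ
  bits : ℕ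
  rounds : ℕ

/-- What a node holds at the end: its own ID (if it was a candidate), the ID it outputs as the
leader's (if any), and a record of its membership in the candidate set `C`; entry `0` is the
membership right after the Search phase, and entry `j` the membership after `j` iterations of
Selection. The record does not influence the execution. -/
structure Outcome where
  id : Option Bits
  leader : Option Bits
  record : List Bool

/-- A uniformly random string of `l` bits. -/
noncomputable def randomBits : ℕ → Prog Bits
  | 0 => pure []
  | l + 1 => do
    let b ← Prog.flip 2⁻¹
    let x ← randomBits l
    pure (b :: x)

/-- The loop of the algorithm with `k` iterations of Selection left, at a node with ID `id`;
`inC` says whether the node is in `C`. The result is the output and the record of membership. -/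
noncomputable def selectionLoop (B : MultiBroadcast) (n D l : ℕ) (id : Option Bits) :
    ℕ → Bool → Prog (Option Bits × List Bool)
  | 0, inC => pure (none, [inC])
  | k + 1, inC => do
    let (p, b) ← selection B n D l (if inC then id else none)
    if b then
      pure (p, List.replicate (k + 2) inC)
    else
      let higher := id.any fun x => p.any fun y => decide (x < y)
      let (out, rec) ← selectionLoop B n D l id k (inC && !higher)
      pure (out, inC :: rec)

/-- High-probability leader election, at a node of a network with `n` nodes and eccentricity `D`. -/
noncomputable def leaderElection (κ : Constants) (B : MultiBroadcast) (n D : ℕ) :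
    Prog Outcome := do
  let candidate ← Prog.flip ((κ.cand * lg n : ℝ≥0) / n)
  let id ← if candidate then some <$> randomBits (κ.bits * lg n) else pure none
  let m ← search B n D (sqrtLg n) id
  let inC := id.any fun x => decide (x.take (sqrtLg n) = m)
  let (out, rec) ← selectionLoop B n D (κ.bits * lg n) id (κ.rounds * sqrtLg n) inC
  pure ⟨id, out, rec⟩

/-- All nodes output the same ID, and this is the ID of precisely one node. -/
def LeaderElected {V : Type} (ω : V → Outcome) : Prop :=
  ∃ x : Bits, (∀ v, (ω v).leader = some x) ∧ ∃! v, (ω v).id = some x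

/-- The candidates after the Search phase and `j` iterations of Selection. -/
def candidates {V : Type} (ω : V → Outcome) (j : ℕ) : Set V :=
  {v | (ω v).record.getD j false = true}

/-- After the Search phase there is at least one candidate and there are at most `N`. -/
def SearchNarrows {V : Type} (N : ℕ) (ω : V → Outcome) : Prop :=
  1 ≤ (candidates ω 0).ncard ∧ (candidates ω 0).ncard ≤ N

/-- As long as there are several candidates, each of the `N` iterations of Selection removes the
candidate with the minimum ID and keeps some other candidate. -/
def SelectionEliminates {V : Type} (N : ℕ) (ω : V → Outcome) : Prop :=
  ∀ j < N, 1 < (candidates ω j).ncard →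
    (candidates ω (j + 1)).Nonempty ∧ candidates ω (j + 1) ⊆ candidates ω j ∧
    ∀ v ∈ candidates ω j, (∀ u ∈ candidates ω j, ∀ x ∈ (ω v).id, ∀ y ∈ (ω u).id, x ≤ y) →
      v ∉ candidates ω (j + 1)

/-- With the constants `κ`, on all directed networks with at least `n₀` nodes and with a suitable
Partial Multi-Broadcast procedure, the algorithm elects a leader with probability at least
`1 - n ^ (-c)`, and always stops within a fixed time that is at most
`K (D log (2n/D) + log² n) √log n`. -/
def ElectsLeader (κ : Constants) (c : ℝ) (n₀ : ℕ) : Prop :=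
  ∃ (B : MultiBroadcast) (T : ℕ → ℕ → ℕ) (K : ℝ),
    ∀ (n D : ℕ), n₀ ≤ n → ∀ (V : Type) [Fintype V] (G : Digraph V),
      Fintype.card V = n → HasEccentricity G D →
      B.Works G n D (κ.bits * lg n) c K ∧
      (T n D : ℝ) ≤ K * (bcastTime n D * Real.sqrt (Real.logb 2 n)) ∧
      (leaderElection κ B n D).StepsLE (T n D) ∧
      (leaderElection κ B n D).MsgLE ⌊K * Real.logb 2 n⌋₊ ∧
      ENNReal.ofReal (1 - (n : ℝ) ^ (-c)) ≤
        prob G (T n D) (fun _ => leaderElection κ B n D) (fun ω =>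
          LeaderElected ω ∧
          SearchNarrows (κ.rounds * sqrtLg n) ω ∧
          SelectionEliminates (κ.rounds * sqrtLg n) ω)

end RadioNetwork

/-!
Rank every node by the last of its out-neighbours on a shortest walk to a target. If the nodes of
the highest informed rank are `m` many, one pass of Decay through the levels `0, …, ⌈log m⌉` raises
that rank with constant probability. As the ranks partition the nodes, at most `D` ranks have
sizes summing to at most `n`, so levels up to `p = O(log (2n/D))` mostly suffice. The broadcast
procedure therefore uses levels `e p, …, e p + p - 1` only a fraction `2 ^ (-e)` of the time, and
also cycles through all levels. A potential that shrinks in the mean bounds its time by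
`O(D log (2n/D) + log² n)`.

With high probability there is a candidate, and few candidates share a prefix of `√log n` ID bits,
so few remain after Search. If several remain in an iteration of Selection, two of them start the
search for witnesses with their own random IDs, which differ in many of their `O(log n)` bits.
In each such position some edge leads from a node with bit `1` to a node with bit `0`, which misses
the four rounds of Decay with probability at most `(7/8) ^ 4`. A witness knows a string above the
minimum ID, so the candidate with the minimum ID leaves. If one candidate remains, there is no
witness and all nodes output its ID.
-/

namespace RadioNetwork

open scoped ENNReal NNReal

/-! ### Expectations over discrete laws -/

/-- The expectation of a nonnegative function under a discrete law. As a sum, it needs no measurable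
structure on the outcomes. -/
noncomputable def mean {α : Type*} (p : PMF α) (φ : α → ℝ≥0∞) : ℝ≥0∞ := ∑' a, p a * φ a

section Mean

variable {α β : Type*}

theorem mean_pure (a : α) (φ : α → ℝ≥0∞) : mean (PMF.pure a) φ = φ a := by
  unfold mean
  rw [tsum_eq_single a]
  · simp
  · intro b hb; simp [PMF.pure_apply, hb]

theorem mean_bind (p : PMF α) (f : α → PMF β) (φ : β → ℝ≥0∞) :
    mean (p.bind f) φ = mean p fun a => mean (f a) φ := by
  simp only [mean, PMF.bind_apply, ← ENNReal.tsum_mul_right, ← ENNReal.tsum_mul_left]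
  rw [ENNReal.tsum_comm]
  simp only [mul_assoc]

theorem mean_map (p : PMF α) (f : α → β) (φ : β → ℝ≥0∞) :
    mean (p.map f) φ = mean p fun a => φ (f a) := by
  rw [← PMF.bind_pure_comp, mean_bind]
  simp [mean_pure]

theorem mean_mono_support {p : PMF α} {φ ψ : α → ℝ≥0∞} (h : ∀ a ∈ p.support, φ a ≤ ψ a) :
    mean p φ ≤ mean p ψ := by
  refine ENNReal.tsum_le_tsum fun a => ?_
  by_cases ha : p a = 0
  · simp [ha]
  · exact mul_le_mul_right (h a ((PMF.mem_support_iff _ _).2 ha)) _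

theorem mean_mono {p : PMF α} {φ ψ : α → ℝ≥0∞} (h : ∀ a, φ a ≤ ψ a) : mean p φ ≤ mean p ψ :=
  mean_mono_support fun a _ => h a

theorem mean_congr_support {p : PMF α} {φ ψ : α → ℝ≥0∞} (h : ∀ a ∈ p.support, φ a = ψ a) :
    mean p φ = mean p ψ :=
  le_antisymm (mean_mono_support fun a ha => (h a ha).le)
    (mean_mono_support fun a ha => (h a ha).ge)

theorem mean_const (p : PMF α) (c : ℝ≥0∞) : mean p (fun _ => c) = c := by
  simp [mean, ENNReal.tsum_mul_right, p.tsum_coe]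

theorem mean_le_of_le {p : PMF α} {φ : α → ℝ≥0∞} {c : ℝ≥0∞} (h : ∀ a, φ a ≤ c) :
    mean p φ ≤ c :=
  (mean_mono h).trans (mean_const p c).le

theorem mean_add (p : PMF α) (φ ψ : α → ℝ≥0∞) :
    mean p (fun a => φ a + ψ a) = mean p φ + mean p ψ := by
  simp [mean, mul_add, ENNReal.tsum_add]

theorem mean_const_mul (p : PMF α) (c : ℝ≥0∞) (φ : α → ℝ≥0∞) :
    mean p (fun a => c * φ a) = c * mean p φ := by
  simp only [mean, ← ENNReal.tsum_mul_left]
  exact tsum_congr fun a => by ring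

theorem mean_finset_sum {ι : Type*} (s : Finset ι) (p : PMF α) (φ : ι → α → ℝ≥0∞) :
    mean p (fun a => ∑ i ∈ s, φ i a) = ∑ i ∈ s, mean p (φ i) := by
  classical
  induction s using Finset.induction_on with
  | empty => simp [mean]
  | insert i s hi ih => simp [Finset.sum_insert hi, mean_add, ih]

theorem mean_tsum {ι : Type*} (p : PMF α) (φ : ι → α → ℝ≥0∞) :
    mean p (fun a => ∑' i, φ i a) = ∑' i, mean p (φ i) := by
  simp only [mean, ← ENNReal.tsum_mul_left]
  exact ENNReal.tsum_comm

theorem pmf_bind_congr {p : PMF α} {f g : α → PMF β} (h : ∀ a ∈ p.support, f a = g a) :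
    p.bind f = p.bind g := by
  ext b
  simp only [PMF.bind_apply]
  refine tsum_congr fun a => ?_
  by_cases ha : p a = 0
  · simp [ha]
  · rw [h a ((PMF.mem_support_iff _ _).2 ha)]

theorem mean_coin (p : ℝ≥0) (h : p ≤ 1) (φ : Bool → ℝ≥0∞) :
    mean (coinPMF p h) φ = p * φ true + ((1 - p : ℝ≥0) : ℝ≥0∞) * φ false := by
  simp [mean, coinPMF]

end Mean

section Indep

variable {V α β : Type} [Fintype V]

theorem indep_apply (p : V → PMF β) (f : V → β) : indep p f = ∏ v, p v (f v) := rfl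

theorem apply_mem_support_of_mem_support_indep {p : V → PMF β} {f : V → β}
    (h : f ∈ (indep p).support) (v : V) : f v ∈ (p v).support := by
  rw [PMF.mem_support_iff, indep_apply, Finset.prod_ne_zero_iff] at h
  exact (PMF.mem_support_iff _ _).2 (h v (Finset.mem_univ v))

theorem indep_bind (p : V → PMF α) (f : V → α → PMF β) :
    (indep fun v => (p v).bind (f v)) = (indep p).bind fun b => indep fun v => f v (b v) := by
  ext g
  simp only [indep_apply, PMF.bind_apply]
  rw [← tsum_pi_prod (fun v b => p v b * f v b (g v))]
  simp only [Finset.prod_mul_distrib]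

theorem indep_pure (a : V → β) : (indep fun v => PMF.pure (a v)) = PMF.pure a := by
  classical
  ext g
  rw [indep_apply, PMF.pure_apply]
  split_ifs with h
  · subst h; simp
  · obtain ⟨v, hv⟩ := Function.ne_iff.1 h
    exact Finset.prod_eq_zero (Finset.mem_univ v) (by simp [PMF.pure_apply, hv])

theorem indep_map (p : V → PMF α) (f : V → α → β) :
    (indep fun v => (p v).map (f v)) = (indep p).map fun a v => f v (a v) := by
  simp only [← PMF.bind_pure_comp, Function.comp_def]
  rw [indep_bind]
  simp only [indep_pure]

theorem mean_indep_prod (p : V → PMF β) (φ : V → β → ℝ≥0∞) :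
    mean (indep p) (fun f => ∏ v, φ v (f v)) = ∏ v, mean (p v) (φ v) := by
  simp only [mean, indep_apply, ← Finset.prod_mul_distrib]
  exact tsum_pi_prod fun v b => p v b * φ v b

theorem mean_indep_prod_finset (s : Finset V) (p : V → PMF β) (φ : V → β → ℝ≥0∞) :
    mean (indep p) (fun f => ∏ v ∈ s, φ v (f v)) = ∏ v ∈ s, mean (p v) (φ v) := by
  classical
  have h := mean_indep_prod p fun v b => if v ∈ s then φ v b else 1
  have h1 : ∀ f : V → β, (∏ v, if v ∈ s then φ v (f v) else 1) = ∏ v ∈ s, φ v (f v) := fun f => by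
    rw [Finset.prod_ite_mem, Finset.univ_inter]
  have h2 : ∀ v, mean (p v) (fun b => if v ∈ s then φ v b else 1) =
      if v ∈ s then mean (p v) (φ v) else 1 := fun v => by
    split_ifs <;> simp [mean_const]
  simp only [h1, h2] at h
  rw [h, Finset.prod_ite_mem, Finset.univ_inter]

end Indep

/-! ### Programs -/

namespace Prog

variable {α β γ : Type}

theorem monad_pure_eq (a : α) : (pure a : Prog α) = done a := rfl

theorem monad_bind_eq (P : Prog α) (F : α → Prog β) : P >>= F = P.bind F := rfl

theorem bind_done (P : Prog α) : P.bind done = P := by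
  induction P with
  | done a => rfl
  | coin p hp k ih => simp [bind, ih]
  | step x k ih => simp [bind, ih]

theorem bind_assoc (P : Prog α) (F : α → Prog β) (H : β → Prog γ) :
    (P.bind F).bind H = P.bind fun a => (F a).bind H := by
  induction P with
  | done a => rfl
  | coin p hp k ih => simp [bind, ih]
  | step x k ih => simp [bind, ih]

instance : LawfulMonad Prog := LawfulMonad.mk'
  (id_map := fun P => bind_done P)
  (pure_bind := fun _ _ => rfl)
  (bind_assoc := bind_assoc)

theorem settle_bind (P : Prog α) (F : α → Prog β) :
    (P.bind F).settle = P.settle.bind fun Q => (Q.bind F).settle := by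
  induction P with
  | done a => simp [bind, settle]
  | coin p hp k ih => simp [bind, settle, ih]
  | step x k _ => simp [bind, settle]

theorem settle_settle (P : Prog α) : P.settle.bind settle = P.settle := by
  have h := settle_bind P done
  simpa only [bind_done] using h.symm

theorem settle_map (P : Prog α) (f : α → β) :
    (P.bind fun a => done (f a)).settle = P.settle.map fun Q => Q.bind fun a => done (f a) := by
  induction P with
  | done a => simp [bind, settle, PMF.pure_map]
  | coin p hp k ih => simp [bind, settle, PMF.map_bind, ih]
  | step x k _ => simp [bind, settle, PMF.pure_map]

theorem sends_map (P : Prog α) (f : α → β) : (P.bind fun a => done (f a)).sends = P.sends := by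
  cases P <;> rfl

theorem resume_map (r : Option Bits) (P : Prog α) (f : α → β) :
    (P.bind fun a => done (f a)).resume r = (P.resume r).bind fun a => done (f a) := by
  cases P with
  | done a => rfl
  | coin p hp k => rfl
  | step x k => cases x <;> rfl

theorem output_map_eq_some_iff (P : Prog α) (f : α → β) {b : β} :
    (P.bind fun a => done (f a)).output = some b ↔ ∃ a, P.output = some a ∧ f a = b := by
  cases P <;> simp [bind, output]

theorem HasDuration.bind {P : Prog α} {F : α → Prog β} {s t : ℕ} (hP : P.HasDuration s)
    (hF : ∀ a, (F a).HasDuration t) : (P.bind F).HasDuration (s + t) := by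
  induction P generalizing s with
  | done a => cases hP; simpa [Prog.bind] using hF a
  | coin p hp k ih => exact fun b => ih b (hP b)
  | step x k ih =>
    obtain ⟨s, rfl, h⟩ := hP
    exact ⟨s + t, by omega, fun r => ih r (h r)⟩

theorem HasDuration.stepsLE {P : Prog α} {t : ℕ} (h : P.HasDuration t) : P.StepsLE t := by
  induction P generalizing t with
  | done a => trivial
  | coin p hp k ih => exact fun b => ih b (h b)
  | step x k ih =>
    obtain ⟨s, rfl, h⟩ := h
    exact ⟨s, rfl, fun r => ih r (h r)⟩

theorem StepsLE.mono {P : Prog α} {s t : ℕ} (h : P.StepsLE s) (hst : s ≤ t) : P.StepsLE t := by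
  induction P generalizing s t with
  | done a => trivial
  | coin p hp k ih => exact fun b => ih b (h b) hst
  | step x k ih =>
    obtain ⟨s, rfl, h⟩ := h
    exact ⟨t - 1, by omega, fun r => ih r (h r) (by omega)⟩

theorem StepsLE.bind {P : Prog α} {F : α → Prog β} {s t : ℕ} (hP : P.StepsLE s)
    (hF : ∀ a, (F a).StepsLE t) : (P.bind F).StepsLE (s + t) := by
  induction P generalizing s with
  | done a => exact (hF a).mono (by omega)
  | coin p hp k ih => exact fun b => ih b (hP b)
  | step x k ih =>
    obtain ⟨s, rfl, h⟩ := hP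
    exact ⟨s + t, by omega, fun r => ih r (h r)⟩

/-- The refinement of `MsgLE` that also says that every output satisfies `A`. This makes it
compositional: the outputs of one program determine the messages of the next one. -/
def Bounded (M : ℕ) (A : α → Prop) : Prog α → Prop
  | done a => A a
  | coin _ _ k => ∀ b, (k b).Bounded M A
  | step x k => (∀ y ∈ x, y.length ≤ M) ∧
      ∀ r : Option Bits, (∀ y ∈ r, y.length ≤ M) → (k r).Bounded M A

theorem Bounded.msgLE {M : ℕ} {A : α → Prop} {P : Prog α} (h : P.Bounded M A) : P.MsgLE M := by
  induction P with
  | done a => trivial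
  | coin p hp k ih => exact fun b => ih b (h b)
  | step x k ih => exact ⟨h.1, fun r hr => ih r (h.2 r hr)⟩

theorem Bounded.bind {M : ℕ} {A : α → Prop} {B : β → Prop} {P : Prog α} {F : α → Prog β}
    (h : P.Bounded M A) (hF : ∀ a, A a → (F a).Bounded M B) : (P.bind F).Bounded M B := by
  induction P with
  | done a => exact hF a h
  | coin p hp k ih => exact fun b => ih b (h b)
  | step x k ih => exact ⟨h.1, fun r hr => ih r (h.2 r hr)⟩

theorem bounded_foldlM {M : ℕ} {ι : Type*} {A : α → Prop} (f : α → ι → Prog α) (l : List ι)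
    (hf : ∀ a i, A a → (f a i).Bounded M A) : ∀ a, A a → (l.foldlM f a).Bounded M A := by
  induction l with
  | nil => intro a ha; exact ha
  | cons i l ih =>
    intro a ha
    rw [List.foldlM_cons]
    exact (hf a i ha).bind ih

theorem hasDuration_foldlM {ι : Type*} (f : α → ι → Prog α) (l : List ι) {d : ℕ}
    (hf : ∀ a i, (f a i).HasDuration d) : ∀ a, (l.foldlM f a).HasDuration (l.length * d) := by
  induction l with
  | nil => intro a; simp [monad_pure_eq, HasDuration]
  | cons i l ih =>
    intro a
    rw [List.foldlM_cons, List.length_cons, Nat.succ_mul, add_comm]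
    exact (hf a i).bind ih

theorem hasDuration_idle : ∀ t, (idle t).HasDuration t
  | 0 => rfl
  | t + 1 => ⟨t, rfl, fun _ => hasDuration_idle t⟩

theorem hasDuration_done (a : α) : (done a).HasDuration 0 := rfl

theorem hasDuration_flip (p : ℝ≥0) : (flip p).HasDuration 0 := fun _ => rfl

theorem HasDuration.settle_zero {P : Prog α} (h : P.HasDuration 0) :
    ∀ Q ∈ P.settle.support, ∃ a, Q = done a := by
  induction P with
  | done a => intro Q hQ; exact ⟨a, by simpa [settle] using hQ⟩
  | coin p hp k ih =>
    intro Q hQ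
    obtain ⟨b, _, hb⟩ := (PMF.mem_support_bind_iff _ _ _).1 hQ
    exact ih b (h b) Q hb
  | step x k _ => obtain ⟨s, hs, _⟩ := h; omega

theorem HasDuration.settle_succ {P : Prog α} {t : ℕ} (h : P.HasDuration (t + 1)) :
    ∀ Q ∈ P.settle.support, ∃ x k, Q = step x k ∧ ∀ r, (k r).HasDuration t := by
  induction P with
  | done a => cases h
  | coin p hp k ih =>
    intro Q hQ
    obtain ⟨b, _, hb⟩ := (PMF.mem_support_bind_iff _ _ _).1 hQ
    exact ih b (h b) Q hb
  | step x k _ =>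
    obtain ⟨s, hs, hk⟩ := h
    obtain rfl : t = s := by omega
    intro Q hQ
    exact ⟨x, k, by simpa [settle] using hQ, hk⟩

end Prog

/-! ### Execution -/

section Exec

variable {V α β : Type}

section Law

variable (G : Digraph V)

/-- What a node receives when the nodes transmit `x`: unlike `heard`, this takes into account that a
transmitting node receives nothing. -/
noncomputable def received (x : V → Option Bits) (v : V) : Option Bits :=
  if x v = none then heard G x v else none

theorem resume_step (x : V → Option Bits) (k : V → Option Bits → Prog α) (v : V) :
    (Prog.step (x v) (k v)).resume (heard G (fun u => (Prog.step (x u) (k u)).sends) v) =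
      k v (received G x v) := by
  unfold received
  cases h : x v <;> simp [Prog.resume, Prog.sends]

variable [Fintype V]

theorem exec_eq_settle_bind (t : ℕ) (P : V → Prog α) :
    exec G t P = (indep fun v => (P v).settle).bind (exec G t) := by
  have h : (indep fun v => (P v).settle) =
      (indep fun v => (P v).settle).bind fun Q => indep fun v => (Q v).settle := by
    rw [← indep_bind]
    simp only [Prog.settle_settle]
  cases t with
  | zero => exact h
  | succ t =>
    simp only [exec]
    conv_lhs => rw [h]
    rw [PMF.bind_bind]

theorem exec_done (t : ℕ) (a : V → α) :
    exec G t (fun v => Prog.done (a v)) = PMF.pure fun v => Prog.done (a v) := by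
  induction t with
  | zero => simp [exec, Prog.settle, indep_pure]
  | succ t ih => simp [exec, Prog.settle, indep_pure, Prog.resume, ih]

theorem exec_coin (t : ℕ) (p : V → ℝ≥0) (hp : ∀ v, p v ≤ 1) (k : V → Bool → Prog α) :
    exec G t (fun v => Prog.coin (p v) (hp v) (k v)) =
      (indep fun v => coinPMF (p v) (hp v)).bind fun b => exec G t fun v => k v (b v) := by
  cases t <;> simp only [exec, Prog.settle, indep_bind, PMF.bind_bind]

theorem exec_step (t : ℕ) (x : V → Option Bits) (k : V → Option Bits → Prog α) :
    exec G (t + 1) (fun v => Prog.step (x v) (k v)) =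
      exec G t fun v => k v (received G x v) := by
  simp only [exec, Prog.settle, indep_pure, PMF.pure_bind, resume_step]

theorem exists_eq_step_of_mem_support {t : ℕ} {P Q : V → Prog α}
    (hP : ∀ v, (P v).HasDuration (t + 1)) (hQ : Q ∈ (indep fun v => (P v).settle).support) :
    ∃ (x : V → Option Bits) (k : V → Option Bits → Prog α),
      (Q = fun v => Prog.step (x v) (k v)) ∧ ∀ v r, (k v r).HasDuration t := by
  choose x k hQ' hk using fun v =>
    (hP v).settle_succ (Q v) (apply_mem_support_of_mem_support_indep hQ v)
  exact ⟨x, k, funext hQ', hk⟩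

theorem exec_bind (F : V → α → Prog β) (t' : ℕ) {t : ℕ} {P : V → Prog α}
    (hP : ∀ v, (P v).HasDuration t) :
    exec G (t + t') (fun v => (P v).bind (F v)) =
      (exec G t P).bind fun Q => exec G t' fun v => (Q v).bind (F v) := by
  induction t generalizing P with
  | zero =>
    rw [zero_add, exec_eq_settle_bind]
    simp only [exec, Prog.settle_bind (P _)]
    rw [indep_bind, PMF.bind_bind]
    simp only [← exec_eq_settle_bind]
  | succ t ih =>
    rw [exec_eq_settle_bind]
    simp only [exec, Prog.settle_bind (P _)]
    rw [indep_bind, PMF.bind_bind, PMF.bind_bind]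
    refine pmf_bind_congr fun Q hQ => ?_
    obtain ⟨x, k, rfl, hk⟩ := exists_eq_step_of_mem_support hP hQ
    rw [← exec_eq_settle_bind]
    simp only [Prog.bind, resume_step]
    rw [show t + 1 + t' = (t + t') + 1 by omega, exec_step, ← ih fun v => hk v _]

theorem exec_map (f : V → α → β) (t : ℕ) (P : V → Prog α) :
    exec G t (fun v => (P v).bind fun a => Prog.done (f v a)) =
      (exec G t P).map fun Q v => (Q v).bind fun a => Prog.done (f v a) := by
  induction t generalizing P with
  | zero => simp only [exec, Prog.settle_map, indep_map]
  | succ t ih =>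
    simp only [exec, Prog.settle_map, indep_map, PMF.bind_map, PMF.map_bind, Function.comp_def,
      Prog.sends_map, Prog.resume_map, ih]

end Law

open Classical in
/-- The outputs of all nodes, once all of them have stopped. -/
noncomputable def outputs (Q : V → Prog α) : Option (V → α) :=
  if h : ∃ a : V → α, ∀ v, (Q v).output = some (a v) then some h.choose else none

theorem outputs_eq_some_iff {Q : V → Prog α} {a : V → α} :
    outputs Q = some a ↔ ∀ v, (Q v).output = some (a v) := by
  by_cases h : ∃ a : V → α, ∀ v, (Q v).output = some (a v)
  · rw [outputs, dif_pos h, Option.some_inj]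
    refine ⟨fun ha v => ha ▸ h.choose_spec v, fun ha => funext fun v => ?_⟩
    exact Option.some_injective _ ((h.choose_spec v).symm.trans (ha v))
  · rw [outputs, dif_neg h]
    exact iff_of_false (by simp) fun ha => h ⟨a, ha⟩

theorem outputs_done (a : V → α) : outputs (fun v => Prog.done (a v)) = some a :=
  outputs_eq_some_iff.2 fun _ => rfl

theorem outputs_map (f : V → α → β) (Q : V → Prog α) :
    outputs (fun v => (Q v).bind fun a => Prog.done (f v a)) =
      (outputs Q).map fun a v => f v (a v) := by
  refine Option.ext fun b => ?_
  simp only [Option.map_eq_some_iff, outputs_eq_some_iff, Prog.output_map_eq_some_iff]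
  refine ⟨fun h => ?_, fun ⟨a, ha, hb⟩ v => ⟨a v, ha v, congrFun hb v⟩⟩
  choose a ha hb using h
  exact ⟨a, ha, funext hb⟩

variable [Fintype V] (G : Digraph V)

/-- The expectation of `φ` at the outputs after `t` time steps. An execution that has not stopped
by then counts `1`, so that upper bounds also bound the probability of running out of time. -/
noncomputable def expect (t : ℕ) (P : V → Prog α) (φ : (V → α) → ℝ≥0∞) : ℝ≥0∞ :=
  mean (exec G t P) fun Q => (outputs Q).elim 1 φ

theorem expect_done (t : ℕ) (a : V → α) (φ : (V → α) → ℝ≥0∞) :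
    expect G t (fun v => Prog.done (a v)) φ = φ a := by
  rw [expect, exec_done, mean_pure, outputs_done, Option.elim_some]

theorem expect_coin (t : ℕ) (p : V → ℝ≥0) (hp : ∀ v, p v ≤ 1) (k : V → Bool → Prog α)
    (φ : (V → α) → ℝ≥0∞) :
    expect G t (fun v => Prog.coin (p v) (hp v) (k v)) φ =
      mean (indep fun v => coinPMF (p v) (hp v)) fun b => expect G t (fun v => k v (b v)) φ := by
  rw [expect, exec_coin, mean_bind]; rfl

theorem expect_step (t : ℕ) (x : V → Option Bits) (k : V → Option Bits → Prog α)
    (φ : (V → α) → ℝ≥0∞) :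
    expect G (t + 1) (fun v => Prog.step (x v) (k v)) φ =
      expect G t (fun v => k v (received G x v)) φ := by
  rw [expect, exec_step]; rfl

theorem exists_eq_done_of_mem_support_exec {t : ℕ} {P Q : V → Prog α}
    (hP : ∀ v, (P v).HasDuration t) (hQ : Q ∈ (exec G t P).support) :
    ∃ a : V → α, Q = fun v => Prog.done (a v) := by
  induction t generalizing P with
  | zero =>
    choose a ha using fun v =>
      (hP v).settle_zero (Q v) (apply_mem_support_of_mem_support_indep hQ v)
    exact ⟨a, funext ha⟩
  | succ t ih =>
    obtain ⟨R, hR, hQ⟩ := (PMF.mem_support_bind_iff _ _ _).1 hQ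
    obtain ⟨x, k, rfl, hk⟩ := exists_eq_step_of_mem_support hP hR
    simp only [resume_step] at hQ
    exact ih (fun v => hk v _) hQ

theorem expect_bind {t t' : ℕ} {P : V → Prog α} (F : V → α → Prog β)
    (hP : ∀ v, (P v).HasDuration t) (φ : (V → β) → ℝ≥0∞) :
    expect G (t + t') (fun v => (P v).bind (F v)) φ =
      expect G t P fun a => expect G t' (fun v => F v (a v)) φ := by
  rw [expect, exec_bind G F t' hP, mean_bind, expect]
  refine mean_congr_support fun Q hQ => ?_
  obtain ⟨a, rfl⟩ := exists_eq_done_of_mem_support_exec G hP hQ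
  rw [outputs_done]
  rfl

theorem expect_map (t : ℕ) (P : V → Prog α) (f : V → α → β) (φ : (V → β) → ℝ≥0∞) :
    expect G t (fun v => (P v).bind fun a => Prog.done (f v a)) φ =
      expect G t P fun a => φ fun v => f v (a v) := by
  simp only [expect, exec_map, mean_map, outputs_map, Option.elim_map, Function.comp_def]

theorem expect_mono {t : ℕ} {P : V → Prog α} {φ ψ : (V → α) → ℝ≥0∞} (h : ∀ a, φ a ≤ ψ a) :
    expect G t P φ ≤ expect G t P ψ := by
  refine mean_mono fun Q => ?_
  cases outputs Q with
  | none => exact le_rfl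
  | some a => exact h a

theorem expect_le_one {t : ℕ} {P : V → Prog α} {φ : (V → α) → ℝ≥0∞} (h : ∀ a, φ a ≤ 1) :
    expect G t P φ ≤ 1 := by
  refine mean_le_of_le fun Q => ?_
  cases outputs Q with
  | none => exact le_rfl
  | some a => exact h a

theorem expect_add_le (t : ℕ) (P : V → Prog α) (φ ψ : (V → α) → ℝ≥0∞) :
    expect G t P (fun a => φ a + ψ a) ≤ expect G t P φ + expect G t P ψ := by
  rw [expect, expect, expect, ← mean_add]
  refine mean_mono fun Q => ?_
  cases outputs Q with
  | none => exact le_self_add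
  | some a => exact le_rfl

theorem expect_const_mul {t : ℕ} {P : V → Prog α} (hP : ∀ v, (P v).HasDuration t) (c : ℝ≥0∞)
    (φ : (V → α) → ℝ≥0∞) :
    expect G t P (fun a => c * φ a) = c * expect G t P φ := by
  rw [expect, expect, ← mean_const_mul]
  refine mean_congr_support fun Q hQ => ?_
  obtain ⟨a, rfl⟩ := exists_eq_done_of_mem_support_exec G hP hQ
  simp only [outputs_done, Option.elim_some]

theorem expect_const {t : ℕ} {P : V → Prog α} (hP : ∀ v, (P v).HasDuration t) (c : ℝ≥0∞) :
    expect G t P (fun _ => c) = c := by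
  rw [expect, ← mean_const (exec G t P) c]
  refine mean_congr_support fun Q hQ => ?_
  obtain ⟨a, rfl⟩ := exists_eq_done_of_mem_support_exec G hP hQ
  simp only [outputs_done, Option.elim_some, mean_const]

/-! ### Failure probabilities -/

open Classical in
/-- The probability that some node does not stop within `t` time steps or that the outputs violate
`E`. -/
noncomputable def failure (t : ℕ) (P : V → Prog α) (E : (V → α) → Prop) : ℝ≥0∞ :=
  expect G t P fun a => if E a then 0 else 1

theorem failure_eq_expect (t : ℕ) (P : V → Prog α) (E : (V → α) → Prop) [DecidablePred E] :
    failure G t P E = expect G t P fun a => if E a then 0 else 1 := by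
  unfold failure
  congr!

theorem failure_le_one (t : ℕ) (P : V → Prog α) (E : (V → α) → Prop) : failure G t P E ≤ 1 :=
  expect_le_one G fun a => by split_ifs <;> simp

theorem prob_add_failure (t : ℕ) (P : V → Prog α) (E : (V → α) → Prop) :
    prob G t P E + failure G t P E = 1 := by
  classical
  rw [prob, PMF.toOuterMeasure_apply, failure, expect, mean, ← ENNReal.tsum_add]
  refine (tsum_congr fun Q => ?_).trans (exec G t P).tsum_coe
  simp only [Set.indicator_apply, Set.mem_ofPred_eq, ← outputs_eq_some_iff]
  rcases Option.eq_none_or_eq_some (outputs Q) with h | ⟨a, h⟩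
  · simp [h]
  · by_cases hE : E a <;> simp [h, hE]

theorem le_prob_of_failure_le {t : ℕ} {P : V → Prog α} {E : (V → α) → Prop} {x : ℝ}
    (hx : 0 ≤ x) (h : failure G t P E ≤ ENNReal.ofReal x) :
    ENNReal.ofReal (1 - x) ≤ prob G t P E := by
  rw [ENNReal.ofReal_sub _ hx, ENNReal.ofReal_one, tsub_le_iff_right, ← prob_add_failure G t P E]
  gcongr

theorem failure_mono {t : ℕ} {P : V → Prog α} {A B : (V → α) → Prop} (h : ∀ a, A a → B a) :
    failure G t P B ≤ failure G t P A := by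
  classical
  refine expect_mono G fun a => ?_
  by_cases hA : A a
  · simp [h a hA]
  · simp [hA, ite_le_one]

theorem expect_le_failure_add {t : ℕ} {P : V → Prog α} {A : (V → α) → Prop}
    {φ ψ : (V → α) → ℝ≥0∞} (h1 : ∀ a, φ a ≤ 1) (h : ∀ a, A a → φ a ≤ ψ a) :
    expect G t P φ ≤ failure G t P A + expect G t P ψ := by
  classical
  refine le_trans (expect_mono G fun a => ?_) (expect_add_le G t P _ _)
  split_ifs with hA
  · simpa using h a hA
  · exact (h1 a).trans le_self_add

theorem failure_and_le {t : ℕ} {P : V → Prog α} {A B : (V → α) → Prop} :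
    failure G t P (fun a => A a ∧ B a) ≤ failure G t P A + failure G t P B := by
  classical
  refine expect_le_failure_add G (fun a => by split_ifs <;> simp) fun a ha => ?_
  simp [ha]

theorem failure_bind_le_add {t t' : ℕ} {P : V → Prog α} {F : V → α → Prog β}
    (hP : ∀ v, (P v).HasDuration t) {A : (V → α) → Prop} {E : (V → β) → Prop} {ε ε' : ℝ≥0∞}
    (h : failure G t P A ≤ ε) (hF : ∀ a, A a → failure G t' (fun v => F v (a v)) E ≤ ε') :
    failure G (t + t') (fun v => (P v).bind (F v)) E ≤ ε + ε' := by
  rw [failure, expect_bind G F hP]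
  refine (expect_le_failure_add G (A := A) (ψ := fun _ => ε')
    (fun a => failure_le_one G t' _ E) hF).trans ?_
  rw [expect_const G hP]
  gcongr

theorem failure_bind_le_mul {t t' : ℕ} {P : V → Prog α} {F : V → α → Prog β}
    (hP : ∀ v, (P v).HasDuration t) {A : (V → α) → Prop} {E : (V → β) → Prop} {ε ε' : ℝ≥0∞}
    (h : failure G t P A ≤ ε) (hA : ∀ a, A a → failure G t' (fun v => F v (a v)) E = 0)
    (hF : ∀ a, ¬ A a → failure G t' (fun v => F v (a v)) E ≤ ε') :
    failure G (t + t') (fun v => (P v).bind (F v)) E ≤ ε' * ε := by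
  classical
  have hpt : ∀ a, failure G t' (fun v => F v (a v)) E ≤ ε' * if A a then 0 else 1 := by
    intro a
    split_ifs with ha
    · exact (hA a ha).trans_le zero_le
    · simpa using hF a ha
  calc failure G (t + t') (fun v => (P v).bind (F v)) E
      ≤ expect G t P fun a => ε' * if A a then 0 else 1 := by
        rw [failure, expect_bind G F hP]
        exact expect_mono G hpt
    _ = ε' * failure G t P A := expect_const_mul G hP _ _
    _ ≤ ε' * ε := by gcongr

theorem failure_done {t : ℕ} {a : V → α} {E : (V → α) → Prop} (h : E a) :
    failure G t (fun v => Prog.done (a v)) E = 0 := by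
  rw [failure, expect_done, if_pos h]

theorem failure_map (t : ℕ) (P : V → Prog α) (f : V → α → β) (E : (V → β) → Prop) :
    failure G t (fun v => (P v).bind fun a => Prog.done (f v a)) E =
      failure G t P fun a => E fun v => f v (a v) :=
  expect_map G t P f _

theorem failure_foldlM_le {ι : Type*} {f : V → α → ι → Prog α} {d : ℕ}
    (hf : ∀ v a i, (f v a i).HasDuration d) {ε : ℝ≥0∞} {E : (V → α) → Prop}
    (l : List ι) (hstep : ∀ i ∈ l, ∀ a, E a → failure G d (fun v => f v (a v) i) E ≤ ε)
    (a : V → α) (ha : E a) :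
    failure G (l.length * d) (fun v => l.foldlM (f v) (a v)) E ≤ l.length * ε := by
  induction l generalizing a with
  | nil => simp [Prog.monad_pure_eq, failure_done G ha]
  | cons i l ih =>
    simp only [List.foldlM_cons, Prog.monad_bind_eq, List.length_cons]
    rw [Nat.succ_mul, add_comm]
    refine (failure_bind_le_add G (fun v => hf v (a v) i) (hstep i (by simp) a ha)
      (ih fun j hj => hstep j (by simp [hj]))).trans (le_of_eq ?_)
    push_cast
    ring

end Exec

/-! ### Exactly one of many coins -/

section ExactlyOne

-- Bernoulli's inequality gives `(1 - q) ^ (k / 2) ≥ 1 - k q / 2 ≥ 1 / 2`; then square.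
theorem one_eighth_le_mul_one_sub_pow {k : ℕ} {q : ℝ≥0} (hq : q ≤ 1) (h1 : 1 / 2 ≤ k * q)
    (h2 : k * q ≤ 1) : 1 / 8 ≤ k * (q * (1 - q) ^ (k - 1)) := by
  have h1' : (1 / 2 : ℝ) ≤ k * (q : ℝ) := by exact_mod_cast h1
  have _h2' : k * (q : ℝ) ≤ 1 := by exact_mod_cast h2
  have _hq' : (q : ℝ) ≤ 1 := by exact_mod_cast hq
  have hq0 : (0 : ℝ) ≤ q := q.2
  rw [← NNReal.coe_le_coe]
  push_cast [NNReal.coe_sub hq]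
  have hhalf : (1 / 2 : ℝ) ≤ (1 - (q : ℝ)) ^ (k / 2) := by
    have hbernoulli := one_add_mul_le_pow (a := -(q : ℝ)) (by linarith) (k / 2)
    have hk : ((k / 2 : ℕ) : ℝ) * q ≤ k / 2 * q :=
      mul_le_mul_of_nonneg_right Nat.cast_div_le hq0
    rw [← sub_eq_add_neg] at hbernoulli
    linarith
  have hquarter : (1 / 4 : ℝ) ≤ (1 - (q : ℝ)) ^ (k - 1) := by
    calc (1 / 4 : ℝ) ≤ ((1 - (q : ℝ)) ^ (k / 2)) ^ 2 := by nlinarith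
      _ = (1 - (q : ℝ)) ^ (k / 2 * 2) := by rw [pow_mul]
      _ ≤ (1 - (q : ℝ)) ^ (k - 1) :=
        pow_le_pow_of_le_one (by linarith) (by linarith) (by omega)
  calc (1 / 8 : ℝ) = 1 / 2 * (1 / 4) := by norm_num
    _ ≤ (k * (q : ℝ)) * (1 - (q : ℝ)) ^ (k - 1) :=
      mul_le_mul h1' hquarter (by norm_num) (by linarith)
    _ = _ := by ring

variable {V : Type}

open Classical in
theorem sum_prod_boole_le_existsUnique (A : Finset V) (b : V → Bool) :
    (∑ u ∈ A, ∏ w ∈ A, if b w = decide (w = u) then (1 : ℝ≥0∞) else 0) ≤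
      if ∃! u, u ∈ A ∧ b u = true then 1 else 0 := by
  simp only [Finset.prod_boole]
  split_ifs with h
  · obtain ⟨u, ⟨hu, hbu⟩, -⟩ := h
    rw [Finset.sum_eq_single_of_mem u hu]
    · split_ifs <;> simp
    · refine fun u' _ hne => if_neg fun h => hne ?_
      exact (by simpa [hbu] using h u hu : u = u').symm
  · refine (Finset.sum_eq_zero fun u hu => if_neg fun hb => h ⟨u, ⟨hu, by simp [hb u hu]⟩, ?_⟩).le
    rintro w ⟨hw, hbw⟩
    simpa [hbw] using hb w hw

variable [Fintype V]

open Classical in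
theorem mean_prod_boole {A : Finset V} {u : V} (hu : u ∈ A) {q : ℝ≥0} (hq : q ≤ 1) :
    mean (indep fun _ : V => coinPMF q hq)
        (fun b => ∏ w ∈ A, if b w = decide (w = u) then 1 else 0) =
      ((q * (1 - q) ^ (A.card - 1) : ℝ≥0) : ℝ≥0∞) := by
  have hne : ∀ w ∈ A.erase u,
      mean (coinPMF q hq) (fun c => if c = decide (w = u) then 1 else 0) =
        ((1 - q : ℝ≥0) : ℝ≥0∞) := by
    intro w hw
    simp [mean_coin, (Finset.mem_erase.1 hw).1]
  rw [mean_indep_prod_finset A _ fun w c => if c = decide (w = u) then 1 else 0,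
    ← Finset.mul_prod_erase A _ hu, Finset.prod_congr rfl hne, Finset.prod_const,
    Finset.card_erase_of_mem hu]
  simp [mean_coin]

open Classical in
theorem one_eighth_le_mean_existsUnique {A : Finset V} {q : ℝ≥0} (hq : q ≤ 1)
    (h1 : 1 / 2 ≤ A.card * q) (h2 : A.card * q ≤ 1) :
    ((1 / 8 : ℝ≥0) : ℝ≥0∞) ≤ mean (indep fun _ : V => coinPMF q hq)
      (fun b => if ∃! u, u ∈ A ∧ b u = true then 1 else 0) := by
  calc ((1 / 8 : ℝ≥0) : ℝ≥0∞)
      ≤ ((A.card * (q * (1 - q) ^ (A.card - 1)) : ℝ≥0) : ℝ≥0∞) := by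
        exact_mod_cast one_eighth_le_mul_one_sub_pow hq h1 h2
    _ = ∑ u ∈ A, mean (indep fun _ : V => coinPMF q hq)
          (fun b => ∏ w ∈ A, if b w = decide (w = u) then 1 else 0) := by
        rw [Finset.sum_congr rfl fun u hu => mean_prod_boole hu hq, Finset.sum_const,
          nsmul_eq_mul]
        push_cast
        rfl
    _ ≤ _ := by
        rw [← mean_finset_sum]
        exact mean_mono (sum_prod_boole_le_existsUnique A)

open Classical in
theorem mean_not_existsUnique_le {A : Finset V} {q : ℝ≥0} (hq : q ≤ 1)
    (h1 : 1 / 2 ≤ A.card * q) (h2 : A.card * q ≤ 1) :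
    mean (indep fun _ : V => coinPMF q hq)
      (fun b => if ∃! u, u ∈ A ∧ b u = true then 0 else 1) ≤ 7 / 8 := by
  set p := indep fun _ : V => coinPMF q hq
  have hadd : mean p (fun b => if ∃! u, u ∈ A ∧ b u = true then 0 else 1) +
      mean p (fun b => if ∃! u, u ∈ A ∧ b u = true then 1 else 0) = 1 := by
    rw [← mean_add]
    refine Eq.trans (congrArg (mean p) ?_) (mean_const p 1)
    funext b
    split_ifs <;> simp
  have hsum : ((1 / 8 : ℝ≥0) : ℝ≥0∞) + 7 / 8 = 1 := by
    rw [show (7 / 8 : ℝ≥0∞) = ((7 / 8 : ℝ≥0) : ℝ≥0∞) by rw [ENNReal.coe_div] <;> norm_num]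
    norm_cast
    norm_num
  refine (ENNReal.add_le_add_iff_left (a := ((1 / 8 : ℝ≥0) : ℝ≥0∞)) ENNReal.coe_ne_top).1 ?_
  refine (add_le_add_left (one_eighth_le_mean_existsUnique hq h1 h2) _).trans ?_
  rw [hsum, add_comm]
  exact hadd.le

theorem card_mul_inv_two_pow_clog {k : ℕ} (hk : 0 < k) :
    (1 / 2 : ℝ≥0) ≤ k * (2 : ℝ≥0)⁻¹ ^ Nat.clog 2 k ∧ k * (2 : ℝ≥0)⁻¹ ^ Nat.clog 2 k ≤ 1 := by
  have hpow : (0 : ℝ≥0) < 2 ^ Nat.clog 2 k := by positivity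
  rw [inv_pow, ← div_eq_mul_inv, div_le_div_iff₀ (by norm_num) hpow, div_le_one hpow]
  refine ⟨?_, mod_cast Nat.le_pow_clog (by norm_num) k⟩
  rcases Nat.eq_or_lt_of_le hk with rfl | hk
  · simp
  · have hlt : 2 ^ (Nat.clog 2 k - 1) < k := Nat.pow_pred_clog_lt_self (by norm_num) hk
    have hclog : 2 ^ Nat.clog 2 k = 2 * 2 ^ (Nat.clog 2 k - 1) := by
      rw [← pow_succ', Nat.sub_add_cancel (Nat.clog_pos (by norm_num) hk)]
    have : 1 * 2 ^ Nat.clog 2 k ≤ k * 2 := by omega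
    exact_mod_cast this

end ExactlyOne

/-! ### Receiving -/

section Heard

variable {V : Type} (G : Digraph V)

theorem heard_eq_of_unique {x : V → Option Bits} {u v : V} (huv : G.Adj u v) (hu : x u ≠ none)
    (h : ∀ w, G.Adj w v → x w ≠ none → w = u) : heard G x v = x u := by
  have hex : ∃! u, G.Adj u v ∧ x u ≠ none := ⟨u, ⟨huv, hu⟩, fun w hw => h w hw.1 hw.2⟩
  rw [heard, dif_pos hex, h _ hex.choose_spec.1.1 hex.choose_spec.1.2]

theorem exists_adj_of_received_eq_some {x : V → Option Bits} {v : V} {y : Bits}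
    (h : received G x v = some y) : ∃ u, G.Adj u v ∧ x u = some y := by
  unfold received heard at h
  split_ifs at h with _ hex
  exact ⟨_, hex.choose_spec.1.1, h⟩

theorem received_ne_none_of_existsUnique {x : V → Option Bits} {v : V} (hv : x v = none)
    {b : V → Bool} (h : ∃! u, (G.Adj u v ∧ x u ≠ none) ∧ b u = true) :
    received G (fun u => if b u then x u else none) v ≠ none := by
  obtain ⟨u, ⟨⟨huv, hu⟩, hbu⟩, huniq⟩ := h
  have hheard := heard_eq_of_unique G (x := fun u => if b u then x u else none) huv
    (by simpa [hbu] using hu) fun w hwv hw => huniq w (by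
      by_cases hbw : b w = true
      · exact ⟨⟨hwv, by simpa [hbw] using hw⟩, hbw⟩
      · simp [hbw] at hw)
  simpa [received, hv, hheard, hbu] using hu

theorem exists_adj_crossing {P : V → Prop} {u : V} (hu : P u) :
    ∀ {k : ℕ} {v : V}, ReachIn G k u v → ¬ P v → ∃ a b, P a ∧ ¬ P b ∧ G.Adj a b
  | 0, v, h, hv => by cases h; exact (hv hu).elim
  | k + 1, v, ⟨w, hw, hwv⟩, hv => by
    by_cases hP : P w
    · exact ⟨w, v, hP, hv, hwv⟩
    · exact exists_adj_crossing hu hw hP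

end Heard

/-! ### Decay -/

/-- The `i`-th time step of a round of Decay. -/
noncomputable def decayStep (x : Option Bits) (got : List Bits) (i : ℕ) : Prog (List Bits) := do
  let b ← Prog.flip ((2 : ℝ≥0)⁻¹ ^ (i + 1))
  let r ← Prog.act (if b then x else none)
  pure (got ++ r.toList)

theorem decay_eq_foldlM (n : ℕ) (x : Option Bits) :
    decay n x = (List.range (lg n)).foldlM (decayStep x) [] := rfl

theorem decay4_eq_bind (n : ℕ) (x : Option Bits) :
    decay4 n x = (decay n x).bind fun r₁ => (decay n x).bind fun r₂ => (decay n x).bind fun r₃ =>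
      (decay n x).bind fun r₄ => Prog.done (r₁ ++ r₂ ++ r₃ ++ r₄) := rfl

theorem hasDuration_decayStep (x : Option Bits) (got : List Bits) (i : ℕ) :
    (decayStep x got i).HasDuration 1 := fun _ => ⟨0, rfl, fun _ => rfl⟩

theorem hasDuration_decay (n : ℕ) (x : Option Bits) : (decay n x).HasDuration (lg n) := by
  simpa [decay_eq_foldlM] using
    Prog.hasDuration_foldlM (decayStep x) (List.range (lg n)) (hasDuration_decayStep x) []

theorem four_mul_eq_add (t : ℕ) : 4 * t = t + (t + (t + (t + 0))) := by ring

theorem hasDuration_decay4 (n : ℕ) (x : Option Bits) : (decay4 n x).HasDuration (4 * lg n) := by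
  have h := hasDuration_decay n x
  rw [four_mul_eq_add, decay4_eq_bind]
  exact h.bind fun _ => h.bind fun _ => h.bind fun _ => h.bind fun _ => Prog.hasDuration_done _

theorem exists_lt_lg_card_mul_inv_two_pow {k n : ℕ} (hk : 0 < k) (hkn : k ≤ n) (hn : 2 ≤ n) :
    ∃ i < lg n, 1 / 2 ≤ k * (2 : ℝ≥0)⁻¹ ^ (i + 1) ∧ k * (2 : ℝ≥0)⁻¹ ^ (i + 1) ≤ 1 := by
  rcases Nat.eq_or_lt_of_le hk with rfl | hk1
  · exact ⟨0, Nat.clog_pos (by norm_num) hn, by norm_num⟩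
  · have hpos : 1 ≤ Nat.clog 2 k := Nat.clog_pos (by norm_num) hk1
    have hle : Nat.clog 2 k ≤ lg n := Nat.clog_mono_right 2 hkn
    refine ⟨Nat.clog 2 k - 1, by omega, ?_⟩
    rw [Nat.sub_add_cancel hpos]
    exact card_mul_inv_two_pow_clog hk

section Decay

variable {V : Type} [Fintype V] (G : Digraph V)

theorem expect_decayStep (x : V → Option Bits) (got : V → List Bits) (i : ℕ)
    (φ : (V → List Bits) → ℝ≥0∞) :
    expect G 1 (fun v => decayStep (x v) (got v) i) φ =
      mean (indep fun _ : V => coinPMF (min 1 ((2 : ℝ≥0)⁻¹ ^ (i + 1))) (min_le_left _ _)) fun b =>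
        φ fun v => got v ++ (received G (fun u => if b u then x u else none) v).toList := by
  change expect G 1 (fun v => Prog.coin _ _ fun b => Prog.step (if b then x v else none) fun r =>
    Prog.done (got v ++ r.toList)) φ = _
  rw [expect_coin]
  congr 1
  funext b
  rw [expect_step, expect_done]

theorem failure_decayStep_eq_zero {x : V → Option Bits} {got : V → List Bits} {i : ℕ}
    {E : (V → List Bits) → Prop}
    (h : ∀ b : V → Bool,
      E fun v => got v ++ (received G (fun u => if b u then x u else none) v).toList) :
    failure G 1 (fun v => decayStep (x v) (got v) i) E = 0 := by
  rw [failure, expect_decayStep]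
  exact nonpos_iff_eq_zero.1 (mean_le_of_le fun b => by rw [if_pos (h b)])

/-- All strings in the lists `got` were sent, with input `x`, by in-neighbours. -/
def ReceivedFrom {V : Type} (G : Digraph V) (x : V → Option Bits) (got : V → List Bits) : Prop :=
  ∀ v, ∀ y ∈ got v, ∃ u, G.Adj u v ∧ x u = some y

theorem failure_decay_receivedFrom (n : ℕ) (x : V → Option Bits) :
    failure G (lg n) (fun v => decay n (x v)) (ReceivedFrom G x) = 0 := by
  have h := failure_foldlM_le G (f := fun v => decayStep (x v)) (ε := 0) (E := ReceivedFrom G x)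
    (fun v => hasDuration_decayStep (x v)) (List.range (lg n))
    (fun i _ got hgot => (failure_decayStep_eq_zero G fun b v y hy => ?_).le)
    (fun _ => []) (fun v y hy => by simp at hy)
  · simpa [← decay_eq_foldlM] using h
  rcases List.mem_append.1 hy with hy | hy
  · exact hgot v y hy
  · obtain ⟨u, huv, hu⟩ := exists_adj_of_received_eq_some G (Option.mem_toList.1 hy)
    refine ⟨u, huv, ?_⟩
    split_ifs at hu
    exact hu

theorem failure_decay4_receivedFrom (n : ℕ) (x : V → Option Bits) :
    failure G (4 * lg n) (fun v => decay4 n (x v)) (ReceivedFrom G x) = 0 := by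
  have hd := fun v => hasDuration_decay n (x v)
  have h0 := (failure_decay_receivedFrom G n x).le
  have hle : failure G (lg n + (lg n + (lg n + (lg n + 0)))) (fun v => decay4 n (x v))
      (ReceivedFrom G x) ≤ 0 + (0 + (0 + (0 + 0))) := by
    simp only [decay4_eq_bind]
    refine failure_bind_le_add G hd h0 fun r₁ h₁ => failure_bind_le_add G hd h0 fun r₂ h₂ =>
      failure_bind_le_add G hd h0 fun r₃ h₃ => failure_bind_le_add G hd h0 fun r₄ h₄ =>
      (failure_done G fun v y hy => ?_).le
    simp only [List.mem_append] at hy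
    rcases hy with ((hy | hy) | hy) | hy
    exacts [h₁ v y hy, h₂ v y hy, h₃ v y hy, h₄ v y hy]
  rw [four_mul_eq_add]
  simpa using hle

open Classical in
theorem failure_decayStep_ne_nil_le {x : V → Option Bits} {v : V} (hv : x v = none)
    (got : V → List Bits) {i : ℕ}
    (h1 : 1 / 2 ≤ (Finset.univ.filter fun u => G.Adj u v ∧ x u ≠ none).card *
      (2 : ℝ≥0)⁻¹ ^ (i + 1))
    (h2 : (Finset.univ.filter fun u => G.Adj u v ∧ x u ≠ none).card * (2 : ℝ≥0)⁻¹ ^ (i + 1) ≤ 1) :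
    failure G 1 (fun v => decayStep (x v) (got v) i) (fun r => r v ≠ []) ≤ 7 / 8 := by
  have hq : min 1 ((2 : ℝ≥0)⁻¹ ^ (i + 1)) = (2 : ℝ≥0)⁻¹ ^ (i + 1) :=
    min_eq_right (pow_le_one₀ (by simp) (by norm_num))
  rw [failure, expect_decayStep]
  refine le_trans (mean_mono fun b => ?_) (mean_not_existsUnique_le
    (A := Finset.univ.filter fun u => G.Adj u v ∧ x u ≠ none) (min_le_left 1 _)
    (by rwa [hq]) (by rwa [hq]))
  by_cases h : ∃! u, u ∈ Finset.univ.filter (fun u => G.Adj u v ∧ x u ≠ none) ∧ b u = true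
  · rw [if_pos]
    · exact zero_le
    · simp only [Finset.mem_filter, Finset.mem_univ, true_and] at h
      simpa using fun _ => received_ne_none_of_existsUnique G hv h
  · rw [if_neg h]
    split_ifs <;> simp

theorem failure_foldlM_decayStep_ne_nil_eq_zero (x : V → Option Bits) {v : V} (l : List ℕ)
    {got : V → List Bits} (h : got v ≠ []) :
    failure G (l.length * 1) (fun v => l.foldlM (decayStep (x v)) (got v)) (fun r => r v ≠ []) =
      0 := by
  refine nonpos_iff_eq_zero.1 ?_
  simpa using failure_foldlM_le G (f := fun v => decayStep (x v)) (ε := 0) (E := fun r => r v ≠ [])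
    (fun v => hasDuration_decayStep (x v)) l
    (fun i _ a ha => (failure_decayStep_eq_zero G fun b => by simp [ha]).le) got h

open Classical in
theorem failure_foldlM_decayStep_ne_nil_le {x : V → Option Bits} {v : V} (hv : x v = none) {i : ℕ}
    (h1 : 1 / 2 ≤ (Finset.univ.filter fun u => G.Adj u v ∧ x u ≠ none).card *
      (2 : ℝ≥0)⁻¹ ^ (i + 1))
    (h2 : (Finset.univ.filter fun u => G.Adj u v ∧ x u ≠ none).card * (2 : ℝ≥0)⁻¹ ^ (i + 1) ≤ 1)
    {l : List ℕ} (hi : i ∈ l) (got : V → List Bits) :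
    failure G (l.length * 1) (fun v => l.foldlM (decayStep (x v)) (got v)) (fun r => r v ≠ []) ≤
      7 / 8 := by
  induction l generalizing got with
  | nil => simp at hi
  | cons j l ih =>
    simp only [List.foldlM_cons, Prog.monad_bind_eq, List.length_cons]
    rw [Nat.succ_mul, add_comm]
    rcases List.mem_cons.1 hi with rfl | hi
    · rw [← one_mul (7 / 8)]
      exact failure_bind_le_mul G (fun v => hasDuration_decayStep _ _ _)
        (failure_decayStep_ne_nil_le G hv got h1 h2)
        (fun a ha => failure_foldlM_decayStep_ne_nil_eq_zero G x l ha)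
        fun a _ => failure_le_one G _ _ _
    · rw [← zero_add (7 / 8)]
      exact failure_bind_le_add G (A := fun _ => True) (fun v => hasDuration_decayStep _ _ _)
        (failure_decayStep_eq_zero G fun _ => trivial).le fun a _ => ih hi a

theorem failure_decay_ne_nil_le (x : V → Option Bits) {u v : V} (huv : G.Adj u v)
    (hv : x v = none) (hu : x u ≠ none) :
    failure G (lg (Fintype.card V)) (fun v => decay (Fintype.card V) (x v)) (fun r => r v ≠ []) ≤
      7 / 8 := by
  classical
  have hcard : 2 ≤ Fintype.card V := Fintype.one_lt_card_iff.2 ⟨u, v, fun h => hu (h ▸ hv)⟩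
  obtain ⟨i, hi, h1, h2⟩ := exists_lt_lg_card_mul_inv_two_pow
    (Finset.card_pos.2 ⟨u, Finset.mem_filter.2 ⟨Finset.mem_univ u, huv, hu⟩⟩)
    (Finset.card_le_univ (Finset.univ.filter fun u => G.Adj u v ∧ x u ≠ none)) hcard
  simpa [decay_eq_foldlM] using
    failure_foldlM_decayStep_ne_nil_le G hv h1 h2 (List.mem_range.2 hi) fun _ => []

theorem failure_decay4_ne_nil_le (x : V → Option Bits) {u v : V} (huv : G.Adj u v)
    (hv : x v = none) (hu : x u ≠ none) :
    failure G (4 * lg (Fintype.card V)) (fun v => decay4 (Fintype.card V) (x v))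
      (fun r => r v ≠ []) ≤ (7 / 8) ^ 4 := by
  set n := Fintype.card V
  have hd := fun v => hasDuration_decay n (x v)
  have hmul : ∀ c φ, expect G (lg n) (fun v => decay n (x v)) (fun a => c * φ a) =
      c * expect G (lg n) (fun v => decay n (x v)) φ := expect_const_mul G hd
  have hmul' : ∀ c φ, expect G (lg n) (fun v => decay n (x v)) (fun a => φ a * c) =
      expect G (lg n) (fun v => decay n (x v)) φ * c := fun c φ => by
    simp only [mul_comm _ c, hmul]
  have hsplit : ∀ r₁ r₂ r₃ r₄ : V → List Bits,
      (if r₁ v ++ r₂ v ++ r₃ v ++ r₄ v ≠ [] then (0 : ℝ≥0∞) else 1) =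
        (if r₁ v ≠ [] then 0 else 1) * ((if r₂ v ≠ [] then 0 else 1) *
          ((if r₃ v ≠ [] then 0 else 1) * if r₄ v ≠ [] then 0 else 1)) := by
    intro r₁ r₂ r₃ r₄
    by_cases h₁ : r₁ v = [] <;> by_cases h₂ : r₂ v = [] <;> by_cases h₃ : r₃ v = [] <;>
      by_cases h₄ : r₄ v = [] <;> simp [h₁, h₂, h₃, h₄]
  calc failure G (4 * lg n) (fun v => decay4 n (x v)) (fun r => r v ≠ [])
      = failure G (lg n) (fun v => decay n (x v)) (fun r => r v ≠ []) ^ 4 := by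
        rw [failure_eq_expect, failure_eq_expect, four_mul_eq_add]
        simp only [decay4_eq_bind, expect_bind G _ hd, expect_done, hsplit, hmul, hmul']
        ring
    _ ≤ (7 / 8) ^ 4 := by
        gcongr
        exact failure_decay_ne_nil_le G x huv hv hu

end Decay

/-! ### Comparing bit strings -/

/-- The probability bound for missing all positions below `l` in which `x` and `y` differ, if each
of them is missed with probability `(7/8)^4`, as by four rounds of Decay. -/
noncomputable def missWeight (l : ℕ) (x y : Bits) : ℝ≥0∞ :=
  ∏ i ∈ Finset.range l, if x.getD i false = y.getD i false then 1 else (7 / 8) ^ 4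

theorem missWeight_self (l : ℕ) (x : Bits) : missWeight l x x = 1 := by simp [missWeight]

theorem missWeight_comm (l : ℕ) (x y : Bits) : missWeight l x y = missWeight l y x := by
  simp only [missWeight, eq_comm]

theorem lt_of_take_eq {x z : Bits} {i : ℕ} (hx : i < x.length) (hz : i < z.length)
    (h : x.take i = z.take i) (hxi : x.getD i false = true) (hzi : z.getD i false = false) :
    z < x := by
  rw [List.lt_iff_exists]
  refine Or.inr ⟨i, hz, hx, fun j hj => ?_, ?_⟩
  · have hj' : (x.take i)[j]? = (z.take i)[j]? := by rw [h]
    rw [List.getElem?_take_of_lt hj, List.getElem?_take_of_lt hj,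
      List.getElem?_eq_getElem (by omega), List.getElem?_eq_getElem (by omega)] at hj'
    exact (Option.some_injective _ hj').symm
  · rw [List.getD_eq_getElem _ _ hx] at hxi
    rw [List.getD_eq_getElem _ _ hz] at hzi
    rw [hxi, hzi]
    exact Bool.false_lt_true

theorem take_succ_eq_append_getD {z : Bits} {i : ℕ} (hz : i < z.length) :
    z.take (i + 1) = z.take i ++ [z.getD i false] := by
  rw [List.take_add_one, List.getElem?_eq_getElem hz, List.getD_eq_getElem _ _ hz]
  rfl

theorem foldl_max_mem (l : List Bits) (x : Bits) : l.foldl max x = x ∨ l.foldl max x ∈ l := by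
  induction l generalizing x with
  | nil => simp
  | cons y l ih =>
    rw [List.foldl_cons]
    rcases ih (max x y) with h | h
    · rw [h]
      rcases max_choice x y with h' | h'
      · exact Or.inl h'
      · exact Or.inr (h'.symm ▸ List.mem_cons_self)
    · exact Or.inr (List.mem_cons_of_mem y h)

theorem le_foldl_max (l : List Bits) (x : Bits) : x ≤ l.foldl max x := by
  induction l generalizing x with
  | nil => simp
  | cons y l ih => exact (le_max_left x y).trans (ih (max x y))

theorem le_foldl_max_of_mem {l : List Bits} (x : Bits) {y : Bits} (hy : y ∈ l) :
    y ≤ l.foldl max x := by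
  induction l generalizing x with
  | nil => simp at hy
  | cons z l ih =>
    rcases List.mem_cons.1 hy with rfl | hy
    · exact (le_max_right x y).trans (le_foldl_max l _)
    · exact ih (max x z) hy

/-! ### Finding witnesses -/

/-- The state of a node after bit position `i` in the search for witnesses, if it received `got`. -/
def witnessUpdate (s : Bits × Bool) (i : ℕ) (got : List Bits) : Bits × Bool :=
  if s.1.getD i false = false ∧ got ≠ [] then (got.foldl max s.1, true) else s

/-- The treatment of bit position `i` in the search for witnesses. -/
noncomputable def witnessStep (n : ℕ) (s : Bits × Bool) (i : ℕ) : Prog (Bits × Bool) :=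
  (decay4 n (if s.1.getD i false then some s.1 else none)).bind fun got =>
    Prog.done (witnessUpdate s i got)

theorem findWitnesses_eq_foldlM (n l : ℕ) (m : Bits) :
    findWitnesses n l m = (List.range l).foldlM (witnessStep n) (m, false) := rfl

theorem hasDuration_witnessStep (n : ℕ) (s : Bits × Bool) (i : ℕ) :
    (witnessStep n s i).HasDuration (4 * lg n) :=
  (hasDuration_decay4 n _).bind fun _ => Prog.hasDuration_done _

theorem hasDuration_findWitnesses (n l : ℕ) (m : Bits) :
    (findWitnesses n l m).HasDuration (l * (4 * lg n)) := by
  simpa [findWitnesses_eq_foldlM] using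
    Prog.hasDuration_foldlM (witnessStep n) (List.range l) (hasDuration_witnessStep n) (m, false)

section Witnesses

variable {V : Type}

/-- The states `s` that the search for witnesses can reach from the strings `m`. -/
structure WitnessInvariant (m : V → Bits) (s : V → Bits × Bool) : Prop where
  exists_eq : ∀ v, ∃ u, (s v).1 = m u
  eq_of_not_witness : ∀ v, (s v).2 = false → (s v).1 = m v
  exists_lt_of_witness : ∀ v, (s v).2 = true → ∃ u, m u < (s v).1

-- A received string has bit `i` set, so it differs from the string of the receiver; the maximum of
-- the two exceeds one of them.
theorem WitnessInvariant.update {m : V → Bits} {s : V → Bits × Bool} {i : ℕ}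
    (hs : WitnessInvariant m s) {got : V → List Bits}
    (hgot : ∀ v, ∀ y ∈ got v, y.getD i false = true ∧ ∃ u, y = m u) :
    WitnessInvariant m fun v => witnessUpdate (s v) i (got v) := by
  refine ⟨fun v => ?_, fun v => ?_, fun v => ?_⟩ <;> dsimp only [witnessUpdate] <;>
    split_ifs with h
  · rcases foldl_max_mem (got v) (s v).1 with h' | h'
    · simpa only [h'] using hs.exists_eq v
    · exact (hgot v _ h').2
  · exact hs.exists_eq v
  · exact fun h => nomatch h
  · exact hs.eq_of_not_witness v
  · obtain ⟨hbit, hne⟩ := h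
    obtain ⟨y, hy⟩ := List.exists_mem_of_ne_nil _ hne
    obtain ⟨hyi, u, hu⟩ := hgot v y hy
    obtain ⟨w, hw⟩ := hs.exists_eq v
    have hys : y ≠ (s v).1 := fun h => Bool.false_ne_true (hbit.symm.trans (h ▸ hyi))
    intro _
    rcases lt_or_gt_of_ne hys with h | h
    · exact ⟨u, hu ▸ h.trans_le (le_foldl_max (got v) _)⟩
    · exact ⟨w, hw ▸ h.trans_le (le_foldl_max_of_mem _ hy)⟩
  · exact hs.exists_lt_of_witness v

theorem exists_adj_of_apply_ne {G : Digraph V} (hG : ∀ u v, ∃ k, ReachIn G k u v) {f : V → Bool}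
    {u v : V} (h : f u ≠ f v) : ∃ a b, f a = true ∧ f b = false ∧ G.Adj a b := by
  have hcross : ∀ u v, f u = true → f v = false → ∃ a b, f a = true ∧ f b = false ∧ G.Adj a b := by
    intro u v hu hv
    obtain ⟨k, hk⟩ := hG u v
    simpa using exists_adj_crossing G (P := fun w => f w = true) hu hk (by simp [hv])
  cases hu : f u <;> cases hv : f v
  · exact absurd (hu.trans hv.symm) h
  · exact hcross v u hv hu
  · exact hcross u v hu hv
  · exact absurd (hu.trans hv.symm) h

variable [Fintype V] (G : Digraph V)

theorem failure_witnessStep_invariant (n i : ℕ) {m : V → Bits} {s : V → Bits × Bool}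
    (hs : WitnessInvariant m s) :
    failure G (4 * lg n) (fun v => witnessStep n (s v) i) (WitnessInvariant m) = 0 := by
  refine nonpos_iff_eq_zero.1 ?_
  rw [← failure_decay4_receivedFrom G n fun v =>
    if (s v).1.getD i false then some (s v).1 else none]
  simp only [witnessStep]
  rw [failure_map]
  refine failure_mono G fun got hgot => hs.update fun v y hy => ?_
  obtain ⟨u, -, hu⟩ := hgot v y hy
  dsimp only at hu
  split_ifs at hu with hbit
  obtain rfl := Option.some_injective _ hu
  exact ⟨hbit, hs.exists_eq u⟩

theorem failure_findWitnesses_invariant (n l : ℕ) (m : V → Bits) :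
    failure G (l * (4 * lg n)) (fun v => findWitnesses n l (m v)) (WitnessInvariant m) = 0 := by
  have h := failure_foldlM_le G (f := fun _ => witnessStep n) (ε := 0) (E := WitnessInvariant m)
    (fun _ => hasDuration_witnessStep n) (List.range l)
    (fun i _ s hs => (failure_witnessStep_invariant G n i hs).le)
    (fun v => (m v, false)) ⟨fun v => ⟨v, rfl⟩, fun v _ => rfl, fun v h => nomatch h⟩
  simpa [← findWitnesses_eq_foldlM] using h

theorem failure_foldlM_witnessStep_of_witness (n : ℕ) (l : List ℕ) {s : V → Bits × Bool}
    (hs : ∃ v, (s v).2 = true) :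
    failure G (l.length * (4 * lg n)) (fun v => l.foldlM (witnessStep n) (s v))
      (fun s => ∃ v, (s v).2 = true) = 0 := by
  have h := failure_foldlM_le G (f := fun _ => witnessStep n) (ε := 0)
    (E := fun s : V → Bits × Bool => ∃ v, (s v).2 = true)
    (fun _ => hasDuration_witnessStep n) l (fun i _ s hs => ?_) s hs
  · simpa using h
  obtain ⟨v, hv⟩ := hs
  simp only [witnessStep]
  rw [failure_map, ← failure_decay4_receivedFrom G n fun v =>
    if (s v).1.getD i false then some (s v).1 else none]
  exact failure_mono G fun got _ => ⟨v, by dsimp only [witnessUpdate]; split_ifs <;> simp [hv]⟩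

theorem failure_decay4_witness_le (hG : ∀ u v, ∃ k, ReachIn G k u v) {m : V → Bits} {i : ℕ}
    {u v : V} (h : (m u).getD i false ≠ (m v).getD i false) :
    failure G (4 * lg (Fintype.card V))
      (fun v => decay4 (Fintype.card V) (if (m v).getD i false then some (m v) else none))
      (fun got => ∃ v, (m v).getD i false = false ∧ got v ≠ []) ≤ (7 / 8) ^ 4 := by
  obtain ⟨a, b, ha, hb, hab⟩ := exists_adj_of_apply_ne hG (f := fun w => (m w).getD i false) h
  refine (failure_mono G fun got hgot => ?_).trans (failure_decay4_ne_nil_le G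
    (fun v => if (m v).getD i false then some (m v) else none) hab
    (by simp only [hb]; rfl) (by simp only [ha]; simp))
  exact ⟨b, hb, hgot⟩

open Classical in
theorem failure_foldlM_witnessStep_le (hG : ∀ u v, ∃ k, ReachIn G k u v) (m : V → Bits) (u v : V)
    (l : List ℕ) :
    failure G (l.length * (4 * lg (Fintype.card V)))
        (fun v => l.foldlM (witnessStep (Fintype.card V)) (m v, false))
        (fun s => ∃ v, (s v).2 = true) ≤
      (l.map fun i => if (m u).getD i false = (m v).getD i false then (1 : ℝ≥0∞)
        else (7 / 8) ^ 4).prod := by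
  induction l with
  | nil => simpa using failure_le_one G _ _ _
  | cons i l ih =>
    simp only [List.foldlM_cons, Prog.monad_bind_eq, List.length_cons, List.map_cons,
      List.prod_cons]
    rw [Nat.succ_mul, add_comm]
    simp only [witnessStep, Prog.bind_assoc, Prog.bind]
    refine (failure_bind_le_mul G (fun v => hasDuration_decay4 _ _)
      (A := fun got => ∃ v, (m v).getD i false = false ∧ got v ≠ []) ?_
      (fun got ⟨w, hw⟩ => ?_) fun got hgot => ?_).trans_eq (mul_comm _ _)
    · split_ifs with hbit
      · exact failure_le_one G _ _ _
      · exact failure_decay4_witness_le G hG hbit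
    · exact failure_foldlM_witnessStep_of_witness G _ l ⟨w, by rw [witnessUpdate, if_pos hw]⟩
    · simp only [witnessUpdate, if_neg (not_exists.1 hgot _)]
      exact ih

theorem failure_findWitnesses_witness_le (l : ℕ) (hG : ∀ u v, ∃ k, ReachIn G k u v)
    (m : V → Bits) (u v : V) :
    failure G (l * (4 * lg (Fintype.card V))) (fun v => findWitnesses (Fintype.card V) l (m v))
      (fun s => ∃ v, (s v).2 = true) ≤ missWeight l (m u) (m v) := by
  have h := failure_foldlM_witnessStep_le G hG m u v (List.range l)
  rw [List.length_range] at h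
  refine h.trans_eq ?_
  rw [missWeight, ← List.prod_toFinset _ List.nodup_range, List.toFinset_range]

end Witnesses

/-! ### Selection -/

/-- On the network `G` the procedure `B` takes its fixed time and, except with probability `ε`, it
is correct and lets every source keep its own string. -/
structure Reliable (B : MultiBroadcast) {V : Type} [Fintype V] (G : Digraph V) (n D lmax : ℕ)
    (ε : ℝ≥0∞) : Prop where
  hasDuration : ∀ l x, (B.run n D l x).HasDuration (B.time n D)
  failure_le : ∀ l ≤ lmax, ∀ f : V → Option Bits, (∀ v, ∀ y ∈ f v, y.length = l) →
    failure G (B.time n D) (fun v => B.run n D l (f v))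
      (fun m => MultiBroadcast.Correct f m ∧ ∀ v, f v ≠ none → m v = f v) ≤ ε

theorem MultiBroadcast.Correct.exists_eq_some {V : Type} {f m : V → Option Bits}
    (h : MultiBroadcast.Correct f m) (hf : ∃ v, f v ≠ none) :
    ∃ y : V → Bits, m = (fun v => some (y v)) ∧ ∀ v, ∃ u, f u = some (y v) := by
  have hm : ∀ v, ∃ y, m v = some y ∧ ∃ u, f u = some y := fun v => by
    obtain ⟨u, hu, hmv⟩ := h.2 hf v
    obtain ⟨y, hy⟩ := Option.ne_none_iff_exists'.1 hu
    exact ⟨y, hmv.trans hy, u, hy⟩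
  choose y hy hfy using hm
  exact ⟨y, funext hy, hfy⟩

/-- The fixed time of Selection. -/
def selectionTime (B : MultiBroadcast) (n D l : ℕ) : ℕ :=
  B.time n D + (l * (4 * lg n) + B.time n D)

/-- The part of Selection after the first broadcast. -/
noncomputable def selectionTail (B : MultiBroadcast) (n D l : ℕ) :
    Option Bits → Prog (Option Bits × Bool)
  | none => (Prog.idle (l * (4 * lg n) + B.time n D)).bind fun _ => Prog.done (none, false)
  | some m₀ => (findWitnesses n l m₀).bind fun s =>
      (B.run n D l (if s.2 then some s.1 else none)).bind fun p =>
        Prog.done (p.elim (some s.1, true) fun q => (some q, false))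

theorem selection_eq_bind (B : MultiBroadcast) (n D l : ℕ) (x : Option Bits) :
    selection B n D l x = (B.run n D l x).bind (selectionTail B n D l) := by
  unfold selection
  rw [Prog.monad_bind_eq]
  congr 1
  funext m
  cases m with
  | none => rfl
  | some m₀ =>
    change (findWitnesses n l m₀).bind _ = (findWitnesses n l m₀).bind _
    congr 1
    funext s
    change (B.run n D l _).bind _ = (B.run n D l _).bind _
    congr 1
    funext p
    cases p <;> rfl

theorem hasDuration_selection {B : MultiBroadcast} {n D : ℕ}
    (hB : ∀ l x, (B.run n D l x).HasDuration (B.time n D)) (l : ℕ) (x : Option Bits) :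
    (selection B n D l x).HasDuration (selectionTime B n D l) := by
  rw [selection_eq_bind]
  refine (hB l x).bind fun m => ?_
  cases m with
  | none => exact (Prog.hasDuration_idle _).bind fun _ => Prog.hasDuration_done _
  | some m₀ =>
    exact (hasDuration_findWitnesses n l m₀).bind fun s => (hB l _).bind fun _ =>
      Prog.hasDuration_done _

section Selection

variable {V : Type} [Fintype V] {G : Digraph V} {B : MultiBroadcast} {n D lmax : ℕ} {ε : ℝ≥0∞}

theorem failure_selectionTail_le (hB : Reliable B G n D lmax ε) {l : ℕ} (hl : l ≤ lmax)
    {m : V → Bits} (hm : ∀ v, (m v).length = l) {W : (V → Bits × Bool) → Prop}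
    {E : (V → Option Bits × Bool) → Prop} {δ : ℝ≥0∞}
    (hW : failure G (l * (4 * lg n)) (fun v => findWitnesses n l (m v)) W ≤ δ)
    (hWE : ∀ s p, W s → WitnessInvariant m s →
      MultiBroadcast.Correct (fun v => if (s v).2 then some (s v).1 else none) p →
      E fun v => (p v).elim (some (s v).1, true) fun q => (some q, false)) :
    failure G (l * (4 * lg n) + B.time n D) (fun v => selectionTail B n D l (some (m v))) E ≤
      δ + ε := by
  refine failure_bind_le_add G (fun v => hasDuration_findWitnesses n l (m v))
    (A := fun s => W s ∧ WitnessInvariant m s) ?_ ?_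
  · refine (failure_and_le G).trans ?_
    rwa [failure_findWitnesses_invariant, add_zero]
  · rintro s ⟨hs, hinv⟩
    rw [failure_map]
    refine (failure_mono G fun p hp => hWE s p hs hinv hp.1).trans
      (hB.failure_le l hl (fun v => if (s v).2 then some (s v).1 else none) fun v y hy => ?_)
    obtain ⟨u, hu⟩ := hinv.exists_eq v
    obtain ⟨-, hy⟩ := Option.ite_none_right_eq_some.1 hy
    rw [← Option.some_injective _ hy, hu, hm]

theorem failure_selection_le (hB : Reliable B G n D lmax ε) {l : ℕ} (hl : l ≤ lmax)
    {x : V → Option Bits} (hx : ∀ v, ∀ y ∈ x v, y.length = l) (hne : ∃ v, x v ≠ none)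
    {E : (V → Option Bits × Bool) → Prop} {δ : ℝ≥0∞}
    (hE : ∀ m : V → Bits, (∀ v, ∃ u, x u = some (m v)) → (∀ v y, x v = some y → m v = y) →
      failure G (l * (4 * lg n) + B.time n D) (fun v => selectionTail B n D l (some (m v))) E ≤ δ) :
    failure G (selectionTime B n D l) (fun v => selection B n D l (x v)) E ≤ ε + δ := by
  simp only [selection_eq_bind]
  refine failure_bind_le_add G (fun v => hB.hasDuration l (x v)) (hB.failure_le l hl x hx) ?_
  rintro p ⟨hp, hown⟩
  obtain ⟨m, rfl, hm⟩ := hp.exists_eq_some hne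
  exact hE m hm fun v y hy => Option.some_injective _ ((hown v (by simp [hy])).trans hy)

theorem failure_selection_le_of_unique (hB : Reliable B G n D lmax ε) {l : ℕ} (hl : l ≤ lmax)
    {x : V → Option Bits} {z : Bits} (hx : ∀ v, ∀ y ∈ x v, y.length = l) (hne : ∃ v, x v ≠ none)
    (hz : ∀ v y, x v = some y → y = z) :
    failure G (selectionTime B n D l) (fun v => selection B n D l (x v))
      (fun o => ∀ v, o v = (some z, true)) ≤ 2 * ε := by
  rw [two_mul]
  refine failure_selection_le hB hl hx hne fun m hmx _ => ?_
  have hmz : ∀ v, m v = z := fun v => (hmx v).elim fun u hu => hz u _ hu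
  have hlen : ∀ v, (m v).length = l := fun v => (hmx v).elim fun u hu => hx u _ hu
  refine (failure_selectionTail_le hB hl hlen (failure_findWitnesses_invariant G n l m).le
    fun s p hinv _ hp v => ?_).trans_eq (zero_add ε)
  have hwit : ∀ v, (s v).2 = false := fun v => by
    by_contra hs
    obtain ⟨u, hu⟩ := hinv.exists_lt_of_witness v (by simpa using hs)
    obtain ⟨w, hw⟩ := hinv.exists_eq v
    rw [hw, hmz, hmz] at hu
    exact lt_irrefl _ hu
  have hpv : p v = none := hp.1 (fun v => by simp [hwit v]) v
  simp [hpv, hinv.eq_of_not_witness v (hwit v), hmz v]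

theorem failure_selection_le_missWeight (hB : Reliable B G n D lmax ε) {l : ℕ} (hl : l ≤ lmax)
    (hn : Fintype.card V = n) (hG : ∀ u v, ∃ k, ReachIn G k u v)
    {x : V → Option Bits} (hx : ∀ v, ∀ y ∈ x v, y.length = l) {u₁ u₂ : V} {y₁ y₂ : Bits}
    (h₁ : x u₁ = some y₁) (h₂ : x u₂ = some y₂) :
    failure G (selectionTime B n D l) (fun v => selection B n D l (x v))
      (fun o => ∀ v, ∃ q, o v = (some q, false) ∧ (∃ u, x u = some q) ∧
        ∃ u y, x u = some y ∧ y < q) ≤ 2 * ε + missWeight l y₁ y₂ := by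
  subst hn
  rw [two_mul, add_assoc, add_comm ε (missWeight l y₁ y₂)]
  refine failure_selection_le hB hl hx ⟨u₁, by simp [h₁]⟩ fun m hmx hown => ?_
  have hlen : ∀ v, (m v).length = l := fun v => (hmx v).elim fun u hu => hx u _ hu
  have hwit := failure_findWitnesses_witness_le G l hG m u₁ u₂
  rw [hown u₁ y₁ h₁, hown u₂ y₂ h₂] at hwit
  refine failure_selectionTail_le hB hl hlen hwit ?_
  rintro s p ⟨w, hw⟩ hinv hp v
  obtain ⟨u, hu, hpv⟩ := hp.2 ⟨w, by simp [hw]⟩ v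
  have hu' : (s u).2 = true := by simpa using hu
  have hpu : p v = some (s u).1 := by simpa [hu'] using hpv
  obtain ⟨a, ha⟩ := hinv.exists_eq u
  obtain ⟨b, hb⟩ := hinv.exists_lt_of_witness u hu'
  obtain ⟨c, hc⟩ := hmx b
  exact ⟨(s u).1, by simp [hpu], ha ▸ hmx a, c, m b, hc, hb⟩

end Selection

/-! ### Search -/

/-- Whether an ID `x` makes a candidate a source when Search has found the bits `m` and determines
bit `i`. -/
def isSearchSource (m : Bits) (i : ℕ) (x : Bits) : Bool :=
  decide (x.take i = m) && x.getD i false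

/-- The determination of bit `i` in Search. -/
noncomputable def searchStep (B : MultiBroadcast) (n D : ℕ) (id : Option Bits) (m : Bits)
    (i : ℕ) : Prog Bits :=
  (B.run n D 1 (if id.any (isSearchSource m i) then some [true] else none)).bind fun p =>
    Prog.done (m ++ [p.isSome])

theorem search_eq_foldlM (B : MultiBroadcast) (n D k : ℕ) (id : Option Bits) :
    search B n D k id = (List.range k).foldlM (searchStep B n D id) [] := rfl

theorem search_succ (B : MultiBroadcast) (n D k : ℕ) (id : Option Bits) :
    search B n D (k + 1) id =
      (search B n D k id).bind fun m => searchStep B n D id m k := by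
  rw [search_eq_foldlM, List.range_succ, List.foldlM_append, ← search_eq_foldlM,
    Prog.monad_bind_eq]
  congr 1
  funext m
  simp

theorem hasDuration_search {B : MultiBroadcast} {n D : ℕ}
    (hB : ∀ l x, (B.run n D l x).HasDuration (B.time n D)) (k : ℕ) (id : Option Bits) :
    (search B n D k id).HasDuration (k * B.time n D) := by
  simpa [search_eq_foldlM] using Prog.hasDuration_foldlM (searchStep B n D id) (List.range k)
    (d := B.time n D) (fun m i => (hB 1 _).bind fun _ => Prog.hasDuration_done _) []

-- A candidate that agrees with the maximum `z` before position `k` and has bit `k` set, although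
-- `z` has not, would exceed `z`.
theorem MultiBroadcast.Correct.isSome_eq_getD {V : Type} {id p : V → Option Bits} {v₀ : V}
    {z : Bits} {k : ℕ} (hz : id v₀ = some z) (hmax : ∀ v y, id v = some y → y ≤ z)
    (hlen : ∀ v y, id v = some y → k < y.length)
    (hp : MultiBroadcast.Correct
      (fun v => if (id v).any (isSearchSource (z.take k) k) then some [true] else none) p) (v : V) :
    (p v).isSome = z.getD k false := by
  cases hzk : z.getD k false with
  | true =>
    obtain ⟨y, rfl, -⟩ := hp.exists_eq_some ⟨v₀, by
      simp only [hz, Option.any_some, isSearchSource, hzk]; simp⟩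
    rfl
  | false =>
    rw [hp.1 (fun w => if_neg fun hw => ?_) v]
    · rfl
    · obtain ⟨y, hy, hyk⟩ := (Option.any_eq_true _ _).1 hw
      simp only [isSearchSource, Bool.and_eq_true, decide_eq_true_eq] at hyk
      exact (hmax w y hy).not_gt (lt_of_take_eq (hlen w y hy) (hlen v₀ z hz) hyk.1 hyk.2 hzk)

section Search

variable {V : Type} [Fintype V] {G : Digraph V} {B : MultiBroadcast} {n D lmax : ℕ} {ε : ℝ≥0∞}

theorem failure_search_le (hB : Reliable B G n D lmax ε) (hlmax : 1 ≤ lmax) {l : ℕ}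
    {id : V → Option Bits} (hid : ∀ v y, id v = some y → y.length = l) {v₀ : V} {z : Bits}
    (hz : id v₀ = some z) (hmax : ∀ v y, id v = some y → y ≤ z) {k : ℕ} (hk : k ≤ l) :
    failure G (k * B.time n D) (fun v => search B n D k (id v)) (fun m => ∀ v, m v = z.take k) ≤
      k * ε := by
  induction k with
  | zero =>
    simp only [search_eq_foldlM, List.range_zero, List.foldlM_nil, Prog.monad_pure_eq]
    rw [failure_done G fun _ => by simp]
    exact zero_le
  | succ k ih =>
    simp only [search_succ]
    rw [Nat.succ_mul, Nat.cast_succ, add_mul, one_mul]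
    refine failure_bind_le_add G (fun v => hasDuration_search hB.hasDuration k (id v))
      (ih (Nat.le_of_succ_le hk)) fun m hm => ?_
    obtain rfl : m = fun _ => z.take k := funext hm
    have hlen : ∀ v y, id v = some y → k < y.length := fun v y hy => (hid v y hy).symm ▸ hk
    simp only [searchStep]
    rw [failure_map]
    refine (failure_mono G fun p hp v => ?_).trans (hB.failure_le 1 hlmax
      (fun v => if (id v).any (isSearchSource (z.take k) k) then some [true] else none)
      fun v y hy => ?_)
    · dsimp only
      rw [take_succ_eq_append_getD (hlen v₀ z hz), hp.1.isSome_eq_getD hz hmax hlen]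
    · obtain ⟨-, hy⟩ := Option.ite_none_right_eq_some.1 hy
      exact Option.some_injective _ hy ▸ rfl

end Search

/-! ### The loop of Selections -/

theorem selectionLoop_succ (B : MultiBroadcast) (n D l : ℕ) (id : Option Bits) (k : ℕ)
    (inC : Bool) :
    selectionLoop B n D l id (k + 1) inC =
      (selection B n D l (if inC then id else none)).bind fun o =>
        if o.2 then Prog.done (o.1, List.replicate (k + 2) inC)
        else (selectionLoop B n D l id k
            (inC && !(id.any fun x => o.1.any fun y => decide (x < y)))).bind fun a =>
          Prog.done (a.1, inC :: a.2) := rfl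

theorem stepsLE_selectionLoop {B : MultiBroadcast} {n D : ℕ}
    (hB : ∀ l x, (B.run n D l x).HasDuration (B.time n D)) (l : ℕ) (id : Option Bits) (k : ℕ)
    (inC : Bool) : (selectionLoop B n D l id k inC).StepsLE (k * selectionTime B n D l) := by
  induction k generalizing inC with
  | zero => trivial
  | succ k ih =>
    rw [selectionLoop_succ, Nat.succ_mul, add_comm (k * _)]
    refine (hasDuration_selection hB l _).stepsLE.bind fun o => ?_
    split_ifs
    · trivial
    · exact (ih _).bind (t := 0) fun _ => trivial

section Survivors

variable {V : Type} {id : V → Option Bits}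

theorem exists_max_id [Finite V] {S : Set V} (hS : ∃ v ∈ S, id v ≠ none) :
    ∃ v ∈ S, ∃ z, id v = some z ∧ ∀ u ∈ S, ∀ y, id u = some y → y ≤ z := by
  obtain ⟨v, ⟨hv, hid⟩, hmax⟩ := Set.exists_max_image {v ∈ S | id v ≠ none}
    (fun v => (id v).getD []) (Set.toFinite _) hS
  obtain ⟨z, hz⟩ := Option.ne_none_iff_exists'.1 hid
  refine ⟨v, hv, z, hz, fun u hu y hy => ?_⟩
  simpa only [hy, hz, Option.getD_some] using hmax u ⟨hu, by simp [hy]⟩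

theorem exists_min_id [Finite V] {S : Set V} (hS : ∃ v ∈ S, id v ≠ none) :
    ∃ v ∈ S, ∃ z, id v = some z ∧ ∀ u ∈ S, ∀ y, id u = some y → z ≤ y := by
  obtain ⟨v, ⟨hv, hid⟩, hmin⟩ := Set.exists_min_image {v ∈ S | id v ≠ none}
    (fun v => (id v).getD []) (Set.toFinite _) hS
  obtain ⟨z, hz⟩ := Option.ne_none_iff_exists'.1 hid
  refine ⟨v, hv, z, hz, fun u hu y hy => ?_⟩
  simpa only [hy, hz, Option.getD_some] using hmin u ⟨hu, by simp [hy]⟩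

/-- The candidates among `C` that remain after a Selection in which node `v` outputs `q v`. -/
def survivors (id : V → Option Bits) (C : V → Bool) (q : V → Bits) (v : V) : Bool :=
  C v && !((id v).any fun x => decide (x < q v))

variable {C : V → Bool} {q : V → Bits}

theorem survivors_eq_true_iff {v : V} :
    survivors id C q v = true ↔ C v = true ∧ ∀ x, id v = some x → q v ≤ x := by
  cases h : id v <;> simp [survivors, h]

theorem survivors_subset : {v | survivors id C q v = true} ⊆ {v | C v = true} :=
  fun _ hv => (survivors_eq_true_iff.1 hv).1

-- No output exceeds the maximum ID of a candidate.
theorem exists_survivor [Finite V] [Nonempty V]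
    (hq : ∀ v, ∃ u, C u = true ∧ id u = some (q v)) : ∃ v, survivors id C q v = true := by
  obtain ⟨u, hu, hid⟩ := hq (Classical.arbitrary V)
  obtain ⟨v, hv, z, hz, hmax⟩ := exists_max_id (id := id) (S := {v | C v = true})
    ⟨u, hu, by simp [hid]⟩
  refine ⟨v, survivors_eq_true_iff.2 ⟨hv, fun x hx => ?_⟩⟩
  obtain ⟨w, hw, hwq⟩ := hq v
  rw [← Option.some_injective _ (hz.symm.trans hx)]
  exact hmax w hw _ hwq

theorem not_survivor_of_forall_le (hq : ∀ v, ∃ u y, C u = true ∧ id u = some y ∧ y < q v) {v : V}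
    {x : Bits} (hx : id v = some x) (hmin : ∀ u, C u = true → ∀ y, id u = some y → x ≤ y) :
    ¬ survivors id C q v = true := by
  intro h
  obtain ⟨u, y, hu, hy, hlt⟩ := hq v
  exact (((survivors_eq_true_iff.1 h).2 x hx).trans (hmin u hu y hy)).not_gt hlt

theorem ncard_survivors_lt [Finite V] [Nonempty V]
    (hq : ∀ v, ∃ u y, C u = true ∧ id u = some y ∧ y < q v) :
    {v | survivors id C q v = true}.ncard < {v | C v = true}.ncard := by
  obtain ⟨u, y, hu, hy, -⟩ := hq (Classical.arbitrary V)
  obtain ⟨v, hv, x, hx, hmin⟩ := exists_min_id (id := id) (S := {v | C v = true})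
    ⟨u, hu, by simp [hy]⟩
  exact Set.ncard_lt_ncard
    ⟨survivors_subset, fun h => not_survivor_of_forall_le hq hx hmin (h hv)⟩ (Set.toFinite _)

end Survivors

section Loop

variable {V : Type}

/-- The nodes whose `j`-th recorded membership bit is set. -/
def recorded (o : V → Option Bits × List Bool) (j : ℕ) : Set V :=
  {v | (o v).2.getD j false = true}

theorem recorded_cons_zero (C : V → Bool) (a : V → Option Bits × List Bool) :
    recorded (fun v => ((a v).1, C v :: (a v).2)) 0 = {v | C v = true} := by
  ext v
  simp [recorded]

theorem recorded_cons_succ (C : V → Bool) (a : V → Option Bits × List Bool) (j : ℕ) :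
    recorded (fun v => ((a v).1, C v :: (a v).2)) (j + 1) = recorded a j := by
  ext v
  simp [recorded]

theorem recorded_replicate (C : V → Bool) (x : Option Bits) {j k : ℕ} (hj : j < k) :
    recorded (fun v => (x, List.replicate k (C v))) j = {v | C v = true} := by
  ext v
  simp [recorded, List.getD_eq_getElem?_getD, hj]

/-- What the loop achieves from the candidate set `C` on, with `k` iterations. -/
structure LoopSucceeds (id : V → Option Bits) (k : ℕ) (C : V → Bool)
    (o : V → Option Bits × List Bool) : Prop where
  elected : ∃ v z, id v = some z ∧ ∀ w, (o w).1 = some z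
  recorded_zero : recorded o 0 = {v | C v = true}
  eliminates : ∀ j < k, 1 < (recorded o j).ncard →
    (recorded o (j + 1)).Nonempty ∧ recorded o (j + 1) ⊆ recorded o j ∧
    ∀ v ∈ recorded o j, (∀ u ∈ recorded o j, ∀ x ∈ id v, ∀ y ∈ id u, x ≤ y) →
      v ∉ recorded o (j + 1)

variable {id : V → Option Bits}

theorem LoopSucceeds.cons [Finite V] [Nonempty V] {k : ℕ} {C : V → Bool} {q : V → Bits}
    {a : V → Option Bits × List Bool} (hC : ∀ v, C v = true → id v ≠ none)
    (hq : ∀ v, ∃ u, C u = true ∧ id u = some (q v))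
    (hq' : ∀ v, ∃ u y, C u = true ∧ id u = some y ∧ y < q v)
    (ha : LoopSucceeds id k (survivors id C q) a) :
    LoopSucceeds id (k + 1) C fun v => ((a v).1, C v :: (a v).2) := by
  refine ⟨ha.elected, recorded_cons_zero C a, fun j hj hcard => ?_⟩
  cases j with
  | zero =>
    rw [recorded_cons_succ, recorded_cons_zero, ha.recorded_zero]
    refine ⟨exists_survivor hq, survivors_subset, fun v hv hmin => ?_⟩
    obtain ⟨x, hx⟩ := Option.ne_none_iff_exists'.1 (hC v hv)
    exact not_survivor_of_forall_le hq' hx fun u hu => hmin u hu x hx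
  | succ j =>
    rw [recorded_cons_succ] at hcard
    rw [recorded_cons_succ, recorded_cons_succ]
    exact ha.eliminates j (by omega) hcard

theorem loopSucceeds_replicate {C : V → Bool} {v : V} {z : Bits} (hz : id v = some z)
    (hcard : {v | C v = true}.ncard ≤ 1) (k : ℕ) :
    LoopSucceeds id k C fun v => (some z, List.replicate (k + 1) (C v)) := by
  refine ⟨⟨v, z, hz, fun _ => rfl⟩, recorded_replicate C _ (by omega), fun j hj hcj => ?_⟩
  rw [recorded_replicate C _ (by omega)] at hcj
  omega

variable [Fintype V] {G : Digraph V} {B : MultiBroadcast} {n D lmax : ℕ} {ε : ℝ≥0∞}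

theorem failure_selectionLoop_le_of_ncard_eq_one (hB : Reliable B G n D lmax ε) {l : ℕ}
    (hl : l ≤ lmax) (hid : ∀ v y, id v = some y → y.length = l) {C : V → Bool}
    (hC : ∀ v, C v = true → id v ≠ none) (hcard : {v | C v = true}.ncard = 1) (k : ℕ) :
    failure G ((k + 1) * selectionTime B n D l)
      (fun v => selectionLoop B n D l (id v) (k + 1) (C v)) (LoopSucceeds id (k + 1) C) ≤
      2 * ε := by
  simp only [selectionLoop_succ]
  rw [Nat.succ_mul, add_comm]
  obtain ⟨v₀, hv₀⟩ := Set.ncard_eq_one.1 hcard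
  have hCv₀ : C v₀ = true := hv₀.symm.subset rfl
  obtain ⟨z, hz⟩ := Option.ne_none_iff_exists'.1 (hC v₀ hCv₀)
  have hsel := failure_selection_le_of_unique hB hl (x := fun v => if C v then id v else none)
    (z := z) (fun _ y hy => hid _ y (Option.ite_none_right_eq_some.1 hy).2)
    ⟨v₀, by simp [hCv₀, hz]⟩ fun v y hy => by
      obtain ⟨hv, hy⟩ := Option.ite_none_right_eq_some.1 hy
      obtain rfl : v = v₀ := hv₀.subset hv
      exact Option.some_injective _ (hy.symm.trans hz)
  refine (failure_bind_le_add G (fun v => hasDuration_selection hB.hasDuration l _) hsel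
    (ε' := 0) fun o ho => ?_).trans_eq (add_zero _)
  obtain rfl : o = fun _ => (some z, true) := funext ho
  simp only [if_true]
  rw [failure_done G (loopSucceeds_replicate hz hcard.le (k + 1))]

theorem failure_selectionLoop_succ_le (hB : Reliable B G n D lmax ε) {l : ℕ} (hl : l ≤ lmax)
    (hn : Fintype.card V = n) (hG : ∀ u v, ∃ k, ReachIn G k u v)
    (hid : ∀ v y, id v = some y → y.length = l) {δ : ℝ≥0∞}
    (hδ : ∀ u v x y, u ≠ v → id u = some x → id v = some y → missWeight l x y ≤ δ)
    {C : V → Bool} (hC : ∀ v, C v = true → id v ≠ none) (hcard : 1 < {v | C v = true}.ncard)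
    {k : ℕ} {ε' : ℝ≥0∞}
    (ih : ∀ C' : V → Bool, {v | C' v = true} ⊆ {v | C v = true} → (∃ v, C' v = true) →
      {v | C' v = true}.ncard < {v | C v = true}.ncard →
      failure G (k * selectionTime B n D l) (fun v => selectionLoop B n D l (id v) k (C' v))
        (LoopSucceeds id k C') ≤ ε') :
    failure G ((k + 1) * selectionTime B n D l)
      (fun v => selectionLoop B n D l (id v) (k + 1) (C v)) (LoopSucceeds id (k + 1) C) ≤
      2 * ε + δ + ε' := by
  simp only [selectionLoop_succ]
  rw [Nat.succ_mul, add_comm (k * _)]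
  obtain ⟨u₁, hu₁, u₂, hu₂, hne⟩ := (Set.one_lt_ncard (Set.toFinite _)).1 hcard
  obtain ⟨y₁, hy₁⟩ := Option.ne_none_iff_exists'.1 (hC u₁ hu₁)
  obtain ⟨y₂, hy₂⟩ := Option.ne_none_iff_exists'.1 (hC u₂ hu₂)
  have : Nonempty V := ⟨u₁⟩
  have hsel := failure_selection_le_missWeight hB hl hn hG
    (x := fun v => if C v then id v else none)
    (fun _ y hy => hid _ y (Option.ite_none_right_eq_some.1 hy).2)
    (Option.ite_none_right_eq_some.2 ⟨hu₁, hy₁⟩) (Option.ite_none_right_eq_some.2 ⟨hu₂, hy₂⟩)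
  refine failure_bind_le_add G (fun v => hasDuration_selection hB.hasDuration l _)
    (hsel.trans (add_le_add_right (hδ _ _ _ _ hne hy₁ hy₂) _)) fun o ho => ?_
  choose q hoq hq hq' using ho
  obtain rfl : o = fun v => (some (q v), false) := funext hoq
  simp only [Option.ite_none_right_eq_some, and_assoc] at hq hq'
  simp only [Bool.false_eq_true, if_false]
  rw [failure_map]
  exact (failure_mono G fun a ha => ha.cons hC hq hq').trans
    (ih (survivors id C q) survivors_subset (exists_survivor hq) (ncard_survivors_lt hq'))

theorem failure_selectionLoop_le (hB : Reliable B G n D lmax ε) {l : ℕ} (hl : l ≤ lmax)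
    (hn : Fintype.card V = n) (hG : ∀ u v, ∃ k, ReachIn G k u v)
    (hid : ∀ v y, id v = some y → y.length = l) {δ : ℝ≥0∞}
    (hδ : ∀ u v x y, u ≠ v → id u = some x → id v = some y → missWeight l x y ≤ δ) {k : ℕ}
    {C : V → Bool} (hC : ∀ v, C v = true → id v ≠ none) (hne : ∃ v, C v = true)
    (hk : {v | C v = true}.ncard ≤ k) :
    failure G (k * selectionTime B n D l) (fun v => selectionLoop B n D l (id v) k (C v))
      (LoopSucceeds id k C) ≤ k * (2 * ε + δ) := by
  have hpos : 0 < {v | C v = true}.ncard := (Set.ncard_pos (Set.toFinite _)).2 hne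
  induction k generalizing C with
  | zero => omega
  | succ k ih =>
    have hsum : ((k + 1 : ℕ) : ℝ≥0∞) * (2 * ε + δ) = 2 * ε + δ + k * (2 * ε + δ) := by
      push_cast
      ring
    rw [hsum]
    rcases Nat.lt_or_ge 1 {v | C v = true}.ncard with hcard | hcard
    · exact failure_selectionLoop_succ_le hB hl hn hG hid hδ hC hcard
        fun C' hsub hne' hlt => ih (fun v hv => hC v (hsub hv)) hne' (by omega)
          ((Set.ncard_pos (Set.toFinite _)).2 hne')
    · exact (failure_selectionLoop_le_of_ncard_eq_one hB hl hid hC (by omega) k).trans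
        (le_self_add.trans le_self_add)

end Loop

/-! ### Leader election from given IDs -/

/-- The part of the algorithm after the choice of the IDs. -/
noncomputable def electFrom (κ : Constants) (B : MultiBroadcast) (n D : ℕ) (id : Option Bits) :
    Prog Outcome :=
  (search B n D (sqrtLg n) id).bind fun m =>
    (selectionLoop B n D (κ.bits * lg n) id (κ.rounds * sqrtLg n)
      (id.any fun x => decide (x.take (sqrtLg n) = m))).bind fun a => Prog.done ⟨id, a.1, a.2⟩

/-- The choice of the ID of a node. -/
noncomputable def chooseId (κ : Constants) (n : ℕ) : Prog (Option Bits) :=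
  (Prog.flip ((κ.cand * lg n : ℝ≥0) / n)).bind fun c =>
    if c then (randomBits (κ.bits * lg n)).bind fun x => Prog.done (some x) else Prog.done none

theorem leaderElection_eq_bind (κ : Constants) (B : MultiBroadcast) (n D : ℕ) :
    leaderElection κ B n D = (chooseId κ n).bind (electFrom κ B n D) := by
  unfold leaderElection chooseId
  simp only [Prog.monad_bind_eq, Prog.bind_assoc]
  congr 1
  funext c
  cases c <;> rfl

/-- The time bound of the algorithm. -/
noncomputable def electionTime (κ : Constants) (B : MultiBroadcast) (n D : ℕ) : ℕ :=
  sqrtLg n * B.time n D + κ.rounds * sqrtLg n * selectionTime B n D (κ.bits * lg n)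

/-- The IDs are suitable for the algorithm: there is a candidate, at most `N` candidates share the
same first `s` bits, and any two IDs of `l` bits differ in many positions. -/
structure GoodIds {V : Type} (l s N : ℕ) (δ : ℝ≥0∞) (id : V → Option Bits) : Prop where
  length_eq : ∀ v y, id v = some y → y.length = l
  exists_candidate : ∃ v, id v ≠ none
  sharing_le : ∀ w : Bits, {v | ∃ y, id v = some y ∧ y.take s = w}.ncard ≤ N
  missWeight_le : ∀ u v x y, u ≠ v → id u = some x → id v = some y → missWeight l x y ≤ δ

theorem GoodIds.injective {V : Type} {l s N : ℕ} {δ : ℝ≥0∞} {id : V → Option Bits}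
    (h : GoodIds l s N δ id) (hδ : δ < 1) {u v : V} {x : Bits} (hu : id u = some x)
    (hv : id v = some x) : u = v := by
  by_contra hne
  have hle := h.missWeight_le u v x x hne hu hv
  rw [missWeight_self] at hle
  exact hle.not_gt hδ

/-- The three guarantees of the algorithm with `N` iterations of Selection. -/
def ElectionSucceeds {V : Type} (N : ℕ) (ω : V → Outcome) : Prop :=
  LeaderElected ω ∧ SearchNarrows N ω ∧ SelectionEliminates N ω

theorem sqrtLg_le_lg (n : ℕ) : sqrtLg n ≤ lg n := by
  rw [sqrtLg, Nat.ceil_le]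
  rcases Nat.eq_zero_or_pos (lg n) with h | h
  · simp [h]
  · have hlg : (1 : ℝ) ≤ lg n := by exact_mod_cast h
    rw [Real.sqrt_le_left (by linarith)]
    nlinarith

theorem LoopSucceeds.leaderElected {V : Type} {l s N k : ℕ} {δ : ℝ≥0∞} {id : V → Option Bits}
    {C : V → Bool} {a : V → Option Bits × List Bool} (ha : LoopSucceeds id k C a) (hδ : δ < 1)
    (hid : GoodIds l s N δ id) : LeaderElected fun v => (⟨id v, (a v).1, (a v).2⟩ : Outcome) := by
  obtain ⟨v, x, hx, hlead⟩ := ha.elected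
  exact ⟨x, hlead, v, hx, fun w hw => hid.injective hδ hw hx⟩

theorem failure_electFrom_le {V : Type} [Fintype V] {G : Digraph V} {κ : Constants}
    {B : MultiBroadcast} {n D : ℕ} {ε δ : ℝ≥0∞} (hB : Reliable B G n D (κ.bits * lg n) ε)
    (hbits : 1 ≤ κ.bits) (hn2 : 2 ≤ n)
    (hn : Fintype.card V = n) (hG : ∀ u v, ∃ k, ReachIn G k u v) {id : V → Option Bits}
    (hδ1 : δ < 1)
    (hid : GoodIds (κ.bits * lg n) (sqrtLg n) (κ.rounds * sqrtLg n) δ id) :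
    failure G (electionTime κ B n D) (fun v => electFrom κ B n D (id v))
      (ElectionSucceeds (κ.rounds * sqrtLg n)) ≤
    sqrtLg n * ε + (κ.rounds * sqrtLg n : ℕ) * (2 * ε + δ) := by
  set s := sqrtLg n
  set N := κ.rounds * s
  have hlg : 1 ≤ lg n := Nat.clog_pos (by norm_num) hn2
  have hsl : s ≤ κ.bits * lg n := (sqrtLg_le_lg n).trans (Nat.le_mul_of_pos_left _ hbits)
  obtain ⟨v₁, hv₁⟩ := hid.exists_candidate
  obtain ⟨v₀, -, z, hz, hmax⟩ := exists_max_id (S := Set.univ) ⟨v₁, trivial, hv₁⟩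
  refine failure_bind_le_add G (fun v => hasDuration_search hB.hasDuration _ _)
    (failure_search_le hB (Nat.mul_pos hbits hlg) hid.length_eq hz (fun v => hmax v trivial) hsl)
    fun m hm => ?_
  obtain rfl : m = fun _ => z.take s := funext hm
  rw [failure_map]
  set C : V → Bool := fun v => (id v).any fun x => decide (x.take s = z.take s) with hC
  have hCiff : ∀ v, C v = true ↔ ∃ y, id v = some y ∧ y.take s = z.take s := fun v => by
    simp [hC, Option.any_eq_true]
  have hne : ∃ v, C v = true := ⟨v₀, (hCiff v₀).2 ⟨z, hz, rfl⟩⟩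
  have hle : {v | C v = true}.ncard ≤ N := by
    simpa only [hCiff] using hid.sharing_le (z.take s)
  have hsome : ∀ v, C v = true → id v ≠ none := fun v hv => by
    obtain ⟨y, hy, -⟩ := (hCiff v).1 hv
    simp [hy]
  refine (failure_mono G fun a ha => ⟨ha.leaderElected hδ1 hid, ?_, ha.eliminates⟩).trans
    (failure_selectionLoop_le hB le_rfl hn hG hid.length_eq hid.missWeight_le hsome hne hle)
  have hzero : candidates (fun v => (⟨id v, (a v).1, (a v).2⟩ : Outcome)) 0 = {v | C v = true} :=
    ha.recorded_zero
  rw [SearchNarrows, hzero]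
  exact ⟨(Set.ncard_pos (Set.toFinite _)).2 hne, hle⟩

/-! ### The law of the IDs -/

/-- The uniform law on the strings of `l` bits. -/
noncomputable def bitsLaw : ℕ → PMF Bits
  | 0 => PMF.pure []
  | l + 1 => (coinPMF (min 1 2⁻¹) (min_le_left _ _)).bind fun b => (bitsLaw l).map (b :: ·)

/-- The law of the ID of a node, which is a candidate with probability `q`. -/
noncomputable def idLaw (q : ℝ≥0) (hq : q ≤ 1) (l : ℕ) : PMF (Option Bits) :=
  (coinPMF q hq).bind fun c => if c then (bitsLaw l).map some else PMF.pure none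

theorem settle_bind_of_settle_eq {α β : Type} {P : Prog α} {p : PMF α}
    (h : P.settle = p.map Prog.done) (F : α → Prog β) :
    (P.bind F).settle = p.bind fun a => (F a).settle := by
  rw [Prog.settle_bind, h, PMF.bind_map]
  rfl

theorem settle_flip (p : ℝ≥0) :
    (Prog.flip p).settle = (coinPMF (min 1 p) (min_le_left _ _)).map Prog.done := by
  rw [← PMF.bind_pure_comp]
  rfl

theorem settle_randomBits : ∀ l, (randomBits l).settle = (bitsLaw l).map Prog.done
  | 0 => by simp [randomBits, bitsLaw, Prog.monad_pure_eq, Prog.settle, PMF.pure_map]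
  | l + 1 => by
    change ((Prog.flip 2⁻¹).bind fun b => (randomBits l).bind fun x =>
      Prog.done (b :: x)).settle = _
    rw [settle_bind_of_settle_eq (settle_flip _), bitsLaw, PMF.map_bind]
    congr 1
    funext b
    rw [settle_bind_of_settle_eq (settle_randomBits l), PMF.map_comp, ← PMF.bind_pure_comp]
    rfl

theorem settle_chooseId (κ : Constants) (n : ℕ) :
    (chooseId κ n).settle =
      (idLaw (min 1 ((κ.cand * lg n : ℝ≥0) / n)) (min_le_left _ _) (κ.bits * lg n)).map
        Prog.done := by
  rw [chooseId, settle_bind_of_settle_eq (settle_flip _), idLaw, PMF.map_bind]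
  congr 1
  funext c
  cases c
  · simp [Prog.settle, PMF.pure_map]
  · simp only [if_true]
    rw [settle_bind_of_settle_eq (settle_randomBits _), PMF.map_comp, ← PMF.bind_pure_comp]
    rfl

theorem hasDuration_randomBits : ∀ l, (randomBits l).HasDuration 0
  | 0 => rfl
  | l + 1 => (Prog.hasDuration_flip _).bind (t := 0) fun _ =>
      (hasDuration_randomBits l).bind (t := 0) fun _ => rfl

theorem hasDuration_chooseId (κ : Constants) (n : ℕ) : (chooseId κ n).HasDuration 0 :=
  (Prog.hasDuration_flip _).bind (t := 0) fun c => by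
    cases c
    · rfl
    · exact (hasDuration_randomBits _).bind (t := 0) fun _ => rfl

theorem expect_eq_mean_of_settle {V α : Type} [Fintype V] (G : Digraph V) {P : Prog α} {p : PMF α}
    (h : P.settle = p.map Prog.done) (φ : (V → α) → ℝ≥0∞) :
    expect G 0 (fun _ : V => P) φ = mean (indep fun _ => p) φ := by
  rw [expect, exec, h, indep_map, mean_map]
  simp only [outputs_done, Option.elim_some]

theorem mean_idLaw (q : ℝ≥0) (hq : q ≤ 1) (l : ℕ) (φ : Option Bits → ℝ≥0∞) :
    mean (idLaw q hq l) φ =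
      q * mean (bitsLaw l) (fun x => φ (some x)) + ((1 - q : ℝ≥0) : ℝ≥0∞) * φ none := by
  rw [idLaw, mean_bind, mean_coin]
  simp [mean_map, mean_pure]

theorem mean_bitsLaw_succ (l : ℕ) (φ : Bits → ℝ≥0∞) :
    mean (bitsLaw (l + 1)) φ = 2⁻¹ * mean (bitsLaw l) (fun x => φ (true :: x)) +
      2⁻¹ * mean (bitsLaw l) (fun x => φ (false :: x)) := by
  rw [bitsLaw, mean_bind, mean_coin]
  have h1 : min 1 (2 : ℝ≥0)⁻¹ = 2⁻¹ := min_eq_right (by norm_num)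
  have h2 : (1 : ℝ≥0) - 2⁻¹ = 2⁻¹ := by
    rw [← NNReal.coe_inj, NNReal.coe_sub (by norm_num)]; norm_num
  have h3 : ((2⁻¹ : ℝ≥0) : ℝ≥0∞) = 2⁻¹ := by rw [ENNReal.coe_inv (by norm_num)]; rfl
  rw [h1, h2, h3]
  simp [mean_map]

theorem length_of_mem_support_bitsLaw : ∀ {l : ℕ} {x : Bits}, x ∈ (bitsLaw l).support →
    x.length = l
  | 0, x, h => by
    simp only [bitsLaw, PMF.support_pure, Set.mem_singleton_iff] at h
    simp [h]
  | l + 1, x, h => by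
    obtain ⟨b, -, hx⟩ := (PMF.mem_support_bind_iff _ _ _).1 h
    obtain ⟨y, hy, rfl⟩ := (PMF.mem_support_map_iff _ _ _).1 hx
    simp [length_of_mem_support_bitsLaw hy]

theorem length_of_mem_support_idLaw {q : ℝ≥0} {hq : q ≤ 1} {l : ℕ} {x : Bits}
    (h : some x ∈ (idLaw q hq l).support) : x.length = l := by
  obtain ⟨c, -, hx⟩ := (PMF.mem_support_bind_iff _ _ _).1 h
  cases c
  · simp at hx
  · simp only [if_true] at hx
    obtain ⟨y, hy, hyx⟩ := (PMF.mem_support_map_iff _ _ _).1 hx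
    obtain rfl := Option.some_injective _ hyx
    exact length_of_mem_support_bitsLaw hy

theorem missWeight_cons_succ (l : ℕ) (b : Bool) (x y : Bits) :
    missWeight (l + 1) (b :: x) y =
      (if b = y.getD 0 false then 1 else (7 / 8) ^ 4) * missWeight l x y.tail := by
  rw [missWeight, Finset.prod_range_succ', mul_comm]
  congr 1
  refine Finset.prod_congr rfl fun i _ => ?_
  cases y <;> simp

theorem mean_bitsLaw_missWeight : ∀ (l : ℕ) (y : Bits),
    mean (bitsLaw l) (fun x => missWeight l x y) = (2⁻¹ + 2⁻¹ * (7 / 8) ^ 4) ^ l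
  | 0, y => by simp [bitsLaw, mean_pure, missWeight]
  | l + 1, y => by
    rw [mean_bitsLaw_succ]
    simp only [missWeight_cons_succ, mean_const_mul, mean_bitsLaw_missWeight l]
    cases y.getD 0 false <;> simp <;> ring

theorem mean_bitsLaw_take_le : ∀ (s l : ℕ), s ≤ l → ∀ w : Bits,
    mean (bitsLaw l) (fun x => if x.take s = w then 1 else 0) ≤ 2⁻¹ ^ s
  | 0, l, _, w => by
    simp only [pow_zero]
    exact mean_le_of_le fun x => by split_ifs <;> simp
  | s + 1, 0, h, w => by omega
  | s + 1, l + 1, h, w => by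
    rw [mean_bitsLaw_succ]
    have ih := mean_bitsLaw_take_le s l (by omega)
    cases w with
    | nil => simp [mean]
    | cons c w =>
      have hc : ∀ b : Bool, mean (bitsLaw l)
          (fun x => if (b :: x).take (s + 1) = c :: w then (1 : ℝ≥0∞) else 0) ≤
            if b = c then 2⁻¹ ^ s else 0 := by
        intro b
        split_ifs with hbc
        · simpa [hbc] using ih w
        · simp [hbc, mean]
      calc _ ≤ 2⁻¹ * (if true = c then (2⁻¹ : ℝ≥0∞) ^ s else 0) +
            2⁻¹ * (if false = c then (2⁻¹ : ℝ≥0∞) ^ s else 0) := by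
            gcongr <;> exact hc _
        _ = 2⁻¹ ^ (s + 1) := by cases c <;> simp [pow_succ']

/-! ### Random IDs are good -/

section RandomIds

variable {V : Type} [Fintype V]

theorem mean_indep_pair {β : Type} (p : V → PMF β) {u v : V} (huv : u ≠ v) (f : β → β → ℝ≥0∞) :
    mean (indep p) (fun a => f (a u) (a v)) = mean (p u) fun x => mean (p v) fun y => f x y := by
  classical
  have hsplit : ∀ a : V → β, f (a u) (a v) = ∑' x, ∏ w ∈ ({u, v} : Finset V),
      (if w = u then (if a w = x then 1 else 0) else f x (a w)) := by
    intro a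
    simp only [Finset.prod_pair huv, if_true, if_neg huv.symm]
    rw [tsum_eq_single (a u)]
    · simp
    · intro x hx; simp [Ne.symm hx]
  simp only [hsplit]
  rw [mean_tsum, mean]
  refine tsum_congr fun x => ?_
  rw [mean_indep_prod_finset {u, v} p
    (fun w b => if w = u then (if b = x then 1 else 0) else f x b), Finset.prod_pair huv]
  simp only [if_true, if_neg huv.symm]
  congr 1
  rw [mean, tsum_eq_single x]
  · simp
  · intro y hy; simp [hy]

/-- Whether the ID begins with `w`, a string of `s` bits. -/
noncomputable def initialIndicator (s : ℕ) (w : Bits) : Option Bits → ℝ≥0∞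
  | none => 0
  | some x => if x.take s = w then 1 else 0

/-- The number of sets of `k` candidates whose IDs agree in the first `s` bits: one set `A` and one
common string `w` contribute `∏ v ∈ A, initialIndicator s w (id v)`. -/
noncomputable def prefixClashes (k s : ℕ) (id : V → Option Bits) : ℝ≥0∞ :=
  ∑ A ∈ Finset.powersetCard k Finset.univ, ∑' w, ∏ v ∈ A, initialIndicator s w (id v)

/-- The risk of not telling the IDs of two nodes apart, which is `0` unless both are candidates. -/
noncomputable def pairRisk (l : ℕ) : Option Bits → Option Bits → ℝ≥0∞
  | some x, some y => missWeight l x y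
  | _, _ => 0

open Classical in
/-- The union bound over all pairs for the risk of not telling two IDs apart. -/
noncomputable def pairsRisk (l : ℕ) (id : V → Option Bits) : ℝ≥0∞ :=
  ∑ e ∈ (Finset.univ : Finset V).offDiag, pairRisk l (id e.1) (id e.2)

open Classical in
/-- An upper bound for the failure probability of the algorithm with the given IDs, when `N`
candidates may share a prefix of `s` bits and Partial Multi-Broadcast fails with probability at
most `ε`. -/
noncomputable def idsRisk (l s N : ℕ) (ε : ℝ≥0∞) (id : V → Option Bits) : ℝ≥0∞ :=
  (∏ v, if id v = none then 1 else 0) + prefixClashes (N + 1) s id +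
    ((s + 2 * N) * ε + N * pairsRisk l id)

theorem one_le_prefixClashes {k s : ℕ} {id : V → Option Bits} {w : Bits}
    (h : k ≤ {v | ∃ y, id v = some y ∧ y.take s = w}.ncard) : 1 ≤ prefixClashes k s id := by
  classical
  rw [Set.ncard_eq_toFinset_card'] at h
  obtain ⟨A, hA, hcard⟩ := Finset.exists_subset_card_eq h
  calc 1 = ∏ v ∈ A, initialIndicator s w (id v) := by
        rw [Finset.prod_eq_one]
        intro v hv
        obtain ⟨y, hy, hyw⟩ : ∃ y, id v = some y ∧ y.take s = w := by simpa using hA hv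
        simp [hy, initialIndicator, hyw]
    _ ≤ ∑' w, ∏ v ∈ A, initialIndicator s w (id v) :=
        ENNReal.le_tsum (f := fun w => ∏ v ∈ A, initialIndicator s w (id v)) w
    _ ≤ prefixClashes k s id := Finset.single_le_sum
        (f := fun A => ∑' w, ∏ v ∈ A, initialIndicator s w (id v)) (fun _ _ => bot_le)
        (Finset.mem_powersetCard.2 ⟨Finset.subset_univ A, hcard⟩)

theorem missWeight_le_pairsRisk {l : ℕ} {id : V → Option Bits} {u v : V} {x y : Bits}
    (huv : u ≠ v) (hu : id u = some x) (hv : id v = some y) :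
    missWeight l x y ≤ pairsRisk l id := by
  classical
  have hle := Finset.single_le_sum (f := fun e : V × V => pairRisk l (id e.1) (id e.2))
    (fun _ _ => bot_le) (a := (u, v))
    (Finset.mem_offDiag.2 ⟨Finset.mem_univ u, Finset.mem_univ v, huv⟩)
  simpa only [hu, hv, pairRisk, pairsRisk] using hle

theorem goodIds_or_one_le_idsRisk {l s N : ℕ} (hN : 1 ≤ N) (ε : ℝ≥0∞) {id : V → Option Bits}
    (hid : ∀ v y, id v = some y → y.length = l) :
    pairsRisk l id < 1 ∧ GoodIds l s N (pairsRisk l id) id ∨ 1 ≤ idsRisk l s N ε id := by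
  classical
  by_contra! hbad
  obtain ⟨hgood, hrisk⟩ := hbad
  have hexists : ∃ v, id v ≠ none := by
    by_contra! hnone
    refine hrisk.not_ge ?_
    simp only [idsRisk, hnone, if_true, Finset.prod_const_one, add_assoc]
    exact le_self_add
  have hsharing : ∀ w : Bits, {v | ∃ y, id v = some y ∧ y.take s = w}.ncard ≤ N := by
    by_contra! hclash
    obtain ⟨w, hw⟩ := hclash
    exact hrisk.not_ge <| (one_le_prefixClashes (Nat.succ_le_of_lt hw)).trans <|
      le_add_self.trans le_self_add
  have hpairs : pairsRisk l id < 1 := by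
    by_contra! hge
    refine hrisk.not_ge (le_trans ?_ (le_add_self.trans le_add_self))
    calc (1 : ℝ≥0∞) = 1 * 1 := (one_mul 1).symm
      _ ≤ N * pairsRisk l id := mul_le_mul' (by exact_mod_cast hN) hge
  exact hgood hpairs ⟨hid, hexists, hsharing, fun u v x y => missWeight_le_pairsRisk⟩

theorem one_le_sqrtLg {n : ℕ} (hn : 2 ≤ n) : 1 ≤ sqrtLg n := by
  rw [sqrtLg, Nat.one_le_ceil_iff, Real.sqrt_pos]
  exact_mod_cast Nat.clog_pos (by norm_num) hn

theorem failure_electFrom_le_idsRisk {G : Digraph V} {κ : Constants}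
    {B : MultiBroadcast} {n D : ℕ} {ε : ℝ≥0∞} (hB : Reliable B G n D (κ.bits * lg n) ε)
    (hbits : 1 ≤ κ.bits) (hrounds : 1 ≤ κ.rounds) (hn2 : 2 ≤ n)
    (hn : Fintype.card V = n) (hG : ∀ u v, ∃ k, ReachIn G k u v) {id : V → Option Bits}
    (hid : ∀ v y, id v = some y → y.length = κ.bits * lg n) :
    failure G (electionTime κ B n D) (fun v => electFrom κ B n D (id v))
      (ElectionSucceeds (κ.rounds * sqrtLg n)) ≤
    idsRisk (κ.bits * lg n) (sqrtLg n) (κ.rounds * sqrtLg n) ε id := by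
  have hN : 1 ≤ κ.rounds * sqrtLg n := Nat.mul_pos hrounds (one_le_sqrtLg hn2)
  rcases goodIds_or_one_le_idsRisk (s := sqrtLg n) hN ε hid with ⟨hpairs, hgood⟩ | hrisk
  · refine (failure_electFrom_le hB hbits hn2 hn hG hpairs hgood).trans ?_
    refine le_trans (le_of_eq ?_) le_add_self
    ring
  · exact (failure_le_one G _ _ _).trans hrisk

section Mean

variable {q : ℝ≥0} (hq : q ≤ 1) (l : ℕ)

theorem mean_prod_eq_none :
    mean (indep fun _ : V => idLaw q hq l) (fun id => ∏ v, if id v = none then 1 else 0) =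
      ((1 - q : ℝ≥0) : ℝ≥0∞) ^ Fintype.card V := by
  rw [mean_indep_prod (fun _ => idLaw q hq l) (fun _ a => if a = none then 1 else 0)]
  simp only [mean_idLaw]
  simp [mean]

theorem mean_prod_initialIndicator_le {l s : ℕ} (hsl : s ≤ l) {N : ℕ} {A : Finset V}
    (hA : A.card = N + 1) (w : Bits) :
    mean (indep fun _ : V => idLaw q hq l) (fun id => ∏ v ∈ A, initialIndicator s w (id v)) ≤
      q ^ (N + 1) * (2⁻¹ ^ s) ^ N *
        mean (bitsLaw l) (fun x => if x.take s = w then 1 else 0) := by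
  rw [mean_indep_prod_finset A (fun _ => idLaw q hq l) (fun _ => initialIndicator s w),
    Finset.prod_const, hA, mean_idLaw]
  simp only [initialIndicator, mul_zero, add_zero]
  rw [mul_pow, pow_succ (mean _ _), mul_assoc]
  gcongr
  exact mean_bitsLaw_take_le s l hsl w

theorem mean_tsum_prod_initialIndicator_le {l s : ℕ} (hsl : s ≤ l) {N : ℕ} {A : Finset V}
    (hA : A.card = N + 1) :
    mean (indep fun _ : V => idLaw q hq l)
      (fun id => ∑' w, ∏ v ∈ A, initialIndicator s w (id v)) ≤ q ^ (N + 1) * (2⁻¹ ^ s) ^ N := by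
  have hone : ∀ x : Bits, ∑' w, (if x.take s = w then (1 : ℝ≥0∞) else 0) = 1 :=
    fun x => by simp only [eq_comm (a := x.take s), tsum_ite_eq]
  calc _ = ∑' w, mean (indep fun _ : V => idLaw q hq l)
          (fun id => ∏ v ∈ A, initialIndicator s w (id v)) := mean_tsum _ _
    _ ≤ ∑' w, q ^ (N + 1) * (2⁻¹ ^ s) ^ N *
          mean (bitsLaw l) (fun x => if x.take s = w then 1 else 0) :=
        ENNReal.tsum_le_tsum (mean_prod_initialIndicator_le hq hsl hA)
    _ = q ^ (N + 1) * (2⁻¹ ^ s) ^ N := by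
        rw [ENNReal.tsum_mul_left, ← mean_tsum]
        simp only [hone, mean_const, mul_one]

theorem mean_prefixClashes_le {l s : ℕ} (hsl : s ≤ l) (N : ℕ) :
    mean (indep fun _ : V => idLaw q hq l) (prefixClashes (N + 1) s) ≤
      if Fintype.card V ≤ N then 0
      else ((Fintype.card V : ℝ≥0∞) * q) ^ (N + 1) * (2⁻¹ ^ s) ^ N := by
  unfold prefixClashes
  rw [mean_finset_sum]
  split_ifs with hN
  · rw [Finset.powersetCard_eq_empty.2 (by rw [Finset.card_univ]; omega), Finset.sum_empty]
  · calc _ ≤ ∑ _A ∈ Finset.powersetCard (N + 1) (Finset.univ : Finset V),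
            (q : ℝ≥0∞) ^ (N + 1) * (2⁻¹ ^ s) ^ N := Finset.sum_le_sum fun A hA =>
          mean_tsum_prod_initialIndicator_le hq hsl (Finset.mem_powersetCard.1 hA).2
      _ = ((Fintype.card V).choose (N + 1) : ℕ) * (q ^ (N + 1) * (2⁻¹ ^ s) ^ N) := by
          rw [Finset.sum_const, Finset.card_powersetCard, Finset.card_univ, nsmul_eq_mul]
      _ ≤ (Fintype.card V : ℝ≥0∞) ^ (N + 1) * (q ^ (N + 1) * (2⁻¹ ^ s) ^ N) := by
          gcongr
          exact_mod_cast Nat.choose_le_pow _ _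
      _ = _ := by ring

theorem mean_pairRisk {u v : V} (huv : u ≠ v) :
    mean (indep fun _ : V => idLaw q hq l) (fun id => pairRisk l (id u) (id v)) =
      q ^ 2 * (2⁻¹ + 2⁻¹ * (7 / 8) ^ 4) ^ l := by
  have hsome : ∀ x, mean (idLaw q hq l) (fun y => pairRisk l (some x) y) =
      q * (2⁻¹ + 2⁻¹ * (7 / 8) ^ 4) ^ l := fun x => by
    rw [mean_idLaw]
    simp only [pairRisk, missWeight_comm l x, mean_bitsLaw_missWeight, mul_zero, add_zero]
  have hnone : mean (idLaw q hq l) (fun y => pairRisk l none y) = 0 := by simp [mean, pairRisk]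
  rw [mean_indep_pair _ huv, mean_idLaw]
  simp only [hsome, hnone, mean_const, mul_zero, add_zero]
  ring

theorem mean_pairsRisk_le :
    mean (indep fun _ : V => idLaw q hq l) (pairsRisk l) ≤
      ((Fintype.card V : ℝ≥0∞) * q) ^ 2 * (2⁻¹ + 2⁻¹ * (7 / 8) ^ 4) ^ l := by
  classical
  unfold pairsRisk
  rw [mean_finset_sum, Finset.sum_congr rfl fun e he =>
    mean_pairRisk hq l (Finset.mem_offDiag.1 he).2.2, Finset.sum_const, Finset.offDiag_card,
    Finset.card_univ, nsmul_eq_mul, mul_pow, ← mul_assoc]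
  gcongr
  exact_mod_cast (Nat.sub_le _ _).trans (sq _).ge

theorem mean_idsRisk_le {l s : ℕ} (hsl : s ≤ l) (N : ℕ) (ε : ℝ≥0∞) :
    mean (indep fun _ : V => idLaw q hq l) (idsRisk l s N ε) ≤
      ((1 - q : ℝ≥0) : ℝ≥0∞) ^ Fintype.card V +
      (if Fintype.card V ≤ N then 0
        else ((Fintype.card V : ℝ≥0∞) * q) ^ (N + 1) * (2⁻¹ ^ s) ^ N) +
      ((s + 2 * N) * ε +
        N * (((Fintype.card V : ℝ≥0∞) * q) ^ 2 * (2⁻¹ + 2⁻¹ * (7 / 8) ^ 4) ^ l)) := by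
  unfold idsRisk
  rw [mean_add, mean_add, mean_add, mean_const, mean_const_mul, mean_prod_eq_none]
  gcongr
  · exact mean_prefixClashes_le hq hsl N
  · exact mean_pairsRisk_le hq l

end Mean

theorem one_sub_min_one_div_pow_le {n : ℕ} (hn : n ≠ 0) (a : ℕ) :
    (1 - min 1 ((a : ℝ≥0) / n)) ^ n ≤ 2⁻¹ ^ a := by
  rcases le_total (1 : ℝ≥0) ((a : ℝ≥0) / n) with h | h
  · rw [min_eq_left h, tsub_self, zero_pow hn]
    exact bot_le
  · have _ : (a : ℝ) / n ≤ 1 := by simpa using NNReal.coe_le_coe.2 h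
    rw [min_eq_right h, ← NNReal.coe_le_coe]
    push_cast [NNReal.coe_sub h]
    calc (1 - (a : ℝ) / n) ^ n ≤ (Real.exp (-((a : ℝ) / n))) ^ n :=
          pow_le_pow_left₀ (by linarith) (Real.one_sub_le_exp_neg _) n
      _ = (Real.exp (-1)) ^ a := by
          rw [← Real.exp_nat_mul, ← Real.exp_nat_mul]
          congr 1
          field_simp
      _ ≤ 2⁻¹ ^ a := by
          refine pow_le_pow_left₀ (Real.exp_pos _).le ?_ a
          rw [Real.exp_neg]
          exact inv_anti₀ (by norm_num) (by linarith [Real.add_one_le_exp (1 : ℝ)])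

theorem mul_min_one_div_le {n : ℕ} (hn : n ≠ 0) (a : ℕ) :
    (n : ℝ≥0) * min 1 ((a : ℝ≥0) / n) ≤ a :=
  calc (n : ℝ≥0) * min 1 ((a : ℝ≥0) / n) ≤ n * (a / n) := by gcongr; exact min_le_right _ _
    _ = a := mul_div_cancel₀ _ (Nat.cast_ne_zero.2 hn)

/-- A bound for the probability that more than `κ.rounds * sqrtLg n` candidates share their first
`sqrtLg n` ID bits. -/
noncomputable def crowdingRisk (κ : Constants) (n : ℕ) : ℝ≥0∞ :=
  if n ≤ κ.rounds * sqrtLg n then 0 else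
    ((κ.cand * lg n : ℕ) : ℝ≥0∞) ^ (κ.rounds * sqrtLg n + 1) *
      (2⁻¹ ^ sqrtLg n) ^ (κ.rounds * sqrtLg n)

/-- A bound for the probability that one of the Partial Multi-Broadcasts in Search and in the
iterations of Selection fails, if each of them fails with probability at most `ε`. -/
noncomputable def broadcastRisk (κ : Constants) (n : ℕ) (ε : ℝ≥0∞) : ℝ≥0∞ :=
  (sqrtLg n + 2 * (κ.rounds * sqrtLg n : ℕ)) * ε

/-- A bound for the probability that some iteration of Selection finds no witness although it
starts with more than one candidate. -/
noncomputable def oversightRisk (κ : Constants) (n : ℕ) : ℝ≥0∞ :=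
  (κ.rounds * sqrtLg n : ℕ) *
    (((κ.cand * lg n : ℕ) : ℝ≥0∞) ^ 2 * (2⁻¹ + 2⁻¹ * (7 / 8) ^ 4) ^ (κ.bits * lg n))

/-- A bound for the failure probability of the algorithm with a broadcast procedure whose error
probability is at most `ε`; the first summand accounts for an empty set of candidates. -/
noncomputable def electionRisk (κ : Constants) (n : ℕ) (ε : ℝ≥0∞) : ℝ≥0∞ :=
  2⁻¹ ^ (κ.cand * lg n) + crowdingRisk κ n + (broadcastRisk κ n ε + oversightRisk κ n)

theorem failure_leaderElection_le {G : Digraph V} {κ : Constants}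
    {B : MultiBroadcast} {n D : ℕ} {ε : ℝ≥0∞} (hB : Reliable B G n D (κ.bits * lg n) ε)
    (hbits : 1 ≤ κ.bits) (hrounds : 1 ≤ κ.rounds) (hn2 : 2 ≤ n)
    (hn : Fintype.card V = n) (hG : ∀ u v, ∃ k, ReachIn G k u v) :
    failure G (electionTime κ B n D) (fun _ => leaderElection κ B n D)
      (ElectionSucceeds (κ.rounds * sqrtLg n)) ≤ electionRisk κ n ε := by
  simp only [leaderElection_eq_bind]
  rw [← zero_add (electionTime κ B n D), failure,
    expect_bind G (fun _ => electFrom κ B n D) (fun _ => hasDuration_chooseId κ n),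
    expect_eq_mean_of_settle G (settle_chooseId κ n)]
  have hsl : sqrtLg n ≤ κ.bits * lg n :=
    (sqrtLg_le_lg n).trans (Nat.le_mul_of_pos_left _ hbits)
  refine (mean_mono_support fun id hid => failure_electFrom_le_idsRisk hB hbits hrounds hn2 hn hG
    fun v y hy =>
      length_of_mem_support_idLaw (hy ▸ apply_mem_support_of_mem_support_indep hid v)).trans ?_
  refine (mean_idsRisk_le (min_le_left _ _) hsl _ ε).trans ?_
  have hn0 : n ≠ 0 := by omega
  have hnone := one_sub_min_one_div_pow_le hn0 (κ.cand * lg n)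
  have hmany := mul_min_one_div_le hn0 (κ.cand * lg n)
  rw [hn, electionRisk, crowdingRisk, broadcastRisk, oversightRisk]
  rw [← ENNReal.coe_le_coe] at hnone hmany
  push_cast [ENNReal.coe_inv] at hnone hmany ⊢
  gcongr
  split_ifs
  · exact le_rfl
  · gcongr

end RandomIds

/-! ### Broadcasting along a schedule -/

/-- The state of a node in a broadcast: once it is informed, the number of time steps after which
this happened, and its string. -/
abbrev BcastState := Option (ℕ × Bits)

namespace BcastState

/-- The string of a node that was informed within the first `a` time steps. -/
def activeAt (a : ℕ) : BcastState → Option Bits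
  | some (τ, y) => if τ ≤ a then some y else none
  | none => none

/-- The state after the time step `t`, in which `r` arrives. -/
def update (t : ℕ) (r : Option Bits) : BcastState → BcastState
  | some p => some p
  | none => r.map fun y => (t + 1, y)

theorem activeAt_eq_some_iff {σ : BcastState} {a : ℕ} {y : Bits} :
    σ.activeAt a = some y ↔ ∃ τ ≤ a, σ = some (τ, y) := by
  cases σ <;> simp [activeAt, Prod.ext_iff, eq_comm]

theorem update_none_eq_some_iff {t : ℕ} {r : Option Bits} {p : ℕ × Bits} :
    update t r none = some p ↔ p.1 = t + 1 ∧ r = some p.2 := by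
  simp only [update, Option.map_eq_some_iff, Prod.ext_iff]
  aesop

end BcastState

theorem inv_two_pow_le_one (k : ℕ) : (2⁻¹ : ℝ≥0) ^ k ≤ 1 :=
  pow_le_one₀ (by simp) (by norm_num)

/-- The `k` time steps from time `t` on: in time step `t` the nodes that were informed within the
first `start t` steps transmit with probability `2 ^ (- level t)`. -/
noncomputable def bcastSteps (level start : ℕ → ℕ) : ℕ → ℕ → BcastState → Prog BcastState
  | 0, _, σ => Prog.done σ
  | k + 1, t, σ => Prog.coin (2⁻¹ ^ level t) (inv_two_pow_le_one _) fun b =>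
      Prog.step (if b then σ.activeAt (start t) else none) fun r =>
        bcastSteps level start k (t + 1) (σ.update t r)

theorem hasDuration_bcastSteps (level start : ℕ → ℕ) : ∀ (k t : ℕ) (σ : BcastState),
    (bcastSteps level start k t σ).HasDuration k
  | 0, _, _ => rfl
  | k + 1, t, _ => fun _ => ⟨k, rfl, fun _ => hasDuration_bcastSteps level start k (t + 1) _⟩

theorem bounded_bcastSteps (level start : ℕ → ℕ) (M : ℕ) : ∀ (k t : ℕ) (σ : BcastState),
    (∀ p ∈ σ, p.2.length ≤ M) →
      (bcastSteps level start k t σ).Bounded M fun σ => ∀ p ∈ σ, p.2.length ≤ M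
  | 0, _, _, h => h
  | k + 1, t, σ, h => fun b => by
    refine ⟨fun y hy => ?_, fun r hr => bounded_bcastSteps level start M k (t + 1) _ ?_⟩
    · obtain ⟨-, hy⟩ : b = true ∧ σ.activeAt (start t) = some y := by simpa using hy
      obtain ⟨τ, -, hσ⟩ := BcastState.activeAt_eq_some_iff.1 hy
      exact h (τ, y) hσ
    · intro p hp
      cases σ with
      | some q => exact h p hp
      | none => exact hr p.2 (BcastState.update_none_eq_some_iff.1 hp).2

section Run

variable {V : Type}

/-- Every node informed in the states `σ` was informed within the first `t` time steps. -/
def InformedBy (t : ℕ) (σ : V → BcastState) : Prop := ∀ v p, σ v = some p → p.1 ≤ t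

/-- The states `σ'` may be reached from the states `σ` between the times `t` and `t'`: informed
nodes keep their states, and the others can only take over the string of an informed node. -/
structure Extends (t t' : ℕ) (σ σ' : V → BcastState) : Prop where
  keep : ∀ v p, σ v = some p → σ' v = some p
  new : ∀ v τ y, σ v = none → σ' v = some (τ, y) →
    t < τ ∧ τ ≤ t' ∧ ∃ u τ', σ u = some (τ', y)

namespace Extends

variable {t t' t'' a : ℕ} {σ σ' σ'' : V → BcastState}

protected theorem refl (t : ℕ) (σ : V → BcastState) : Extends t t σ σ where
  keep _ _ h := h
  new v τ y h h' := by simp [h] at h'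

theorem exists_source (h : Extends t t' σ σ') {v : V} {τ : ℕ} {y : Bits}
    (hv : σ' v = some (τ, y)) : ∃ u τ', σ u = some (τ', y) := by
  cases hσ : σ v with
  | none => exact (h.new v τ y hσ hv).2.2
  | some p => exact ⟨v, τ, hσ.trans ((h.keep v p hσ).symm.trans hv)⟩

theorem ne_none (h : Extends t t' σ σ') {v : V} (hv : σ v ≠ none) : σ' v ≠ none := by
  obtain ⟨p, hp⟩ := Option.ne_none_iff_exists'.1 hv
  simp [h.keep v p hp]

theorem trans (h : Extends t t' σ σ') (h' : Extends t' t'' σ' σ'') (htt : t ≤ t')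
    (htt' : t' ≤ t'') : Extends t t'' σ σ'' where
  keep v p hp := h'.keep v p (h.keep v p hp)
  new v τ y hn hs := by
    cases hσ : σ' v with
    | some p =>
      obtain rfl : p = (τ, y) := Option.some_injective _ ((h'.keep v p hσ).symm.trans hs)
      obtain ⟨h₁, h₂, h₃⟩ := h.new v τ y hn hσ
      exact ⟨h₁, h₂.trans htt', h₃⟩
    | none =>
      obtain ⟨h₁, h₂, u, τ', hu⟩ := h'.new v τ y hσ hs
      exact ⟨htt.trans_lt h₁, h₂, h.exists_source hu⟩

theorem informedBy (h : Extends t t' σ σ') (hσ : InformedBy t σ) (htt : t ≤ t') :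
    InformedBy t' σ' := by
  intro v p hp
  cases hv : σ v with
  | some q =>
    obtain rfl : q = p := Option.some_injective _ ((h.keep v q hv).symm.trans hp)
    exact (hσ v q hv).trans htt
  | none => exact (h.new v p.1 p.2 hv hp).2.1

theorem activeAt_ne_none_iff (h : Extends a t σ σ') (hσ : InformedBy a σ) (v : V) :
    (σ' v).activeAt a ≠ none ↔ σ v ≠ none := by
  constructor
  · intro hact hv
    obtain ⟨y, hy⟩ := Option.ne_none_iff_exists'.1 hact
    obtain ⟨τ, hτ, hσ'⟩ := BcastState.activeAt_eq_some_iff.1 hy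
    exact (h.new v τ y hv hσ').1.not_ge hτ
  · intro hv
    obtain ⟨p, hp⟩ := Option.ne_none_iff_exists'.1 hv
    simp [BcastState.activeAt_eq_some_iff.2 ⟨p.1, hσ v p hp, h.keep v p hp⟩]

end Extends

variable (G : Digraph V) (level start : ℕ → ℕ)

/-- The states after the time step `t` in which the nodes have coins `b`. -/
noncomputable def bcastNext (t : ℕ) (σ : V → BcastState) (b : V → Bool) (v : V) : BcastState :=
  (σ v).update t (received G (fun u => if b u then (σ u).activeAt (start t) else none) v)

theorem extends_bcastNext (t : ℕ) (σ : V → BcastState) (b : V → Bool) :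
    Extends t (t + 1) σ (bcastNext G start t σ b) where
  keep v p h := by simp [bcastNext, h, BcastState.update]
  new v τ y h h' := by
    rw [bcastNext, h, BcastState.update_none_eq_some_iff] at h'
    obtain ⟨hτ, hrec⟩ := h'
    obtain ⟨u, -, hu⟩ := exists_adj_of_received_eq_some G hrec
    obtain ⟨-, hu⟩ : b u = true ∧ (σ u).activeAt (start t) = some y := by simpa using hu
    obtain ⟨τ', -, hσ⟩ := BcastState.activeAt_eq_some_iff.1 hu
    exact ⟨by omega, by omega, u, τ', hσ⟩

variable [Fintype V]

/-- The law of the states after the `k` time steps from time `t` on. -/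
noncomputable def bcastRun : ℕ → ℕ → (V → BcastState) → PMF (V → BcastState)
  | 0, _, σ => PMF.pure σ
  | k + 1, t, σ => (indep fun _ : V => coinPMF (2⁻¹ ^ level t) (inv_two_pow_le_one _)).bind
      fun b => bcastRun k (t + 1) (bcastNext G start t σ b)

theorem expect_bcastSteps (φ : (V → BcastState) → ℝ≥0∞) : ∀ (k t : ℕ) (σ : V → BcastState),
    expect G k (fun v => bcastSteps level start k t (σ v)) φ =
      mean (bcastRun G level start k t σ) φ
  | 0, t, σ => by
    simp only [bcastSteps, bcastRun]
    rw [expect_done, mean_pure]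
  | k + 1, t, σ => by
    simp only [bcastSteps, bcastRun]
    rw [expect_coin, mean_bind]
    congr 1
    funext b
    rw [expect_step]
    exact expect_bcastSteps φ k (t + 1) _

theorem bcastRun_add (k' : ℕ) : ∀ (k t : ℕ) (σ : V → BcastState),
    bcastRun G level start (k + k') t σ =
      (bcastRun G level start k t σ).bind fun σ' => bcastRun G level start k' (t + k) σ'
  | 0, t, σ => by simp [bcastRun]
  | k + 1, t, σ => by
    rw [show k + 1 + k' = (k + k') + 1 by omega]
    simp only [bcastRun, PMF.bind_bind, bcastRun_add k' k (t + 1)]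
    rw [show t + 1 + k = t + (k + 1) by omega]

theorem extends_of_mem_support_bcastRun : ∀ {k t : ℕ} {σ σ' : V → BcastState},
    σ' ∈ (bcastRun G level start k t σ).support → Extends t (t + k) σ σ'
  | 0, t, σ, σ', h => by
    obtain rfl : σ' = σ := by simpa [bcastRun] using h
    exact Extends.refl t σ'
  | k + 1, t, σ, σ', h => by
    obtain ⟨b, -, hb⟩ := (PMF.mem_support_bind_iff _ _ _).1 h
    rw [show t + (k + 1) = t + 1 + k by omega]
    exact (extends_bcastNext G start t σ b).trans (extends_of_mem_support_bcastRun hb)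
      (by omega) (by omega)

theorem mean_bcastRun_add_le {k k' t : ℕ} {σ : V → BcastState} {φ : (V → BcastState) → ℝ≥0∞}
    {c : ℝ≥0∞}
    (h : ∀ σ', Extends t (t + k) σ σ' → mean (bcastRun G level start k' (t + k) σ') φ ≤ c) :
    mean (bcastRun G level start (k + k') t σ) φ ≤ c := by
  rw [bcastRun_add, mean_bind]
  exact (mean_mono_support fun σ' hσ' =>
    h σ' (extends_of_mem_support_bcastRun G level start hσ')).trans (mean_const _ _).le

end Run

/-! ### Progress along a walk -/

/-- A walk `π 1, …, π L` towards `target`, in which every node is ranked by the last node of the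
walk to which it has an edge. A transmission that reaches `π i` from a node of rank `i` thus informs
a node of higher rank. -/
structure RankedWalk {V : Type} (G : Digraph V) (target : V) (L : ℕ) where
  π : ℕ → V
  rank : V → ℕ
  lt_rank : ∀ i, 1 ≤ i → i ≤ L → i < rank (π i)
  adj_of_rank_eq : ∀ u i, 1 ≤ i → i ≤ L → rank u = i → G.Adj u (π i)
  le_rank_of_adj : ∀ u i, 1 ≤ i → i ≤ L → G.Adj u (π i) → i ≤ rank u
  eq_target : ∀ u, L < rank u → u = target

theorem exists_walk {V : Type} (G : Digraph V) {s : V} : ∀ {k : ℕ} {v : V}, ReachIn G k s v →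
    ∃ π : ℕ → V, π 0 = s ∧ π k = v ∧ ∀ i < k, G.Adj (π i) (π (i + 1))
  | 0, v, h => ⟨fun _ => s, rfl, h, fun i hi => by omega⟩
  | k + 1, v, ⟨w, hw, hwv⟩ => by
    obtain ⟨π, h0, hk, hadj⟩ := exists_walk G hw
    refine ⟨fun i => if i ≤ k then π i else v, by simp [h0], by simp, fun i hi => ?_⟩
    rcases Nat.lt_or_ge i k with h | h
    · simp only [if_pos h.le, if_pos (Nat.succ_le_of_lt h)]
      exact hadj i h
    · obtain rfl : i = k := by omega
      simpa [hk] using hwv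

section WalkRank

variable {V : Type} (G : Digraph V) (π : ℕ → V) (k : ℕ) (v : V)

open Classical in
/-- The last `i ≤ k` such that there is an edge from `u` to `π i`, where the end `v` of the walk is
ranked above all other nodes. It is `0` if there is no such edge. -/
noncomputable def walkRank (u : V) : ℕ :=
  if u = v then k + 1 else ((Finset.Icc 1 k).filter fun i => G.Adj u (π i)).sup id

variable {G π k v} {u : V} {i : ℕ}

theorem walkRank_self : walkRank G π k v v = k + 1 := if_pos rfl

theorem walkRank_le (hu : u ≠ v) : walkRank G π k v u ≤ k := by
  classical
  rw [walkRank, if_neg hu]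
  exact Finset.sup_le fun i hi => (Finset.mem_Icc.1 (Finset.mem_filter.1 hi).1).2

theorem le_walkRank_of_adj (h1 : 1 ≤ i) (hk : i ≤ k) (h : G.Adj u (π i)) :
    i ≤ walkRank G π k v u := by
  classical
  unfold walkRank
  split_ifs
  · omega
  · exact Finset.le_sup (f := id) (Finset.mem_filter.2 ⟨Finset.mem_Icc.2 ⟨h1, hk⟩, h⟩)

theorem adj_of_walkRank_eq (h1 : 1 ≤ i) (hk : i ≤ k) (h : walkRank G π k v u = i) :
    G.Adj u (π i) := by
  classical
  unfold walkRank at h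
  split_ifs at h
  · omega
  · have hne : ((Finset.Icc 1 k).filter fun i => G.Adj u (π i)).Nonempty :=
      Finset.nonempty_of_ne_empty fun he => by
        rw [he, Finset.sup_empty] at h
        simp only [bot_eq_zero'] at h; omega
    obtain ⟨j, hj, hsup⟩ := Finset.exists_mem_eq_sup _ hne id
    obtain rfl : j = i := hsup.symm.trans h
    exact (Finset.mem_filter.1 hj).2

theorem lt_walkRank (hk : π k = v) (hadj : ∀ i < k, G.Adj (π i) (π (i + 1))) (hi : i ≤ k) :
    i < walkRank G π k v (π i) := by
  rcases hi.lt_or_eq with hi | rfl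
  · exact le_walkRank_of_adj (by omega) hi (hadj i hi)
  · simp [hk, walkRank_self]

end WalkRank

theorem exists_rankedWalk {V : Type} (G : Digraph V) {s v : V} {k : ℕ} (h : ReachIn G k s v) :
    ∃ R : RankedWalk G v k, 1 ≤ R.rank s := by
  obtain ⟨π, rfl, hk, hadj⟩ := exists_walk G h
  exact ⟨{ π := π
           rank := walkRank G π k v
           lt_rank := fun _ _ hi => lt_walkRank hk hadj hi
           adj_of_rank_eq := fun _ _ => adj_of_walkRank_eq
           le_rank_of_adj := fun _ _ => le_walkRank_of_adj
           eq_target := fun u hu => not_imp_comm.1 walkRank_le hu.not_ge },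
    lt_walkRank hk hadj k.zero_le⟩

/-- Every stretch of `w` time steps contains a time `a` and, after it, for each `j ≤ r` a time step
of level `j` for those informed by time `a`. -/
def Schedules (level start : ℕ → ℕ) (r w : ℕ) : Prop :=
  ∀ a₀, ∃ a ≥ a₀, ∀ j ≤ r, ∃ t, a ≤ t ∧ t < a₀ + w ∧ level t = j ∧ start t = a

theorem Schedules.pos {level start : ℕ → ℕ} {r w : ℕ} (h : Schedules level start r w) : 0 < w := by
  obtain ⟨a, _, hsch⟩ := h 0
  obtain ⟨t, _, htw, -⟩ := hsch 0 r.zero_le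
  omega

section Progress

variable {V : Type} {G : Digraph V} {target : V} {L : ℕ}

/-- Some informed node has rank at least `i`. -/
def RankedWalk.Reached (R : RankedWalk G target L) (i : ℕ) (σ : V → BcastState) : Prop :=
  ∃ u, σ u ≠ none ∧ i ≤ R.rank u

theorem RankedWalk.Reached.extends {R : RankedWalk G target L} {i t t' : ℕ}
    {σ σ' : V → BcastState} (h : R.Reached i σ) (h' : Extends t t' σ σ') : R.Reached i σ' := by
  obtain ⟨u, hu, hi⟩ := h
  exact ⟨u, h'.ne_none hu, hi⟩

theorem RankedWalk.rank_le_of_not_reached {R : RankedWalk G target L} {i : ℕ}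
    {σ : V → BcastState} (h : ¬ R.Reached (i + 1) σ) {u : V} (hu : σ u ≠ none) : R.rank u ≤ i := by
  by_contra hc
  exact h ⟨u, hu, by omega⟩

section Law

variable (G) [Fintype V] (level start : ℕ → ℕ)

open Classical in
/-- The probability that `target` is not informed at the end of the `k` time steps from `t` on. -/
noncomputable def uninformedProb (target : V) (k t : ℕ) (σ : V → BcastState) : ℝ≥0∞ :=
  mean (bcastRun G level start k t σ) fun σ' => if σ' target = none then 1 else 0

theorem uninformedProb_le_one (target : V) (k t : ℕ) (σ : V → BcastState) :
    uninformedProb G level start target k t σ ≤ 1 :=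
  mean_le_of_le fun _ => by split_ifs <;> simp

end Law

namespace RankedWalk

variable [Fintype V] (R : RankedWalk G target L) (level start : ℕ → ℕ) {i k t : ℕ}
  {σ : V → BcastState}

/-- The nodes of rank `i`. -/
def layer (i : ℕ) : Finset V := {u | R.rank u = i}

open Classical in
/-- The nodes of rank `i` that are informed in the states `σ`. -/
noncomputable def informedLayer (i : ℕ) (σ : V → BcastState) : Finset V :=
  {u | R.rank u = i ∧ σ u ≠ none}

theorem mem_informedLayer {u : V} : u ∈ R.informedLayer i σ ↔ R.rank u = i ∧ σ u ≠ none := by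
  simp [informedLayer]

theorem informedLayer_subset (i : ℕ) (σ : V → BcastState) : R.informedLayer i σ ⊆ R.layer i := by
  intro u hu
  simpa [layer] using (R.mem_informedLayer.1 hu).1

open Classical in
/-- The probability that no node of rank at least `i` is informed at the end of the `k` time steps
from `t` on. -/
noncomputable def unreachedProb (i k t : ℕ) (σ : V → BcastState) : ℝ≥0∞ :=
  mean (bcastRun G level start k t σ) fun σ' => if R.Reached i σ' then 0 else 1

theorem unreachedProb_eq_zero (h : R.Reached i σ) : R.unreachedProb level start i k t σ = 0 := by
  refine le_antisymm ((mean_mono_support fun σ' hσ' => ?_).trans (mean_const _ 0).le) bot_le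
  rw [if_pos (h.extends (extends_of_mem_support_bcastRun G level start hσ'))]

theorem unreachedProb_add_le (k k' : ℕ) :
    R.unreachedProb level start i (k + k') t σ ≤ R.unreachedProb level start i k t σ := by
  unfold unreachedProb
  rw [bcastRun_add, mean_bind]
  refine mean_mono fun σ' => ?_
  split_ifs with h
  · exact (R.unreachedProb_eq_zero level start h).le
  · exact mean_le_of_le fun _ => by split_ifs <;> simp

variable {level start}

theorem adj_and_activeAt_ne_none_iff {a : ℕ} (hi1 : 1 ≤ i) (hiL : i ≤ L) {σa : V → BcastState}
    (hext : Extends a t σa σ) (hinf : InformedBy a σa) (hnot : ¬ R.Reached (i + 1) σ) (u : V) :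
    G.Adj u (R.π i) ∧ (σ u).activeAt a ≠ none ↔ u ∈ R.informedLayer i σa := by
  rw [hext.activeAt_ne_none_iff hinf, mem_informedLayer]
  refine and_congr_left fun hu => ⟨fun hadj => ?_, R.adj_of_rank_eq u i hi1 hiL⟩
  exact (rank_le_of_not_reached hnot (hext.ne_none hu)).antisymm
    (R.le_rank_of_adj u i hi1 hiL hadj)

theorem reached_bcastNext {a : ℕ} (hi1 : 1 ≤ i) (hiL : i ≤ L) {σa : V → BcastState}
    (hext : Extends a t σa σ) (hinf : InformedBy a σa) (hnot : ¬ R.Reached (i + 1) σ)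
    (hstart : start t = a) {b : V → Bool} (hb : ∃! u, u ∈ R.informedLayer i σa ∧ b u = true) :
    R.Reached (i + 1) (bcastNext G start t σ b) := by
  have hnone : σ (R.π i) = none := by
    by_contra hc
    exact (R.lt_rank i hi1 hiL).not_ge (rank_le_of_not_reached hnot hc)
  have hrec : received G (fun u => if b u then (σ u).activeAt (start t) else none) (R.π i) ≠
      none := by
    refine received_ne_none_of_existsUnique G (by simp [hnone, BcastState.activeAt]) ?_
    simpa only [hstart, R.adj_and_activeAt_ne_none_iff hi1 hiL hext hinf hnot] using hb
  refine ⟨R.π i, ?_, R.lt_rank i hi1 hiL⟩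
  simpa [bcastNext, hnone, BcastState.update] using hrec

theorem unreachedProb_one_le {a : ℕ} (hi1 : 1 ≤ i) (hiL : i ≤ L) {σa : V → BcastState}
    (hext : Extends a t σa σ) (hinf : InformedBy a σa) (hnot : ¬ R.Reached (i + 1) σ)
    (hreach : R.Reached i σa) (hstart : start t = a)
    (hlevel : level t = Nat.clog 2 (R.informedLayer i σa).card) :
    R.unreachedProb level start (i + 1) 1 t σ ≤ 7 / 8 := by
  have hpos : 0 < (R.informedLayer i σa).card := by
    obtain ⟨u, hu, hui⟩ := hreach
    have hrank := rank_le_of_not_reached hnot (hext.ne_none hu)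
    exact Finset.card_pos.2 ⟨u, R.mem_informedLayer.2 ⟨hrank.antisymm hui, hu⟩⟩
  obtain ⟨h1, h2⟩ := card_mul_inv_two_pow_clog hpos
  rw [← hlevel] at h1 h2
  simp only [unreachedProb, bcastRun, mean_bind, mean_pure]
  refine le_trans (mean_mono fun b => ?_)
    (mean_not_existsUnique_le (inv_two_pow_le_one (level t)) h1 h2)
  split_ifs with hr hb
  · exact le_rfl
  · exact zero_le_one
  · exact absurd (R.reached_bcastNext hi1 hiL hext hinf hnot hstart ‹_›) hr
  · exact le_rfl

theorem unreachedProb_window_le {r w : ℕ} (hi1 : 1 ≤ i) (hiL : i ≤ L)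
    (hr : Nat.clog 2 (R.layer i).card ≤ r) (hw : Schedules level start r w)
    (hinf : InformedBy t σ) (hreach : R.Reached i σ) :
    R.unreachedProb level start (i + 1) w t σ ≤ 7 / 8 := by
  obtain ⟨a, hat, hsch⟩ := hw t
  obtain ⟨t₀, ha₀, hw₀, -⟩ := hsch 0 r.zero_le
  rw [show w = (a - t) + (t + w - a) by omega]
  refine mean_bcastRun_add_le G level start fun σa hσa => ?_
  rw [show t + (a - t) = a by omega] at hσa ⊢
  obtain ⟨t', hat', htw, hlevel, hstart⟩ := hsch (Nat.clog 2 (R.informedLayer i σa).card)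
    ((Nat.clog_mono_right 2 (Finset.card_le_card (R.informedLayer_subset i σa))).trans hr)
  rw [show t + w - a = (t' - a) + (1 + (t + w - t' - 1)) by omega]
  refine mean_bcastRun_add_le G level start fun σ' hσ' => ?_
  rw [show a + (t' - a) = t' by omega] at hσ' ⊢
  by_cases hr' : R.Reached (i + 1) σ'
  · exact (R.unreachedProb_eq_zero level start hr').trans_le bot_le
  · exact (R.unreachedProb_add_le level start _ _).trans
      (R.unreachedProb_one_le hi1 hiL hσ' (hσa.informedBy hinf hat) hr' (hreach.extends hσa)
        hstart hlevel)

theorem uninformedProb_eq_zero (h : R.Reached (L + 1) σ) :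
    uninformedProb G level start target k t σ = 0 := by
  refine le_antisymm ((mean_mono_support fun σ' hσ' => ?_).trans (mean_const _ 0).le) bot_le
  obtain ⟨u, hu, hLu⟩ := h.extends (extends_of_mem_support_bcastRun G level start hσ')
  rw [if_neg (R.eq_target u (by omega) ▸ hu)]

end RankedWalk

-- The left-hand side is monotone in `p₀`, since `y ≤ 1`.
theorem add_mul_le_of_le {p₀ p₁ y z : ℝ≥0∞} (h : p₀ + p₁ = 1) (h₀ : p₀ ≤ 7 / 8) (hy : y ≤ 1)
    (hz : 7 / 8 + 1 / 8 * y ≤ z) : p₀ + p₁ * y ≤ z := by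
  have hsum : (7 / 8 : ℝ≥0∞) + 1 / 8 = 1 := by
    rw [ENNReal.div_add_div_same]
    norm_num
    exact ENNReal.div_self (by norm_num) (by norm_num)
  have hp₀ : p₀ ≠ ∞ := ne_top_of_le_ne_top (by finiteness) h₀
  obtain ⟨d, hd⟩ := exists_add_of_le h₀
  have hp₁ : p₁ = d + 1 / 8 := by
    refine (ENNReal.add_right_inj hp₀).1 ((h.trans hsum.symm).trans ?_)
    rw [hd, add_assoc]
  calc p₀ + p₁ * y = p₀ + d * y + 1 / 8 * y := by rw [hp₁]; ring
    _ ≤ p₀ + d * 1 + 1 / 8 * y := by gcongr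
    _ = 7 / 8 + 1 / 8 * y := by rw [hd, mul_one]
    _ ≤ z := hz

namespace RankedWalk

variable [Fintype V] (R : RankedWalk G target L) {level start : ℕ → ℕ} {i t : ℕ}
  {σ : V → BcastState}

open Classical in
theorem unreachedProb_add_mul_le {w : ℕ} {x : ℝ≥0∞} (hx : x ≤ 1) (hi1 : 1 ≤ i) (hiL : i ≤ L)
    (hw : Schedules level start (Nat.clog 2 (R.layer i).card) w)
    (hxw : 7 / 8 + 1 / 8 * x ^ (16 * w) ≤ x ^ w) (hinf : InformedBy t σ) (hreach : R.Reached i σ) :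
    mean (bcastRun G level start w t σ)
      (fun σ' => if R.Reached (i + 1) σ' then x ^ (16 * w) else 1) ≤ x ^ w := by
  set p := bcastRun G level start w t σ
  have hsum : R.unreachedProb level start (i + 1) w t σ +
      mean p (fun σ' => if R.Reached (i + 1) σ' then 1 else 0) = 1 := by
    rw [unreachedProb, ← mean_add]
    refine Eq.trans (congrArg (mean p) (funext fun σ' => ?_)) (mean_const p 1)
    split_ifs <;> simp
  calc mean p (fun σ' => if R.Reached (i + 1) σ' then x ^ (16 * w) else 1)
      = R.unreachedProb level start (i + 1) w t σ +
          mean p (fun σ' => if R.Reached (i + 1) σ' then 1 else 0) * x ^ (16 * w) := by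
        rw [unreachedProb, mul_comm (mean p _), ← mean_const_mul, ← mean_add]
        congr 1
        funext σ'
        split_ifs <;> simp
    _ ≤ x ^ w := add_mul_le_of_le hsum (R.unreachedProb_window_le hi1 hiL le_rfl hw hinf hreach)
        (pow_le_one₀ bot_le hx) hxw

-- The potential `x ^ (-16 * S)`, where `S` is the total length of the remaining windows, shrinks by
-- the factor `x ^ w` in the mean.
theorem uninformedProb_add_mul_le {k w S : ℕ} {x : ℝ≥0∞} (hx : x ≤ 1) (hi1 : 1 ≤ i) (hiL : i ≤ L)
    (hw : Schedules level start (Nat.clog 2 (R.layer i).card) w)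
    (hxw : 7 / 8 + 1 / 8 * x ^ (16 * w) ≤ x ^ w) (hinf : InformedBy t σ) (hreach : R.Reached i σ)
    (hnext : ∀ σ', InformedBy (t + w) σ' → R.Reached (i + 1) σ' →
      uninformedProb G level start target k (t + w) σ' * x ^ (16 * S) ≤ x ^ k)
    (hstay : ∀ σ', InformedBy (t + w) σ' → R.Reached i σ' →
      uninformedProb G level start target k (t + w) σ' * x ^ (16 * (w + S)) ≤ x ^ k) :
    uninformedProb G level start target (w + k) t σ * x ^ (16 * (w + S)) ≤ x ^ (w + k) := by
  classical
  have hwindow : ∀ σ' ∈ (bcastRun G level start w t σ).support,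
      x ^ (16 * (w + S)) * uninformedProb G level start target k (t + w) σ' ≤
        x ^ k * if R.Reached (i + 1) σ' then x ^ (16 * w) else 1 := by
    intro σ' hσ'
    have hext := extends_of_mem_support_bcastRun G level start hσ'
    have hinf' := hext.informedBy hinf (by omega)
    split_ifs with hr
    · have hle := hnext σ' hinf' hr
      calc _ = uninformedProb G level start target k (t + w) σ' * x ^ (16 * S) *
            x ^ (16 * w) := by ring
        _ ≤ _ := by gcongr
    · rw [mul_one, mul_comm]
      exact hstay σ' hinf' (hreach.extends hext)
  calc uninformedProb G level start target (w + k) t σ * x ^ (16 * (w + S))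
      = mean (bcastRun G level start w t σ) fun σ' =>
          x ^ (16 * (w + S)) * uninformedProb G level start target k (t + w) σ' := by
        rw [uninformedProb, bcastRun_add, mean_bind, mul_comm, mean_const_mul]
        rfl
    _ ≤ x ^ k * mean (bcastRun G level start w t σ)
          fun σ' => if R.Reached (i + 1) σ' then x ^ (16 * w) else 1 :=
        (mean_mono_support hwindow).trans_eq (mean_const_mul _ _ _)
    _ ≤ x ^ k * x ^ w := by
        gcongr
        exact R.unreachedProb_add_mul_le hx hi1 hiL hw hxw hinf hreach
    _ = x ^ (w + k) := by rw [← pow_add, add_comm]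

theorem uninformedProb_mul_le {w : ℕ → ℕ} {x : ℝ≥0∞} (hx : x ≤ 1)
    (hw : ∀ i, 1 ≤ i → i ≤ L → Schedules level start (Nat.clog 2 (R.layer i).card) (w i))
    (hxw : ∀ i, 1 ≤ i → i ≤ L → 7 / 8 + 1 / 8 * x ^ (16 * w i) ≤ x ^ w i) (k : ℕ) :
    ∀ (i t : ℕ) (σ : V → BcastState), 1 ≤ i → i ≤ L + 1 → InformedBy t σ → R.Reached i σ →
      uninformedProb G level start target k t σ *
        x ^ (16 * ∑ j ∈ Finset.Ico i (L + 1), w j) ≤ x ^ k := by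
  induction k using Nat.strong_induction_on with
  | _ k ih =>
  intro i t σ hi1 hiL hinf hreach
  rcases hiL.eq_or_lt with rfl | hi
  · rw [R.uninformedProb_eq_zero hreach, zero_mul]
    exact bot_le
  have hi : i ≤ L := by omega
  have hsum : ∑ j ∈ Finset.Ico i (L + 1), w j = w i + ∑ j ∈ Finset.Ico (i + 1) (L + 1), w j :=
    Finset.sum_eq_sum_Ico_succ_bot (by omega) w
  rcases Nat.lt_or_ge k (w i) with hk | hk
  · calc _ ≤ 1 * x ^ (16 * ∑ j ∈ Finset.Ico i (L + 1), w j) := by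
          gcongr; exact uninformedProb_le_one ..
      _ ≤ x ^ k := by
        rw [one_mul, hsum]
        exact pow_le_pow_of_le_one bot_le hx (by omega)
  have hwpos := (hw i hi1 hi).pos
  obtain ⟨k', rfl⟩ := Nat.exists_eq_add_of_le hk
  rw [hsum]
  refine R.uninformedProb_add_mul_le hx hi1 hi (hw i hi1 hi) (hxw i hi1 hi) hinf hreach
    (fun σ' => ih k' (by omega) (i + 1) (t + w i) σ' (by omega) (by omega)) fun σ' => ?_
  rw [← hsum]
  exact ih k' (by omega) i (t + w i) σ' hi1 (by omega)

end RankedWalk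

end Progress

/-! ### The schedule -/

/-- The level of time step `t`: the even steps repeat the levels `0, …, Λ - 1`; the odd steps have
the levels `e p, …, e p + p - 1` at a fraction `2 ^ (-e-1)` of the time. -/
def mixedLevel (Λ p t : ℕ) : ℕ :=
  if t % 2 = 0 then t / 2 % Λ
  else padicValNat 2 (t / 2 + 1) * p + (t / 2 + 1) / 2 ^ (padicValNat 2 (t / 2 + 1) + 1) % p

/-- The time by which a node has to be informed in order to take part in time step `t`. -/
def mixedStart (Λ p t : ℕ) : ℕ :=
  if t % 2 = 0 then 2 * (Λ * (t / 2 / Λ))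
  else 2 * (p * 2 ^ (padicValNat 2 (t / 2 + 1) + 1) *
    (t / 2 / (p * 2 ^ (padicValNat 2 (t / 2 + 1) + 1))))

theorem exists_multiple {P : ℕ} (hP : 0 < P) (a : ℕ) : ∃ M, a ≤ P * M ∧ P * M ≤ a + P := by
  have hlt := Nat.lt_mul_div_succ a hP
  have hle := Nat.mul_div_le a P
  exact ⟨a / P + 1, by omega, by rw [mul_add, mul_one]; omega⟩

theorem mixed_even {Λ j : ℕ} (hj : j < Λ) (p M : ℕ) :
    mixedLevel Λ p (2 * (Λ * M + j)) = j ∧ mixedStart Λ p (2 * (Λ * M + j)) = 2 * (Λ * M) := by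
  have heven : 2 * (Λ * M + j) % 2 = 0 := by omega
  have hhalf : 2 * (Λ * M + j) / 2 = Λ * M + j := by omega
  rw [mixedLevel, mixedStart, if_pos heven, if_pos heven, hhalf, Nat.mul_add_mod,
    Nat.mod_eq_of_lt hj, Nat.mul_add_div (by omega), Nat.div_eq_of_lt hj, add_zero]
  exact ⟨rfl, rfl⟩

theorem schedules_even {Λ r : ℕ} (hr : r < Λ) (p : ℕ) :
    Schedules (mixedLevel Λ p) (mixedStart Λ p) r (4 * Λ) := by
  intro a₀
  obtain ⟨M, h1, h2⟩ := exists_multiple (P := 2 * Λ) (by omega) a₀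
  rw [mul_assoc] at h1 h2
  refine ⟨2 * (Λ * M), h1, fun j hj => ?_⟩
  obtain ⟨hlevel, hstart⟩ := mixed_even (hj.trans_lt hr) p M
  exact ⟨2 * (Λ * M + j), by omega, by omega, hlevel, hstart⟩

theorem padicValNat_two_pow_mul_odd (e x : ℕ) : padicValNat 2 (2 ^ e * (2 * x + 1)) = e := by
  rw [padicValNat.mul (by positivity) (by omega), padicValNat.prime_pow,
    padicValNat.eq_zero_of_not_dvd (by omega), add_zero]

-- In block `N` of length `p * 2 ^ (e + 1)`, level `e * p + s` is used by the `s`-th number whose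
-- 2-adic valuation is `e`.
theorem exists_mixed_odd (Λ : ℕ) {p s : ℕ} (hs : s < p) (e N : ℕ) :
    ∃ u, p * 2 ^ (e + 1) * N ≤ u ∧ u < p * 2 ^ (e + 1) * (N + 1) ∧
      mixedLevel Λ p (2 * u + 1) = e * p + s ∧
      mixedStart Λ p (2 * u + 1) = 2 * (p * 2 ^ (e + 1) * N) := by
  set Q := p * 2 ^ (e + 1) with hQ
  have hpos : 0 < 2 ^ e := Nat.two_pow_pos e
  have hlt : 2 ^ e * (2 * s + 1) < Q := by
    calc 2 ^ e * (2 * s + 1) < 2 ^ e * (2 * p) := Nat.mul_lt_mul_of_pos_left (by omega) hpos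
      _ = Q := by rw [hQ, pow_succ]; ring
  have hsplit : 2 ^ e * (2 * (p * N + s) + 1) = Q * N + 2 ^ e * (2 * s + 1) := by
    rw [hQ, pow_succ]; ring
  have hge : 0 < 2 ^ e * (2 * s + 1) := by positivity
  obtain ⟨u, hu⟩ : ∃ u, u + 1 = 2 ^ e * (2 * (p * N + s) + 1) :=
    ⟨_, Nat.succ_pred_eq_of_pos (by positivity)⟩
  have hlower : Q * N ≤ u := by omega
  have hupper : u < Q * (N + 1) := by rw [mul_add, mul_one]; omega
  have hval : padicValNat 2 (u + 1) = e := by rw [hu, padicValNat_two_pow_mul_odd]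
  have hindex : (u + 1) / 2 ^ (e + 1) = p * N + s := by
    rw [hu, pow_succ, Nat.mul_div_mul_left _ _ hpos]; omega
  have hblock : u / Q = N := Nat.div_eq_of_lt_le (by rwa [mul_comm]) (by rwa [mul_comm])
  have hodd : (2 * u + 1) % 2 ≠ 0 := by omega
  have hhalf : (2 * u + 1) / 2 = u := by omega
  refine ⟨u, hlower, hupper, ?_, ?_⟩
  · rw [mixedLevel, if_neg hodd, hhalf, hval, hindex, Nat.mul_add_mod, Nat.mod_eq_of_lt hs]
  · rw [mixedStart, if_neg hodd, hhalf, hval, hblock]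

theorem schedules_odd (Λ : ℕ) {p : ℕ} (hp : 1 ≤ p) (r : ℕ) :
    Schedules (mixedLevel Λ p) (mixedStart Λ p) r (4 * (p * 2 ^ (r / p + 1))) := by
  intro a₀
  set P := p * 2 ^ (r / p + 1)
  obtain ⟨M, h1, h2⟩ := exists_multiple (P := 2 * P) (by positivity) a₀
  rw [mul_assoc] at h1 h2
  refine ⟨2 * (P * M), h1, fun j hj => ?_⟩
  have hle : j / p ≤ r / p := Nat.div_le_div_right hj
  have hblocks : p * 2 ^ (j / p + 1) * (2 ^ (r / p - j / p) * M) = P * M := by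
    rw [← mul_assoc, mul_assoc p, ← pow_add,
      show j / p + 1 + (r / p - j / p) = r / p + 1 by omega]
  have hshort : p * 2 ^ (j / p + 1) ≤ P :=
    Nat.mul_le_mul_left p (Nat.pow_le_pow_right (by norm_num) (by omega))
  obtain ⟨u, hlower, hupper, hlevel, hstart⟩ :=
    exists_mixed_odd Λ (Nat.mod_lt j hp) (j / p) (2 ^ (r / p - j / p) * M)
  rw [mul_add, mul_one, hblocks] at hupper
  rw [hblocks] at hlower hstart
  exact ⟨2 * u + 1, by omega, by omega, hlevel.trans (Nat.div_add_mod' j p), hstart⟩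

/-- A stretch of time in which a layer of `m` nodes is likely to be passed. -/
def layerTime (Λ p m : ℕ) : ℕ := min (4 * Λ) (4 * (p * 2 ^ (Nat.clog 2 m / p + 1)))

theorem schedules_layerTime {Λ p m : ℕ} (hp : 1 ≤ p) (hm : Nat.clog 2 m < Λ) :
    Schedules (mixedLevel Λ p) (mixedStart Λ p) (Nat.clog 2 m) (layerTime Λ p m) := by
  rcases min_choice (4 * Λ) (4 * (p * 2 ^ (Nat.clog 2 m / p + 1))) with h | h
  · rw [layerTime, h]; exact schedules_even hm p
  · rw [layerTime, h]; exact schedules_odd Λ hp _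

theorem div_add_le_succ {p r : ℕ} (hp : 1 ≤ p) (h : p ≤ r) : r / p + p ≤ r + 1 := by
  have hdiv := Nat.div_mul_le_self r p
  have hone : 1 ≤ r / p := (Nat.one_le_div_iff (by omega)).2 h
  nlinarith [Nat.mul_le_mul hone hp]

theorem two_pow_clog_div_mul_le {p : ℕ} (hp : 1 ≤ p) (m : ℕ) :
    2 ^ (Nat.clog 2 m / p) * 2 ^ p ≤ 2 ^ p + 4 * m := by
  set r := Nat.clog 2 m
  rcases Nat.lt_or_ge r p with h | h
  · rw [Nat.div_eq_of_lt h]; omega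
  · have hm : 1 < m := by
      by_contra hc
      have : r = 0 := Nat.clog_of_right_le_one (by omega) 2
      omega
    have hlt : 2 ^ (r - 1) < m := Nat.pow_pred_clog_lt_self (by norm_num) hm
    calc 2 ^ (r / p) * 2 ^ p = 2 ^ (r / p + p) := (pow_add _ _ _).symm
      _ ≤ 2 ^ (r - 1 + 2) :=
        Nat.pow_le_pow_right (by norm_num) ((div_add_le_succ hp h).trans (by omega))
      _ = 4 * 2 ^ (r - 1) := by rw [pow_add]; ring
      _ ≤ 2 ^ p + 4 * m := (Nat.mul_le_mul_left 4 hlt.le).trans (Nat.le_add_left _ _)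

theorem sum_layerTime_le {n D L Λ p : ℕ} (hp : 1 ≤ p) (hnD : n ≤ 2 ^ p * D) (hL : L ≤ D)
    (m : ℕ → ℕ) (hm : ∑ i ∈ Finset.Ico 1 (L + 1), m i ≤ n) :
    ∑ i ∈ Finset.Ico 1 (L + 1), layerTime Λ p (m i) ≤ 40 * (p * D) := by
  have hpow : ∑ i ∈ Finset.Ico 1 (L + 1), 2 ^ (Nat.clog 2 (m i) / p) ≤ 5 * D := by
    refine Nat.le_of_mul_le_mul_right ?_ (Nat.two_pow_pos p)
    rw [Finset.sum_mul]
    calc _ ≤ ∑ i ∈ Finset.Ico 1 (L + 1), (2 ^ p + 4 * m i) :=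
          Finset.sum_le_sum fun i _ => two_pow_clog_div_mul_le hp (m i)
      _ = L * 2 ^ p + 4 * ∑ i ∈ Finset.Ico 1 (L + 1), m i := by
          rw [Finset.sum_add_distrib, Finset.mul_sum]; simp
      _ ≤ D * 2 ^ p + 4 * (2 ^ p * D) := by gcongr; exact hm.trans hnD
      _ = 5 * D * 2 ^ p := by ring
  calc _ ≤ ∑ i ∈ Finset.Ico 1 (L + 1), 8 * p * 2 ^ (Nat.clog 2 (m i) / p) := by
        refine Finset.sum_le_sum fun i _ => (min_le_right _ _).trans (le_of_eq ?_)
        rw [pow_succ]; ring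
    _ = 8 * p * ∑ i ∈ Finset.Ico 1 (L + 1), 2 ^ (Nat.clog 2 (m i) / p) := by
        rw [Finset.mul_sum]
    _ ≤ 8 * p * (5 * D) := by gcongr
    _ = 40 * (p * D) := by ring

theorem RankedWalk.sum_card_layer_le {V : Type} [Fintype V] {G : Digraph V} {target : V} {L : ℕ}
    (R : RankedWalk G target L) (s : Finset ℕ) : ∑ i ∈ s, (R.layer i).card ≤ Fintype.card V :=
  (Finset.sum_card_fiberwise_eq_card_filter Finset.univ s R.rank).trans_le
    (Finset.card_filter_le _ _)

/-! ### The rate of progress -/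

/-- The base of the exponential bound, for windows of length at most `W`. -/
noncomputable def decayRate (W : ℕ) : ℝ := 1 - 1 / (28 * W)

section DecayRate

variable {W : ℕ} (hW : 1 ≤ W)
include hW

theorem one_div_mul_le : (1 : ℝ) / (28 * W) ≤ 1 / 28 := by
  have hW' : (1 : ℝ) ≤ W := by exact_mod_cast hW
  apply one_div_le_one_div_of_le <;> linarith

theorem decayRate_pos : 0 < decayRate W := by
  have := one_div_mul_le hW
  unfold decayRate
  linarith

theorem decayRate_pow_le_half : decayRate W ^ (28 * W) ≤ 1 / 2 := by
  have : (1 : ℝ) ≤ W := by exact_mod_cast hW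
  calc decayRate W ^ (28 * W) ≤ (Real.exp (-(1 / (28 * W)))) ^ (28 * W) :=
        pow_le_pow_left₀ (decayRate_pos hW).le (Real.one_sub_le_exp_neg _) _
    _ = Real.exp (-1) := by
        rw [← Real.exp_nat_mul]
        congr 1
        push_cast
        field_simp
    _ ≤ 1 / 2 := by
        rw [Real.exp_neg, one_div]
        exact inv_anti₀ (by norm_num) (by have := Real.add_one_le_exp (1 : ℝ); linarith)

end DecayRate

theorem decayRate_le_one (W : ℕ) : decayRate W ≤ 1 := by
  have : (0 : ℝ) ≤ 1 / (28 * W) := by positivity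
  unfold decayRate
  linarith

theorem le_decayRate_pow {W : ℕ} (hW : 1 ≤ W) : 27 / 28 ≤ decayRate W ^ W := by
  have : (1 : ℝ) ≤ W := by exact_mod_cast hW
  have hbernoulli := one_add_mul_le_pow (a := -(1 / (28 * (W : ℝ))))
    (by linarith [one_div_mul_le hW]) W
  have heq : (1 : ℝ) + W * -(1 / (28 * (W : ℝ))) = 27 / 28 := by
    field_simp; norm_num
  rwa [heq, ← sub_eq_add_neg] at hbernoulli

theorem pow_sixteen_add_le {z : ℝ} (h0 : 27 / 28 ≤ z) (h1 : z ≤ 1) :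
    7 / 8 + 1 / 8 * z ^ 16 ≤ z := by
  have hterm : ∀ i ∈ Finset.range 16, (1 / 2 : ℝ) ≤ z ^ i := fun i hi =>
    calc (1 / 2 : ℝ) ≤ (27 / 28) ^ 16 := by norm_num
      _ ≤ z ^ 16 := by gcongr
      _ ≤ z ^ i := pow_le_pow_of_le_one (by linarith) h1 (Finset.mem_range.1 hi).le
  have hsum : (8 : ℝ) ≤ ∑ i ∈ Finset.range 16, z ^ i := by
    have := Finset.card_nsmul_le_sum _ _ _ hterm
    norm_num at this
    exact this
  have hgeom := mul_neg_geom_sum z 16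
  nlinarith

theorem decayRate_window {W w : ℕ} (hW : 1 ≤ W) (hw : w ≤ W) :
    7 / 8 + 1 / 8 * decayRate W ^ (16 * w) ≤ decayRate W ^ w := by
  have h0 := (decayRate_pos hW).le
  rw [mul_comm 16 w, pow_mul]
  exact pow_sixteen_add_le
    ((le_decayRate_pow hW).trans (pow_le_pow_of_le_one h0 (decayRate_le_one W) hw))
    (pow_le_one₀ h0 (decayRate_le_one W))

/-! ### The broadcast procedure -/

theorem ofReal_decayRate_pow_le_half {W : ℕ} (hW : 1 ≤ W) :
    ENNReal.ofReal (decayRate W) ^ (28 * W) ≤ 2⁻¹ := by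
  rw [← ENNReal.ofReal_pow (decayRate_pos hW).le]
  refine (ENNReal.ofReal_le_ofReal (decayRate_pow_le_half hW)).trans_eq ?_
  rw [one_div, ENNReal.ofReal_inv_of_pos (by norm_num), ENNReal.ofReal_ofNat]

theorem ofReal_decayRate_window {W w : ℕ} (hW : 1 ≤ W) (hw : w ≤ W) :
    7 / 8 + 1 / 8 * ENNReal.ofReal (decayRate W) ^ (16 * w) ≤
      ENNReal.ofReal (decayRate W) ^ w := by
  have h0 := (decayRate_pos hW).le
  have h78 : (7 / 8 : ℝ≥0∞) = ENNReal.ofReal (7 / 8) := by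
    rw [ENNReal.ofReal_div_of_pos (by norm_num)]; norm_num
  have h18 : (1 / 8 : ℝ≥0∞) = ENNReal.ofReal (1 / 8) := by
    rw [ENNReal.ofReal_div_of_pos (by norm_num)]; norm_num
  rw [← ENNReal.ofReal_pow h0, ← ENNReal.ofReal_pow h0, h78, h18,
    ← ENNReal.ofReal_mul (by norm_num), ← ENNReal.ofReal_add (by norm_num) (by positivity)]
  exact ENNReal.ofReal_le_ofReal (decayRate_window hW hw)

theorem RankedWalk.uninformedProb_mixed_le {V : Type} [Fintype V] {G : Digraph V} {v : V}
    {L D Λ p q t : ℕ} (R : RankedWalk G v L) (hp : 1 ≤ p)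
    (hΛ : Nat.clog 2 (Fintype.card V) < Λ) (hcard : Fintype.card V ≤ 2 ^ p * D) (hL : L ≤ D)
    {σ : V → BcastState} (hinf : InformedBy t σ) (hreach : R.Reached 1 σ) :
    uninformedProb G (mixedLevel Λ p) (mixedStart Λ p) v
      (16 * (40 * (p * D)) + 28 * (4 * Λ) * q) t σ ≤ 2⁻¹ ^ q := by
  have hW : 1 ≤ 4 * Λ := by omega
  set x := ENNReal.ofReal (decayRate (4 * Λ))
  have hx1 : x ≤ 1 := ENNReal.ofReal_le_one.2 (decayRate_le_one _)
  have hx0 : x ≠ 0 := (ENNReal.ofReal_pos.2 (decayRate_pos hW)).ne'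
  set w : ℕ → ℕ := fun i => layerTime Λ p (R.layer i).card
  set S := ∑ i ∈ Finset.Ico 1 (L + 1), w i
  have hS : S ≤ 40 * (p * D) := sum_layerTime_le hp hcard hL _ (R.sum_card_layer_le _)
  have hschedules : ∀ i, Schedules (mixedLevel Λ p) (mixedStart Λ p)
      (Nat.clog 2 (R.layer i).card) (w i) := fun i =>
    schedules_layerTime hp ((Nat.clog_mono_right 2 (Finset.card_le_univ _)).trans_lt hΛ)
  have hpotential := R.uninformedProb_mul_le hx1 (fun i _ _ => hschedules i)
    (fun i _ _ => ofReal_decayRate_window hW (min_le_left _ _))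
    (16 * (40 * (p * D)) + 28 * (4 * Λ) * q) 1 t σ le_rfl (by omega) hinf hreach
  refine (ENNReal.mul_le_mul_iff_left (pow_ne_zero (16 * S) hx0)
    (ENNReal.pow_ne_top ENNReal.ofReal_ne_top)).1 (hpotential.trans ?_)
  calc x ^ (16 * (40 * (p * D)) + 28 * (4 * Λ) * q)
      = (x ^ (28 * (4 * Λ))) ^ q * x ^ (16 * (40 * (p * D))) := by
        rw [pow_add, mul_comm, pow_mul x (28 * (4 * Λ))]
    _ ≤ 2⁻¹ ^ q * x ^ (16 * S) :=
        mul_le_mul' (pow_le_pow_left₀ bot_le (ofReal_decayRate_pow_le_half hW) _)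
          (pow_le_pow_of_le_one bot_le hx1 (by omega))

/-- The number of levels that are sufficient for most layers of a network. -/
def shortLevels (n D : ℕ) : ℕ := Nat.log 2 (n / D) + 1

theorem le_two_pow_shortLevels_mul {D : ℕ} (hD : 1 ≤ D) (n : ℕ) :
    n ≤ 2 ^ shortLevels n D * D :=
  ((Nat.div_lt_iff_lt_mul hD).1 (Nat.lt_pow_succ_log_self (by norm_num) _)).le

/-- The duration of a broadcast with error probability at most `2 ^ (-c log n)`: the first summand
pays for the layers of a shortest walk, the second one for the error probability. -/
def layeredTime (c n D : ℕ) : ℕ :=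
  16 * (40 * (shortLevels n D * D)) + 28 * (4 * (lg n + 1)) * ((c + 1) * lg n)

/-- The state of a node at the start of a broadcast in which it has the input `x`. -/
def BcastState.init (x : Option Bits) : BcastState := x.map fun y => (0, y)

theorem BcastState.init_eq_some_iff {x : Option Bits} {p : ℕ × Bits} :
    init x = some p ↔ p.1 = 0 ∧ x = some p.2 := by
  simp only [init, Option.map_eq_some_iff, Prod.ext_iff]
  aesop

/-- A Partial Multi-Broadcast procedure with error probability at most `2 ^ (-c log n)`. -/
noncomputable def layeredBroadcast (c : ℕ) : MultiBroadcast where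
  time n D := layeredTime c n D
  run n D _ x := (bcastSteps (mixedLevel (lg n + 1) (shortLevels n D))
    (mixedStart (lg n + 1) (shortLevels n D)) (layeredTime c n D) 0 (BcastState.init x)).bind
      fun σ => Prog.done (σ.map Prod.snd)

theorem hasDuration_layeredBroadcast (c n D l : ℕ) (x : Option Bits) :
    ((layeredBroadcast c).run n D l x).HasDuration ((layeredBroadcast c).time n D) :=
  (hasDuration_bcastSteps _ _ _ _ _).bind (t := 0) fun _ => rfl

theorem bounded_layeredBroadcast (c n D l M : ℕ) (x : Option Bits)
    (hx : ∀ y ∈ x, y.length ≤ M) :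
    ((layeredBroadcast c).run n D l x).Bounded M fun m => ∀ y ∈ m, y.length ≤ M := by
  refine (bounded_bcastSteps _ _ M _ _ _ fun p hp => ?_).bind fun σ hσ y hy => ?_
  · exact hx p.2 (BcastState.init_eq_some_iff.1 hp).2
  · obtain ⟨p, hp, rfl⟩ := Option.map_eq_some_iff.1 hy
    exact hσ p hp

theorem informedBy_init {V : Type} (f : V → Option Bits) :
    InformedBy 0 fun v => BcastState.init (f v) :=
  fun _ _ hp => (BcastState.init_eq_some_iff.1 hp).1.le

section Outcome

variable {V : Type} {t t' : ℕ} {f : V → Option Bits} {σ : V → BcastState}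

theorem Extends.exists_source_of_init (h : Extends t t' (fun v => BcastState.init (f v)) σ) {v : V}
    {p : ℕ × Bits} (hp : σ v = some p) : ∃ u, f u = some p.2 := by
  obtain ⟨u, τ, hu⟩ := h.exists_source hp
  exact ⟨u, (BcastState.init_eq_some_iff.1 hu).2⟩

theorem Extends.map_snd_eq_of_init (h : Extends t t' (fun v => BcastState.init (f v)) σ) {v : V}
    (hv : f v ≠ none) : (σ v).map Prod.snd = f v := by
  obtain ⟨y, hy⟩ := Option.ne_none_iff_exists'.1 hv
  rw [h.keep v (0, y) (BcastState.init_eq_some_iff.2 ⟨rfl, hy⟩), hy, Option.map_some]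

theorem Extends.correct_of_init (h : Extends t t' (fun v => BcastState.init (f v)) σ)
    (hall : (∃ s, f s ≠ none) → ∀ v, σ v ≠ none) :
    MultiBroadcast.Correct f fun v => (σ v).map Prod.snd := by
  refine ⟨fun hnone v => ?_, fun hs v => ?_⟩
  · by_contra hv
    have hσ : σ v ≠ none := by simpa only [Option.map_eq_none_iff] using hv
    obtain ⟨p, hp⟩ := Option.ne_none_iff_exists'.1 hσ
    obtain ⟨u, hu⟩ := h.exists_source_of_init hp
    simp [hnone u] at hu
  · obtain ⟨p, hp⟩ := Option.ne_none_iff_exists'.1 (hall hs v)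
    obtain ⟨u, hu⟩ := h.exists_source_of_init hp
    exact ⟨u, by simp [hu], by simp [hp, hu]⟩

end Outcome

theorem le_two_pow_lg (n : ℕ) : n ≤ 2 ^ lg n := Nat.le_pow_clog (by norm_num) n

theorem natCast_mul_inv_two_pow_lg_le_one (n : ℕ) : (n : ℝ≥0∞) * 2⁻¹ ^ lg n ≤ 1 := by
  rw [← ENNReal.inv_pow, ← div_eq_mul_inv]
  refine ENNReal.div_le_of_le_mul ?_
  rw [one_mul]
  exact_mod_cast le_two_pow_lg n

section Reliability

variable {V : Type} [Fintype V] {G : Digraph V} {n D : ℕ}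

theorem sum_uninformedProb_le (hn : Fintype.card V = n) (hD : 1 ≤ D)
    (hG : ∀ u v, ∃ k ≤ D, ReachIn G k u v) (c : ℕ) {f : V → Option Bits} {s : V}
    (hs : f s ≠ none) :
    ∑ v, uninformedProb G (mixedLevel (lg n + 1) (shortLevels n D))
      (mixedStart (lg n + 1) (shortLevels n D)) v (layeredTime c n D) 0
      (fun v => BcastState.init (f v)) ≤ 2⁻¹ ^ (c * lg n) := by
  have hterm : ∀ v, uninformedProb G (mixedLevel (lg n + 1) (shortLevels n D))
      (mixedStart (lg n + 1) (shortLevels n D)) v (layeredTime c n D) 0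
      (fun v => BcastState.init (f v)) ≤ 2⁻¹ ^ ((c + 1) * lg n) := fun v => by
    obtain ⟨L, hL, hLr⟩ := hG s v
    obtain ⟨R, hR⟩ := exists_rankedWalk G hLr
    exact R.uninformedProb_mixed_le (Nat.le_add_left _ _) (by rw [hn]; exact Nat.lt_succ_self _)
      (hn.trans_le (le_two_pow_shortLevels_mul hD n)) hL (informedBy_init f)
      ⟨s, by simpa [BcastState.init] using hs, hR⟩
  calc _ ≤ ∑ _v : V, (2⁻¹ : ℝ≥0∞) ^ ((c + 1) * lg n) := Finset.sum_le_sum fun v _ => hterm v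
    _ = 2⁻¹ ^ (c * lg n) * (n * 2⁻¹ ^ lg n) := by
        rw [Finset.sum_const, Finset.card_univ, hn, nsmul_eq_mul]; ring
    _ ≤ 2⁻¹ ^ (c * lg n) :=
        mul_le_of_le_one_right bot_le (natCast_mul_inv_two_pow_lg_le_one n)

open Classical in
theorem failure_layeredBroadcast_eq (c l : ℕ) (f : V → Option Bits)
    (E : (V → Option Bits) → Prop) :
    failure G (layeredTime c n D) (fun v => (layeredBroadcast c).run n D l (f v)) E =
      mean (bcastRun G (mixedLevel (lg n + 1) (shortLevels n D))
        (mixedStart (lg n + 1) (shortLevels n D)) (layeredTime c n D) 0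
        fun v => BcastState.init (f v))
        fun σ => if E fun v => (σ v).map Prod.snd then 0 else 1 := by
  change failure G _ (fun v => (bcastSteps _ _ _ 0 (BcastState.init (f v))).bind fun σ =>
    Prog.done (σ.map Prod.snd)) E = _
  rw [failure_map G _ _ fun _ => Option.map Prod.snd, failure, expect_bcastSteps]

theorem reliable_layeredBroadcast (hn : Fintype.card V = n) (hD : 1 ≤ D)
    (hG : ∀ u v, ∃ k ≤ D, ReachIn G k u v) (c lmax : ℕ) :
    Reliable (layeredBroadcast c) G n D lmax (2⁻¹ ^ (c * lg n)) where
  hasDuration l x := hasDuration_layeredBroadcast c n D l x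
  failure_le l _ f _ := by
    classical
    refine (failure_layeredBroadcast_eq c l f _).trans_le ?_
    by_cases hs : ∃ s, f s ≠ none
    · obtain ⟨s, hs⟩ := hs
      refine le_trans (mean_mono_support (ψ := fun σ => ∑ v, if σ v = none then 1 else 0)
        fun σ hσ => ?_) ((mean_finset_sum _ _ _).trans_le (sum_uninformedProb_le hn hD hG c hs))
      have hext := extends_of_mem_support_bcastRun G _ _ hσ
      by_cases hall : ∀ v, σ v ≠ none
      · rw [if_pos ⟨hext.correct_of_init fun _ => hall, fun _ => hext.map_snd_eq_of_init⟩]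
        exact bot_le
      · obtain ⟨v, hv⟩ := not_forall_not.1 hall
        refine le_trans ?_ (Finset.single_le_sum (fun _ _ => bot_le) (Finset.mem_univ v))
        rw [if_pos hv]
        split_ifs <;> simp
    · refine (mean_mono_support fun σ hσ => ?_).trans ((mean_const _ 0).le.trans bot_le)
      have hext := extends_of_mem_support_bcastRun G _ _ hσ
      rw [if_pos ⟨hext.correct_of_init fun h => absurd h hs, fun _ => hext.map_snd_eq_of_init⟩]

end Reliability

/-! ### Message lengths -/

section Messages

variable {M : ℕ}

theorem bounded_idle (t : ℕ) : (Prog.idle t).Bounded M fun _ => True := by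
  induction t with
  | zero => trivial
  | succ t ih => exact ⟨fun _ hy => (Option.not_mem_none _ hy).elim, fun _ _ => ih⟩

theorem bounded_randomBits : ∀ l, (randomBits l).Bounded M fun x => x.length = l
  | 0 => rfl
  | l + 1 => fun _ => (bounded_randomBits l).bind fun _ hx => congrArg Nat.succ hx

theorem bounded_decay (n : ℕ) {x : Option Bits} (hx : ∀ y ∈ x, y.length ≤ M) :
    (decay n x).Bounded M fun got => ∀ y ∈ got, y.length ≤ M := by
  rw [decay_eq_foldlM]
  refine Prog.bounded_foldlM _ _ (fun got i hgot b => ⟨fun y hy => ?_, fun r hr y hy => ?_⟩) _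
    (by simp)
  · exact hx y (Option.mem_ite_none_right.1 hy).2
  · rcases List.mem_append.1 hy with hy | hy
    · exact hgot y hy
    · exact hr y (Option.mem_toList.1 hy)

theorem bounded_decay4 (n : ℕ) {x : Option Bits} (hx : ∀ y ∈ x, y.length ≤ M) :
    (decay4 n x).Bounded M fun got => ∀ y ∈ got, y.length ≤ M :=
  (bounded_decay n hx).bind fun _ h₁ => (bounded_decay n hx).bind fun _ h₂ =>
    (bounded_decay n hx).bind fun _ h₃ => (bounded_decay n hx).bind fun _ h₄ y hy => by
      simp only [List.mem_append] at hy
      rcases hy with ((hy | hy) | hy) | hy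
      exacts [h₁ y hy, h₂ y hy, h₃ y hy, h₄ y hy]

theorem length_witnessUpdate_le {s : Bits × Bool} (hs : s.1.length ≤ M) (i : ℕ) {got : List Bits}
    (hgot : ∀ y ∈ got, y.length ≤ M) : (witnessUpdate s i got).1.length ≤ M := by
  unfold witnessUpdate
  split_ifs
  · rcases foldl_max_mem got s.1 with h | h
    · exact h.symm ▸ hs
    · exact hgot _ h
  · exact hs

theorem bounded_findWitnesses (n l : ℕ) {m : Bits} (hm : m.length ≤ M) :
    (findWitnesses n l m).Bounded M fun s => s.1.length ≤ M := by
  rw [findWitnesses_eq_foldlM]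
  refine Prog.bounded_foldlM _ _ (fun s i hs => ?_) _ hm
  refine (bounded_decay4 n fun y hy => ?_).bind fun got hgot => length_witnessUpdate_le hs i hgot
  obtain rfl := Option.some_injective _ (Option.mem_ite_none_right.1 hy).2
  exact hs

/-- The procedure sends and outputs only strings of at most `M` bits if its inputs have at most
`M` bits. -/
def MultiBroadcast.BoundedBy (B : MultiBroadcast) (n D M : ℕ) : Prop :=
  ∀ l x, (∀ y ∈ x, y.length ≤ M) → (B.run n D l x).Bounded M fun m => ∀ y ∈ m, y.length ≤ M

variable {B : MultiBroadcast} {n D : ℕ}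

theorem bounded_selection (hB : B.BoundedBy n D M) (l : ℕ) {x : Option Bits}
    (hx : ∀ y ∈ x, y.length ≤ M) :
    (selection B n D l x).Bounded M fun _ => True := by
  rw [selection_eq_bind]
  refine (hB l x hx).bind fun m hm => ?_
  cases m with
  | none => exact (bounded_idle _).bind fun _ _ => trivial
  | some m₀ =>
    refine (bounded_findWitnesses n l (hm m₀ rfl)).bind fun s hs =>
      (hB l _ fun y hy => ?_).bind fun _ _ => trivial
    obtain rfl := Option.some_injective _ (Option.mem_ite_none_right.1 hy).2
    exact hs

theorem bounded_search (hB : B.BoundedBy n D M) (hM : 1 ≤ M) (k : ℕ) (id : Option Bits) :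
    (search B n D k id).Bounded M fun _ => True := by
  rw [search_eq_foldlM]
  refine Prog.bounded_foldlM _ _ (fun m i _ => ?_) _ trivial
  refine (hB 1 _ fun y hy => ?_).bind fun _ _ => trivial
  obtain rfl := Option.some_injective _ (Option.mem_ite_none_right.1 hy).2
  exact hM

theorem bounded_selectionLoop (hB : B.BoundedBy n D M) (l : ℕ) {id : Option Bits}
    (hid : ∀ y ∈ id, y.length ≤ M) :
    ∀ k inC, (selectionLoop B n D l id k inC).Bounded M fun _ => True
  | 0, _ => trivial
  | k + 1, inC => by
    rw [selectionLoop_succ]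
    refine (bounded_selection hB l fun y hy => ?_).bind fun o _ => ?_
    · exact hid y (Option.mem_ite_none_right.1 hy).2
    · split_ifs
      · trivial
      · exact (bounded_selectionLoop hB l hid k _).bind fun _ _ => trivial

theorem bounded_chooseId {κ : Constants} (hbits : κ.bits * lg n ≤ M) :
    (chooseId κ n).Bounded M fun id => ∀ y ∈ id, y.length ≤ M
  | false => fun _ hy => (Option.not_mem_none _ hy).elim
  | true => (bounded_randomBits _).bind fun x hx y hy => by
      obtain rfl := Option.some_injective _ hy
      exact hx.le.trans hbits

theorem bounded_electFrom {κ : Constants} (hB : B.BoundedBy n D M) (hM : 1 ≤ M) {id : Option Bits}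
    (hid : ∀ y ∈ id, y.length ≤ M) : (electFrom κ B n D id).Bounded M fun _ => True :=
  (bounded_search hB hM _ id).bind fun _ _ =>
    (bounded_selectionLoop hB _ hid _ _).bind fun _ _ => trivial

theorem msgLE_leaderElection {κ : Constants} (hB : B.BoundedBy n D M) (hM : 1 ≤ M)
    (hbits : κ.bits * lg n ≤ M) :
    (leaderElection κ B n D).MsgLE M := by
  rw [leaderElection_eq_bind]
  exact ((bounded_chooseId hbits).bind fun id hid => bounded_electFrom hB hM hid).msgLE

end Messages

theorem stepsLE_leaderElection {κ : Constants} {B : MultiBroadcast} {n D : ℕ}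
    (hB : ∀ l x, (B.run n D l x).HasDuration (B.time n D)) :
    (leaderElection κ B n D).StepsLE (electionTime κ B n D) := by
  rw [leaderElection_eq_bind, ← zero_add (electionTime κ B n D)]
  exact (hasDuration_chooseId κ n).stepsLE.bind fun id =>
    (hasDuration_search hB _ id).stepsLE.bind fun m =>
      (stepsLE_selectionLoop hB _ id _ _).bind (t := 0) fun _ => trivial

/-! ### Eccentricity -/

section Eccentricity

variable {V : Type} {G : Digraph V} {D : ℕ}

theorem HasEccentricity.pos [Nontrivial V] (hD : HasEccentricity G D) : 1 ≤ D := by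
  refine Nat.one_le_iff_ne_zero.2 ?_
  rintro rfl
  obtain ⟨a, b, hab⟩ := exists_pair_ne V
  obtain ⟨k, hk, hr⟩ := hD.1 a b
  obtain rfl := Nat.le_zero.1 hk
  exact hab hr

theorem le_ncard_reachIn_le [Finite V] {u v : V} (huv : ∃ m, ReachIn G m u v) {k : ℕ}
    (hfar : ∀ j < k, ¬ ReachIn G j u v) : k ≤ {w | ∃ j ≤ k, ReachIn G j u w}.ncard := by
  induction k with
  | zero => exact Nat.zero_le _
  | succ k ih =>
    obtain ⟨m, hm⟩ := huv
    obtain ⟨a, b, ⟨i, hi, ha⟩, hb, hab⟩ :=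
      exists_adj_crossing G (P := fun w => ∃ j ≤ k, ReachIn G j u w) ⟨0, k.zero_le, rfl⟩ hm
        fun ⟨j, hj, hr⟩ => hfar j (Nat.lt_succ_of_le hj) hr
    have hsub : {w | ∃ j ≤ k, ReachIn G j u w} ⊆ {w | ∃ j ≤ k + 1, ReachIn G j u w} :=
      fun w ⟨j, hj, hr⟩ => ⟨j, Nat.le_succ_of_le hj, hr⟩
    have hbnew : b ∈ {w | ∃ j ≤ k + 1, ReachIn G j u w} :=
      ⟨i + 1, Nat.succ_le_succ hi, a, ha, hab⟩
    exact (ih fun j hj => hfar j (Nat.lt_succ_of_lt hj)).trans_lt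
      (Set.ncard_lt_ncard ((Set.ssubset_iff_of_subset hsub).2 ⟨b, hbnew, hb⟩))

theorem HasEccentricity.le_card [Fintype V] (hD : HasEccentricity G D) : D ≤ Fintype.card V := by
  obtain ⟨hall, u, v, hfar⟩ := hD
  refine (le_ncard_reachIn_le ((hall u v).imp fun _ h => h.2) hfar).trans ?_
  exact (Set.ncard_le_card _).trans_eq Nat.card_eq_fintype_card

end Eccentricity

/-! ### Time bounds -/

theorem one_le_logb {n : ℕ} (hn : 2 ≤ n) : 1 ≤ Real.logb 2 n := by
  rw [Real.le_logb_iff_rpow_le (by norm_num) (by positivity), Real.rpow_one]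
  exact_mod_cast hn

theorem lg_le_two_mul_logb {n : ℕ} (hn : 2 ≤ n) : (lg n : ℝ) ≤ 2 * Real.logb 2 n := by
  have hlog := one_le_logb hn
  have hceil : ⌈Real.logb 2 n⌉₊ = lg n := by simpa [lg] using Real.natCeil_logb_natCast 2 n
  have hlt := Nat.ceil_lt_add_one (a := Real.logb 2 n) (by linarith)
  rw [hceil] at hlt
  linarith

theorem lg_le_sqrtLg_sq (n : ℕ) : lg n ≤ sqrtLg n ^ 2 := by
  have h : (lg n : ℝ) ≤ (sqrtLg n : ℝ) ^ 2 :=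
    (Real.sqrt_le_left (Nat.cast_nonneg _)).1 (Nat.le_ceil _)
  exact_mod_cast h

theorem sqrtLg_le {n : ℕ} (hn : 2 ≤ n) : (sqrtLg n : ℝ) ≤ 3 * Real.sqrt (Real.logb 2 n) := by
  have hlog := one_le_logb hn
  have hceil : (sqrtLg n : ℝ) < Real.sqrt (lg n) + 1 := Nat.ceil_lt_add_one (Real.sqrt_nonneg _)
  have hsqrt : Real.sqrt (lg n) ≤ 2 * Real.sqrt (Real.logb 2 n) := by
    refine Real.sqrt_le_iff.2 ⟨by positivity, ?_⟩
    rw [mul_pow, Real.sq_sqrt (by linarith)]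
    linarith [lg_le_two_mul_logb hn]
  linarith [Real.one_le_sqrt.2 hlog]

theorem shortLevels_mul_le {n D : ℕ} (hD : 1 ≤ D) (hDn : D ≤ n) :
    ((shortLevels n D * D : ℕ) : ℝ) ≤ D * Real.logb 2 (2 * n / D) := by
  have hD0 : (0 : ℝ) < D := by exact_mod_cast hD
  have hn0 : (0 : ℝ) < n := by exact_mod_cast hD.trans hDn
  have hlog : (Nat.log 2 (n / D) : ℝ) ≤ Real.logb 2 (n / D) := by
    rw [Real.le_logb_iff_rpow_le (by norm_num) (by positivity), Real.rpow_natCast]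
    calc ((2 : ℝ) ^ Nat.log 2 (n / D)) ≤ ((n / D : ℕ) : ℝ) := by
          exact_mod_cast Nat.pow_log_le_self 2 (Nat.div_pos hDn hD).ne'
      _ ≤ n / D := Nat.cast_div_le
  have hdouble : Real.logb 2 (2 * n / D) = 1 + Real.logb 2 (n / D) := by
    rw [mul_div_assoc, Real.logb_mul (by norm_num) (by positivity),
      Real.logb_self_eq_one (by norm_num)]
  rw [hdouble, shortLevels, mul_comm]
  push_cast
  exact mul_le_mul_of_nonneg_left (by linarith) hD0.le

theorem logb_sq_le_bcastTime {n D : ℕ} (hD : 1 ≤ D) (hDn : D ≤ n) :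
    Real.logb 2 n ^ 2 ≤ bcastTime n D :=
  le_add_of_nonneg_left ((Nat.cast_nonneg _).trans (shortLevels_mul_le hD hDn))

/-- The factor of `bcastTime` in the bound for the duration of a broadcast. -/
def layeredFactor (c : ℕ) : ℝ := 640 + 672 * (c + 1)

theorem layeredFactor_nonneg (c : ℕ) : 0 ≤ layeredFactor c := by
  unfold layeredFactor
  positivity

theorem layeredTime_le {n D : ℕ} (hn : 2 ≤ n) (hD : 1 ≤ D) (hDn : D ≤ n) (c : ℕ) :
    (layeredTime c n D : ℝ) ≤ layeredFactor c * bcastTime n D := by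
  have hshort := shortLevels_mul_le hD hDn
  have hlog := one_le_logb hn
  have hlg : ((lg n : ℝ) + 1) * lg n ≤ 6 * Real.logb 2 n ^ 2 := by
    nlinarith [lg_le_two_mul_logb hn, (lg n).cast_nonneg (α := ℝ)]
  calc (layeredTime c n D : ℝ)
      = 640 * (shortLevels n D * D : ℕ) + 112 * (c + 1) * ((lg n + 1) * lg n) := by
        rw [layeredTime]; push_cast; ring
    _ ≤ 640 * (D * Real.logb 2 (2 * n / D)) + 112 * (c + 1) * (6 * Real.logb 2 n ^ 2) := by
        gcongr
    _ ≤ layeredFactor c * (D * Real.logb 2 (2 * n / D) + Real.logb 2 n ^ 2) := by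
        rw [layeredFactor]
        nlinarith [mul_nonneg c.cast_nonneg ((Nat.cast_nonneg _).trans hshort),
          (Nat.cast_nonneg _).trans hshort, sq_nonneg (Real.logb 2 n)]

/-- The factor of `bcastTime n D * √(log n)` in the bound for the duration of the algorithm. -/
def electionFactor (κ : Constants) (c : ℕ) : ℝ :=
  3 * ((1 + 2 * κ.rounds) * layeredFactor c + 16 * κ.rounds * κ.bits)

theorem electionFactor_nonneg (κ : Constants) (c : ℕ) : 0 ≤ electionFactor κ c := by
  have _ := layeredFactor_nonneg c
  unfold electionFactor
  positivity

theorem electionTime_layeredBroadcast_le {κ : Constants} {n D : ℕ} (hn : 2 ≤ n) (hD : 1 ≤ D)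
    (hDn : D ≤ n) (c : ℕ) :
    (electionTime κ (layeredBroadcast c) n D : ℝ) ≤
      electionFactor κ c * (bcastTime n D * Real.sqrt (Real.logb 2 n)) := by
  have htime := layeredTime_le hn hD hDn c
  have hlogsq := logb_sq_le_bcastTime hD hDn
  have _ : 0 ≤ bcastTime n D := (sq_nonneg _).trans hlogsq
  have _ := layeredFactor_nonneg c
  have hlg : (lg n : ℝ) * lg n ≤ 4 * bcastTime n D := by
    nlinarith [lg_le_two_mul_logb hn, (lg n).cast_nonneg (α := ℝ)]
  calc (electionTime κ (layeredBroadcast c) n D : ℝ)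
      = sqrtLg n *
          ((1 + 2 * κ.rounds) * layeredTime c n D + 4 * κ.rounds * κ.bits * (lg n * lg n)) := by
        simp only [electionTime, selectionTime, layeredBroadcast]; push_cast; ring
    _ ≤ 3 * Real.sqrt (Real.logb 2 n) *
          ((1 + 2 * κ.rounds) * (layeredFactor c * bcastTime n D) +
            4 * κ.rounds * κ.bits * (4 * bcastTime n D)) := by
        have _ := sqrtLg_le hn
        gcongr
    _ = electionFactor κ c * (bcastTime n D * Real.sqrt (Real.logb 2 n)) := by
        rw [electionFactor]; ring

/-! ### Error probabilities -/

theorem inv_two_pow_mul_lg_le {n c₀ : ℕ} {c : ℝ} (hn : 1 ≤ n) (hc : c ≤ c₀) :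
    (2⁻¹ : ℝ≥0∞) ^ (c₀ * lg n) ≤ ENNReal.ofReal ((n : ℝ) ^ (-c)) := by
  have htwo : (2⁻¹ : ℝ≥0∞) = ENNReal.ofReal 2⁻¹ := by
    rw [ENNReal.ofReal_inv_of_pos (by norm_num), ENNReal.ofReal_ofNat]
  have hn1 : (1 : ℝ) ≤ n := by exact_mod_cast hn
  rw [htwo, ← ENNReal.ofReal_pow (by norm_num)]
  refine ENNReal.ofReal_le_ofReal ?_
  calc ((2 : ℝ)⁻¹) ^ (c₀ * lg n) = (((2 : ℝ) ^ lg n) ^ c₀)⁻¹ := by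
        rw [← pow_mul, mul_comm, inv_pow]
    _ ≤ ((n : ℝ) ^ c₀)⁻¹ := by
        gcongr
        exact_mod_cast le_two_pow_lg n
    _ = (n : ℝ) ^ (-(c₀ : ℝ)) := by rw [Real.rpow_neg (by positivity), Real.rpow_natCast]
    _ ≤ (n : ℝ) ^ (-c) := Real.rpow_le_rpow_of_exponent_le hn1 (by linarith)

theorem mul_lg_le_floor {n b : ℕ} {K : ℝ} (hn : 2 ≤ n) (hK : 2 * b ≤ K) :
    b * lg n ≤ ⌊K * Real.logb 2 n⌋₊ := by
  have hlog := one_le_logb hn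
  refine Nat.le_floor ?_
  push_cast
  calc (b : ℝ) * lg n ≤ b * (2 * Real.logb 2 n) := by gcongr; exact lg_le_two_mul_logb hn
    _ = 2 * b * Real.logb 2 n := by ring
    _ ≤ K * Real.logb 2 n := by gcongr

theorem layeredBroadcast_works {V : Type} [Fintype V] {G : Digraph V} {n D lmax c₀ : ℕ} {c K : ℝ}
    (hn2 : 2 ≤ n) (hn : Fintype.card V = n) (hD : 1 ≤ D) (hG : HasEccentricity G D) (hc : c ≤ c₀)
    (hK : layeredFactor c₀ ≤ K) (hlmax : lmax ≤ ⌊K * Real.logb 2 n⌋₊) :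
    (layeredBroadcast c₀).Works G n D lmax c K := by
  have hDn : D ≤ n := hn ▸ hG.le_card
  have hrel := reliable_layeredBroadcast hn hD hG.1 c₀ lmax
  have hb : 0 ≤ bcastTime n D := (sq_nonneg _).trans (logb_sq_le_bcastTime hD hDn)
  refine ⟨(layeredTime_le hn2 hD hDn c₀).trans (mul_le_mul_of_nonneg_right hK hb),
    fun l hl => ⟨hrel.hasDuration l, fun x hx => ?_, fun f hf => ?_⟩⟩
  · exact (bounded_layeredBroadcast c₀ n D l _ x fun y hy =>
      ((hx y hy).le.trans hl).trans hlmax).msgLE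
  · refine le_prob_of_failure_le G (by positivity) ?_
    calc _ ≤ (2⁻¹ : ℝ≥0∞) ^ (c₀ * lg n) :=
          (failure_mono G fun m hm => hm.1).trans (hrel.failure_le l hl f hf)
      _ ≤ ENNReal.ofReal ((n : ℝ) ^ (-c)) := inv_two_pow_mul_lg_le (by omega) hc

theorem electsLeader_of_electionRisk_le {κ : Constants} {c₀ c' n₀ : ℕ} {c : ℝ}
    (hbits : 1 ≤ κ.bits) (hrounds : 1 ≤ κ.rounds) (hc : c ≤ c₀) (hc' : c₀ ≤ c') (hn₀ : 2 ≤ n₀)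
    (hrisk : ∀ n, n₀ ≤ n → electionRisk κ n (2⁻¹ ^ (c' * lg n)) ≤ 2⁻¹ ^ (c₀ * lg n)) :
    ElectsLeader κ c n₀ := by
  have hbits' : (1 : ℝ) ≤ κ.bits := by exact_mod_cast hbits
  have hbcast := layeredFactor_nonneg c'
  have helect := electionFactor_nonneg κ c'
  refine ⟨layeredBroadcast c', electionTime κ (layeredBroadcast c'),
    layeredFactor c' + electionFactor κ c' + 2 * κ.bits, fun n D hn V _ G hV hG => ?_⟩
  have hn2 : 2 ≤ n := hn₀.trans hn
  have _ : Nontrivial V := Fintype.one_lt_card_iff_nontrivial.1 (hV ▸ hn2)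
  have hD : 1 ≤ D := hG.pos
  have hDn : D ≤ n := hV ▸ hG.le_card
  have hb : 0 ≤ bcastTime n D := (sq_nonneg _).trans (logb_sq_le_bcastTime hD hDn)
  have hrel := reliable_layeredBroadcast hV hD hG.1 c' (κ.bits * lg n)
  have hM := mul_lg_le_floor hn2 (b := κ.bits)
    (K := layeredFactor c' + electionFactor κ c' + 2 * κ.bits) (by linarith)
  have hM1 := (Nat.mul_pos hbits (Nat.clog_pos (by norm_num) hn2)).trans_le hM
  refine ⟨layeredBroadcast_works hn2 hV hD hG (hc.trans (by exact_mod_cast hc'))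
    (by linarith) hM, ?_, stepsLE_leaderElection hrel.hasDuration,
    msgLE_leaderElection (fun l x hx => bounded_layeredBroadcast c' n D l _ x hx) hM1 hM, ?_⟩
  · refine (electionTime_layeredBroadcast_le hn2 hD hDn c').trans ?_
    exact mul_le_mul_of_nonneg_right (by linarith) (by positivity)
  · refine le_prob_of_failure_le G (by positivity) ?_
    calc _ ≤ electionRisk κ n (2⁻¹ ^ (c' * lg n)) :=
          failure_leaderElection_le hrel hbits hrounds hn2 hV fun u v =>
            (hG.1 u v).imp fun _ h => h.2
      _ ≤ 2⁻¹ ^ (c₀ * lg n) := hrisk n hn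
      _ ≤ ENNReal.ofReal ((n : ℝ) ^ (-c)) := inv_two_pow_mul_lg_le (by omega) hc

/-! ### Choice of the constants -/

theorem natCast_mul_inv_two_pow_le {a e f : ℕ} (h : a * 2 ^ f ≤ 2 ^ e) :
    (a : ℝ≥0∞) * 2⁻¹ ^ e ≤ 2⁻¹ ^ f := by
  rw [← ENNReal.inv_pow, ← ENNReal.inv_pow, ← div_eq_mul_inv]
  refine ENNReal.div_le_of_le_mul ?_
  rw [mul_comm, ← div_eq_mul_inv, ENNReal.le_div_iff_mul_le (by simp) (by simp)]
  exact_mod_cast h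

theorem missFactor_pow_le : (2⁻¹ + 2⁻¹ * (7 / 8) ^ 4 : ℝ≥0∞) ^ 16 ≤ 2⁻¹ ^ 5 := by
  have h2 : (2⁻¹ : ℝ≥0∞) = ENNReal.ofReal 2⁻¹ := by
    rw [ENNReal.ofReal_inv_of_pos (by norm_num)]; norm_num
  have h78 : (7 / 8 : ℝ≥0∞) = ENNReal.ofReal (7 / 8) := by
    rw [ENNReal.ofReal_div_of_pos (by norm_num)]; norm_num
  rw [h2, h78, ← ENNReal.ofReal_pow (by norm_num), ← ENNReal.ofReal_pow (by norm_num),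
    ← ENNReal.ofReal_mul (by norm_num), ← ENNReal.ofReal_add (by norm_num) (by norm_num),
    ← ENNReal.ofReal_pow (by norm_num)]
  exact ENNReal.ofReal_le_ofReal (by norm_num)

theorem lg_le_two_pow_lg (n : ℕ) : lg n ≤ 2 ^ lg n := Nat.lt_two_pow_self.le

theorem sqrtLg_le_two_pow_lg (n : ℕ) : sqrtLg n ≤ 2 ^ lg n :=
  (sqrtLg_le_lg n).trans (lg_le_two_pow_lg n)

section Risk

variable {κ : Constants} {c₀ n : ℕ}

-- The square of the inequality involves only `sqrtLg n ^ 2`, which bounds `lg n`.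
theorem crowdingRisk_le (hbase : (κ.cand * sqrtLg n ^ 2) ^ 2 ≤ 2 ^ sqrtLg n)
    (hrounds : 2 * c₀ * sqrtLg n ^ 2 + 4 + sqrtLg n ≤ κ.rounds * sqrtLg n ^ 2) :
    crowdingRisk κ n ≤ 2⁻¹ ^ (c₀ * lg n + 2) := by
  unfold crowdingRisk
  split_ifs
  · exact bot_le
  have hLs := lg_le_sqrtLg_sq n
  set L := lg n
  set s := sqrtLg n
  set N := κ.rounds * s
  rw [← pow_mul, ← Nat.cast_pow]
  refine natCast_mul_inv_two_pow_le ((Nat.pow_le_pow_iff_left (n := 2) (by norm_num)).1 ?_)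
  calc ((κ.cand * L) ^ (N + 1) * 2 ^ (c₀ * L + 2)) ^ 2
      = ((κ.cand * L) ^ 2) ^ (N + 1) * 2 ^ (2 * (c₀ * L + 2)) := by
        rw [mul_pow, ← pow_mul, ← pow_mul, ← pow_mul, mul_comm 2 (N + 1), mul_comm 2 (c₀ * L + 2)]
    _ ≤ ((κ.cand * s ^ 2) ^ 2) ^ (N + 1) * 2 ^ (2 * (c₀ * s ^ 2 + 2)) := by
        gcongr
        exact one_le_two
    _ ≤ (2 ^ s) ^ (N + 1) * 2 ^ (2 * (c₀ * s ^ 2 + 2)) := by gcongr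
    _ = 2 ^ (s * (N + 1) + 2 * (c₀ * s ^ 2 + 2)) := by rw [← pow_mul, ← pow_add]
    _ ≤ 2 ^ (s * N * 2) := by
        refine Nat.pow_le_pow_right two_pos ?_
        have hN : s * N = κ.rounds * s ^ 2 := by ring
        nlinarith
    _ = (2 ^ (s * N)) ^ 2 := by rw [pow_mul]

theorem crowdingRisk_eq_zero (h : n ≤ κ.rounds * sqrtLg n) : crowdingRisk κ n = 0 := if_pos h

theorem broadcastRisk_le (hn : 2 ≤ n) :
    broadcastRisk κ n (2⁻¹ ^ ((c₀ + 1 + 4 * (1 + 2 * κ.rounds)) * lg n)) ≤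
      2⁻¹ ^ (c₀ * lg n + 2) := by
  have hL : 1 ≤ lg n := Nat.clog_pos (by norm_num) hn
  have hcast : (sqrtLg n : ℝ≥0∞) + 2 * (κ.rounds * sqrtLg n : ℕ) =
      (sqrtLg n + 2 * (κ.rounds * sqrtLg n) : ℕ) := by push_cast; ring
  rw [broadcastRisk, hcast]
  refine natCast_mul_inv_two_pow_le ?_
  calc (sqrtLg n + 2 * (κ.rounds * sqrtLg n)) * 2 ^ (c₀ * lg n + 2)
      = 4 * (1 + 2 * κ.rounds) * sqrtLg n * 2 ^ (c₀ * lg n) := by rw [pow_add]; ring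
    _ ≤ 2 ^ (4 * (1 + 2 * κ.rounds)) * 2 ^ lg n * 2 ^ (c₀ * lg n) := by
        gcongr
        · exact Nat.lt_two_pow_self.le
        · exact sqrtLg_le_two_pow_lg n
    _ = 2 ^ (4 * (1 + 2 * κ.rounds) + lg n + c₀ * lg n) := by rw [← pow_add, ← pow_add]
    _ ≤ 2 ^ ((c₀ + 1 + 4 * (1 + 2 * κ.rounds)) * lg n) :=
        Nat.pow_le_pow_right two_pos (by nlinarith)

theorem oversightRisk_le {β : ℕ} (hbits : κ.bits = 16 * β)
    (hβ : 4 * κ.rounds * κ.cand ^ 2 * 2 ^ ((3 + c₀) * lg n) ≤ 2 ^ (5 * β * lg n)) :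
    oversightRisk κ n ≤ 2⁻¹ ^ (c₀ * lg n + 2) := by
  have hmiss : (2⁻¹ + 2⁻¹ * (7 / 8) ^ 4 : ℝ≥0∞) ^ (κ.bits * lg n) ≤ 2⁻¹ ^ (5 * β * lg n) := by
    rw [hbits, mul_assoc, pow_mul, mul_assoc 5, pow_mul 2⁻¹ 5]
    exact pow_le_pow_left₀ bot_le missFactor_pow_le _
  have hcount : κ.rounds * sqrtLg n * (κ.cand * lg n) ^ 2 * 2 ^ (c₀ * lg n + 2) ≤
      2 ^ (5 * β * lg n) :=
    calc κ.rounds * sqrtLg n * (κ.cand * lg n) ^ 2 * 2 ^ (c₀ * lg n + 2)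
        = 4 * κ.rounds * κ.cand ^ 2 * (sqrtLg n * lg n * lg n * 2 ^ (c₀ * lg n)) := by
          rw [pow_add]; ring
      _ ≤ 4 * κ.rounds * κ.cand ^ 2 * (2 ^ lg n * 2 ^ lg n * 2 ^ lg n * 2 ^ (c₀ * lg n)) := by
          gcongr
          exacts [sqrtLg_le_two_pow_lg n, lg_le_two_pow_lg n, lg_le_two_pow_lg n]
      _ = 4 * κ.rounds * κ.cand ^ 2 * 2 ^ ((3 + c₀) * lg n) := by ring
      _ ≤ 2 ^ (5 * β * lg n) := hβ
  calc oversightRisk κ n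
      ≤ (κ.rounds * sqrtLg n : ℕ) * (((κ.cand * lg n : ℕ) : ℝ≥0∞) ^ 2 * 2⁻¹ ^ (5 * β * lg n)) := by
        rw [oversightRisk]; gcongr
    _ = (κ.rounds * sqrtLg n * (κ.cand * lg n) ^ 2 : ℕ) * 2⁻¹ ^ (5 * β * lg n) := by
        push_cast; ring
    _ ≤ 2⁻¹ ^ (c₀ * lg n + 2) := natCast_mul_inv_two_pow_le hcount

theorem four_mul_inv_two_pow_add_two (e : ℕ) : (4 : ℝ≥0∞) * 2⁻¹ ^ (e + 2) = 2⁻¹ ^ e := by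
  have hfour : (4 : ℝ≥0∞) * 2⁻¹ ^ 2 = 1 := by
    rw [show (4 : ℝ≥0∞) = 2 ^ 2 by norm_num, ← mul_pow,
      ENNReal.mul_inv_cancel (by norm_num) (by norm_num), one_pow]
  rw [add_comm, pow_add, ← mul_assoc, hfour, one_mul]

theorem electionRisk_le {ε : ℝ≥0∞} (hn : 2 ≤ n) (hcand : c₀ + 2 ≤ κ.cand)
    (hcrowd : crowdingRisk κ n ≤ 2⁻¹ ^ (c₀ * lg n + 2))
    (hbroadcast : broadcastRisk κ n ε ≤ 2⁻¹ ^ (c₀ * lg n + 2))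
    (hoversight : oversightRisk κ n ≤ 2⁻¹ ^ (c₀ * lg n + 2)) :
    electionRisk κ n ε ≤ 2⁻¹ ^ (c₀ * lg n) := by
  have hL : 1 ≤ lg n := Nat.clog_pos (by norm_num) hn
  have hnone : (2⁻¹ : ℝ≥0∞) ^ (κ.cand * lg n) ≤ 2⁻¹ ^ (c₀ * lg n + 2) :=
    pow_le_pow_of_le_one bot_le (by simp) (by nlinarith)
  calc electionRisk κ n ε ≤ 2⁻¹ ^ (c₀ * lg n + 2) + 2⁻¹ ^ (c₀ * lg n + 2) +
        (2⁻¹ ^ (c₀ * lg n + 2) + 2⁻¹ ^ (c₀ * lg n + 2)) :=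
        add_le_add (add_le_add hnone hcrowd) (add_le_add hbroadcast hoversight)
    _ = 4 * 2⁻¹ ^ (c₀ * lg n + 2) := by ring
    _ = 2⁻¹ ^ (c₀ * lg n) := four_mul_inv_two_pow_add_two _

end Risk

theorem electsLeader_of_constants {α β γ c₀ n₀ : ℕ} {c : ℝ} (hc : c ≤ c₀) (hn₀ : 2 ≤ n₀)
    (hα : c₀ + 2 ≤ α) (hβ1 : 1 ≤ β) (hγ1 : 1 ≤ γ)
    (hβ : ∀ n, n₀ ≤ n → 4 * γ * α ^ 2 * 2 ^ ((3 + c₀) * lg n) ≤ 2 ^ (5 * β * lg n))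
    (hγ : ∀ n, n₀ ≤ n → n ≤ γ * sqrtLg n ∨ (α * sqrtLg n ^ 2) ^ 2 ≤ 2 ^ sqrtLg n ∧
      2 * c₀ * sqrtLg n ^ 2 + 4 + sqrtLg n ≤ γ * sqrtLg n ^ 2) :
    ElectsLeader ⟨α, 16 * β, γ⟩ c n₀ := by
  refine electsLeader_of_electionRisk_le (c₀ := c₀) (c' := c₀ + 1 + 4 * (1 + 2 * γ))
    (Nat.mul_pos (by norm_num) hβ1) hγ1 hc (by omega) hn₀ fun n hn => ?_
  refine electionRisk_le (hn₀.trans hn) hα ?_ (broadcastRisk_le (hn₀.trans hn))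
    (oversightRisk_le rfl (hβ n hn))
  rcases hγ n hn with h | ⟨hbase, hrounds⟩
  · exact (crowdingRisk_eq_zero h).trans_le bot_le
  · exact crowdingRisk_le hbase hrounds

theorem exists_sq_le_two_pow (α : ℕ) : ∃ s₀, ∀ s ≥ s₀, (α * s ^ 2) ^ 2 ≤ 2 ^ s := by
  have hlim := tendsto_pow_const_div_const_pow_of_one_lt 4 (r := (2 : ℝ)) (by norm_num)
  have hpos : (0 : ℝ) < 1 / ((α : ℝ) ^ 2 + 1) := by positivity
  obtain ⟨s₀, hs₀⟩ := Filter.eventually_atTop.1 (hlim.eventually (gt_mem_nhds hpos))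
  refine ⟨s₀, fun s hs => ?_⟩
  have hquot := hs₀ s hs
  rw [div_lt_div_iff₀ (by positivity) (by positivity), one_mul] at hquot
  have hreal : ((α * s ^ 2) ^ 2 : ℝ) ≤ 2 ^ s := by
    have _ : (0 : ℝ) ≤ (s : ℝ) ^ 4 := by positivity
    nlinarith
  exact_mod_cast hreal

theorem le_lg_of_two_pow_le {n k : ℕ} (h : 2 ^ k ≤ n) : k ≤ lg n := by
  simpa only [lg, Nat.clog_pow 2 _ one_lt_two] using Nat.clog_mono_right 2 h

theorem le_sqrtLg_of_two_pow_sq_le {n s : ℕ} (h : 2 ^ s ^ 2 ≤ n) : s ≤ sqrtLg n :=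
  (Nat.pow_le_pow_iff_left two_ne_zero).1 ((le_lg_of_two_pow_le h).trans (lg_le_sqrtLg_sq n))

theorem electsLeader_four_sixteen_three : ∃ n₀ : ℕ, 2 ≤ n₀ ∧ ElectsLeader ⟨4, 16, 3⟩ 1 n₀ := by
  obtain ⟨s₀, hs₀⟩ := exists_sq_le_two_pow 4
  have hn₀ : 2 ≤ 2 ^ (s₀ + 3) ^ 2 := Nat.le_self_pow (by positivity) 2
  have hs : ∀ n, 2 ^ (s₀ + 3) ^ 2 ≤ n → s₀ + 3 ≤ sqrtLg n := fun n => le_sqrtLg_of_two_pow_sq_le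
  refine ⟨2 ^ (s₀ + 3) ^ 2, hn₀, electsLeader_of_constants (β := 1) (c₀ := 1) (by norm_num) hn₀
    (by norm_num) le_rfl (by norm_num) (fun n hn => ?_) fun n hn => Or.inr ⟨?_, ?_⟩⟩
  · have hL : 8 ≤ lg n := by
      have _ : (s₀ + 3) ^ 2 ≤ lg n := le_lg_of_two_pow_le hn
      have _ : 3 ^ 2 ≤ (s₀ + 3) ^ 2 := Nat.pow_le_pow_left (Nat.le_add_left 3 s₀) 2
      omega
    calc 4 * 3 * 4 ^ 2 * 2 ^ ((3 + 1) * lg n) ≤ 2 ^ 8 * 2 ^ ((3 + 1) * lg n) := by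
          gcongr; norm_num
      _ = 2 ^ (8 + (3 + 1) * lg n) := by rw [← pow_add]
      _ ≤ 2 ^ (5 * 1 * lg n) := Nat.pow_le_pow_right two_pos (by omega)
  · exact hs₀ _ (by have := hs n hn; omega)
  · have := hs n hn
    nlinarith

-- `γ ≥ 2 ^ s₀ ^ 2` covers the networks with `sqrtLg n < s₀`, in which all nodes may be candidates.
theorem exists_electsLeader (c : ℝ) : ∃ κ : Constants, ElectsLeader κ c 2 := by
  set c₀ := ⌈c⌉₊
  set α := c₀ + 2
  obtain ⟨s₀, hs₀⟩ := exists_sq_le_two_pow α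
  set γ := 2 ^ s₀ ^ 2 + (2 * c₀ + 5)
  set β := c₀ + 3 + 4 * γ * α ^ 2 with hβ
  refine ⟨⟨α, 16 * β, γ⟩, electsLeader_of_constants (c₀ := c₀) (Nat.le_ceil c) le_rfl le_rfl
    (by omega) (Nat.le_add_left_of_le (by omega)) (fun n hn => ?_) fun n hn => ?_⟩
  · have hL : 1 ≤ lg n := Nat.clog_pos (by norm_num) hn
    calc 4 * γ * α ^ 2 * 2 ^ ((3 + c₀) * lg n)
        ≤ 2 ^ (4 * γ * α ^ 2) * 2 ^ ((3 + c₀) * lg n) := by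
          gcongr; exact Nat.lt_two_pow_self.le
      _ = 2 ^ (4 * γ * α ^ 2 + (3 + c₀) * lg n) := by rw [← pow_add]
      _ ≤ 2 ^ (5 * β * lg n) := by
          have _ : 4 * γ * α ^ 2 ≤ 4 * γ * α ^ 2 * lg n := Nat.le_mul_of_pos_right _ hL
          refine Nat.pow_le_pow_right two_pos ?_
          calc 4 * γ * α ^ 2 + (3 + c₀) * lg n
              ≤ 4 * γ * α ^ 2 * lg n + (3 + c₀) * lg n := by gcongr
            _ = β * lg n := by rw [hβ]; ring
            _ ≤ 5 * β * lg n := by gcongr; omega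
  · rcases Nat.lt_or_ge (sqrtLg n) s₀ with h | h
    · left
      calc n ≤ 2 ^ lg n := le_two_pow_lg n
        _ ≤ 2 ^ s₀ ^ 2 := Nat.pow_le_pow_right two_pos
            ((lg_le_sqrtLg_sq n).trans (Nat.pow_le_pow_left h.le 2))
        _ ≤ γ := Nat.le_add_right _ _
        _ ≤ γ * sqrtLg n := Nat.le_mul_of_pos_right _ (one_le_sqrtLg hn)
    · refine Or.inr ⟨hs₀ _ h, ?_⟩
      have hs1 := one_le_sqrtLg hn
      calc 2 * c₀ * sqrtLg n ^ 2 + 4 + sqrtLg n ≤ (2 * c₀ + 5) * sqrtLg n ^ 2 := by nlinarith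
        _ ≤ γ * sqrtLg n ^ 2 := Nat.mul_le_mul_right _ (Nat.le_add_left _ _)

end RadioNetwork

theorem theorem2 :
    -- the constants `4`, `16`, `3`, with error probability `1 / n`, on all large enough networks
    (∃ n₀ : ℕ, 2 ≤ n₀ ∧ RadioNetwork.ElectsLeader ⟨4, 16, 3⟩ 1 n₀) ∧
    -- any error exponent `c`, with constants that depend on `c` only, on all networks
    (∀ c : ℝ, 1 ≤ c → ∃ κ : RadioNetwork.Constants, RadioNetwork.ElectsLeader κ c 2) :=
  ⟨RadioNetwork.electsLeader_four_sixteen_three,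
    fun c _ => RadioNetwork.exists_electsLeader c⟩
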